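/- Let $U\subset\mathbb R^2$ be a non-empty connected open set with coordinates $(x,y)$, $I\subset\mathbb R$ a non-empty open interval with coordinate $z$, and $M=U\times I$. Let $h$ be a smooth metric of arbitrary signature on $U$ (symmetric and non-degenerate), $\rho\in\mathbb R$, $Z\colon I\to\mathbb R$ smooth with $\zeta:=Z-\rho$ nowhere zero, and $$g=\zeta(z)\,(h+dz^2).$$ Let $u=v^1(x,y)\partial_x+v^2(x,y)\partial_y$ be a smooth vector field on $U$, $\alpha\colon I\to\mathbb R$ a smooth function, and $v=u+\alpha(z)\partial_z$. The field $v$ is called projective for $g$ if its local flow maps unparametrised geodesics of $g$ (curves with $\nabla_{\dot\gamma}\dot\gamma=f\dot\gamma$ for some function $f$) to unparametrised geodesics of $g$. Put $\sigma^{ij}=|\det g|^{1/4}g^{ij}$, a section of $S^2(TM)\otimes(\Lambda^3T^*M)^{1/2}$, and $\bar\sigma=L\sigma$ with $L=\rho(\partial_x\otimes dx+\partial_y\otimes dy)+Z(z)\,\partial_z\otimes dz$. (If $\rho$ and $Z$ have no zeros, $\bar\sigma=|\det\bar g|^{1/4}\bar g^{-1}$ for the metric $\bar g=\frac{\zeta}{|Z|\rho^2}\big(\frac{h}{\rho}+\frac{dz^2}{Z}\big)$,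 which is projectively equivalent to $g$.) Say that $v$ acts by $A=\begin{pmatrix}a&b\\c&d\end{pmatrix}\in\mathbb R^{2\times2}$ if $$\mathcal L_v\sigma=a\sigma+b\bar\sigma,\qquad \mathcal L_v\bar\sigma=c\sigma+d\bar\sigma .$$ (i) Suppose that $g$ is not of constant (sectional) curvature and that $v$ is projective for $g$. Then $v$ acts by exactly one matrix $A$, and $u$ is homothetic for $h$, namely $$\mathcal L_uh=-C\,h,\qquad C=2b\rho+3a+d .$$ (ii) Conversely, suppose that $\mathcal L_uh=-C\,h$ for a constant $C\in\mathbb R$ (with no assumption on the curvature of $g$). Then $v$ is projective for $g$ if and only if $v$ acts by exactly one matrix $A$, $C=2b\rho+3a+d$, and, with $B=a+d$, $$-2\alpha'=C+b\,\zeta,\qquad \alpha\,\zeta'=-b\,\zeta^2+(2B-C)\,\zeta\qquad\text{on }I .$$ Moreover, if these two equations hold on $I$ for some constants $b,B\in\mathbb R$, then $v$ is projective for $g$. -/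

import Mathlib

open scoped ContDiff

namespace LeviCivita21

section Coordinates

/-! Differential geometry in coordinates on an open subset `M` of `ι → ℝ`. A metric is given by the
matrix of its components, a vector field by the tuple of its components. -/

variable {ι : Type} [Fintype ι] [DecidableEq ι]

/-- The partial derivative of `f` in the direction of the `k`-th coordinate. -/
noncomputable def pd (k : ι) (f : (ι → ℝ) → ℝ) (p : ι → ℝ) : ℝ :=
  fderiv ℝ f p (Pi.single k 1)

/-- A (pseudo-Riemannian) metric of arbitrary signature on `M`: smooth, symmetric,
non-degenerate. -/
structure IsMetricOn (M : Set (ι → ℝ)) (g : (ι → ℝ) → Matrix ι ι ℝ) : Prop where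
  smooth : ∀ i j, ContDiffOn ℝ ∞ (fun p => g p i j) M
  symm : ∀ p ∈ M, (g p).IsSymm
  nondeg : ∀ p ∈ M, (g p).det ≠ 0

/-- The Christoffel symbol `Γ^k_{ij}` of the Levi-Civita connection of `g`. -/
noncomputable def christoffel (g : (ι → ℝ) → Matrix ι ι ℝ) (k i j : ι) (p : ι → ℝ) : ℝ :=
  (1 / 2) * ∑ l, (g p)⁻¹ k l *
    (pd i (fun q => g q j l) p + pd j (fun q => g q i l) p - pd l (fun q => g q i j) p)

/-- The component `R^l_{kij}` of the curvature tensor, `R(∂_i, ∂_j) ∂_k = R^l_{kij} ∂_l`. -/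
noncomputable def riemann (g : (ι → ℝ) → Matrix ι ι ℝ) (l k i j : ι) (p : ι → ℝ) : ℝ :=
  pd i (christoffel g l j k) p - pd j (christoffel g l i k) p +
    ∑ m, (christoffel g l i m p * christoffel g m j k p -
      christoffel g l j m p * christoffel g m i k p)

/-- The inner product `g_p(X, Y)`. -/
def metricInner (g : (ι → ℝ) → Matrix ι ι ℝ) (p X Y : ι → ℝ) : ℝ :=
  ∑ i, ∑ j, g p i j * X i * Y j

/-- The tangent vector `R(X, Y) W` at `p`. -/
noncomputable def curvature (g : (ι → ℝ) → Matrix ι ι ℝ) (p X Y W : ι → ℝ) : ι → ℝ :=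
  fun l => ∑ k, ∑ i, ∑ j, riemann g l k i j p * W k * X i * Y j

/-- `g(X, X) g(Y, Y) - g(X, Y)²`; it is non-zero if and only if `X` and `Y` span a plane on which
`g` is non-degenerate. -/
def gram (g : (ι → ℝ) → Matrix ι ι ℝ) (p X Y : ι → ℝ) : ℝ :=
  metricInner g p X X * metricInner g p Y Y - metricInner g p X Y ^ 2

/-- The sectional curvature of the (non-degenerate) plane spanned by `X` and `Y`. -/
noncomputable def sectional (g : (ι → ℝ) → Matrix ι ι ℝ) (p X Y : ι → ℝ) : ℝ :=
  metricInner g p (curvature g p X Y Y) X / gram g p X Y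

/-- All sectional curvatures of `g` on `M` are equal to one and the same constant. -/
def HasConstantCurvature (M : Set (ι → ℝ)) (g : (ι → ℝ) → Matrix ι ι ℝ) : Prop :=
  ∃ κ : ℝ, ∀ p ∈ M, ∀ X Y : ι → ℝ, gram g p X Y ≠ 0 → sectional g p X Y = κ

/-- The acceleration `∇_{γ'} γ'` of a curve at time `t`. -/
noncomputable def acceleration (g : (ι → ℝ) → Matrix ι ι ℝ) (γ : ℝ → ι → ℝ) (t : ℝ) : ι → ℝ :=
  fun k => deriv (deriv γ) t k +
    ∑ i, ∑ j, christoffel g k i j (γ t) * deriv γ t i * deriv γ t j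

/-- The smooth curve `γ : (r, s) → M` is an unparametrised geodesic of `g`:
`∇_{γ'} γ' = f γ'` for some function `f`. -/
def IsUnparamGeodesic (g : (ι → ℝ) → Matrix ι ι ℝ) (M : Set (ι → ℝ)) (r s : ℝ)
    (γ : ℝ → ι → ℝ) : Prop :=
  ContDiffOn ℝ ∞ γ (Set.Ioo r s) ∧ (∀ t ∈ Set.Ioo r s, γ t ∈ M) ∧
    ∃ f : ℝ → ℝ, ∀ t ∈ Set.Ioo r s, acceleration g γ t = f t • deriv γ t

/-- `φ t`, for `|t| < ε`, is a smooth local flow of the vector field `v`, defined on the open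
subset `V` of `M` and with values in `M`. -/
structure IsLocalFlow (M : Set (ι → ℝ)) (v : (ι → ℝ) → ι → ℝ) (ε : ℝ) (V : Set (ι → ℝ))
    (φ : ℝ → (ι → ℝ) → ι → ℝ) : Prop where
  isOpen : IsOpen V
  subset : V ⊆ M
  smooth : ContDiffOn ℝ ∞ (fun x : ℝ × (ι → ℝ) => φ x.1 x.2) (Set.Ioo (-ε) ε ×ˢ V)
  mem : ∀ t ∈ Set.Ioo (-ε) ε, ∀ p ∈ V, φ t p ∈ M
  zero : ∀ p ∈ V, φ 0 p = p
  hasDerivAt : ∀ t ∈ Set.Ioo (-ε) ε, ∀ p ∈ V, HasDerivAt (fun t' => φ t' p) (v (φ t p)) t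

/-- The vector field `v` is projective for the metric `g` on `M`: its local flow sends
unparametrised geodesics to unparametrised geodesics. (The maps of a smooth local flow are
automatically diffeomorphisms onto their images.) -/
def IsProjective (M : Set (ι → ℝ)) (g : (ι → ℝ) → Matrix ι ι ℝ) (v : (ι → ℝ) → ι → ℝ) : Prop :=
  ∀ (ε : ℝ) (V : Set (ι → ℝ)) (φ : ℝ → (ι → ℝ) → ι → ℝ), 0 < ε → IsLocalFlow M v ε V φ →
    ∀ t ∈ Set.Ioo (-ε) ε, ∀ (r s : ℝ) (γ : ℝ → ι → ℝ),
      IsUnparamGeodesic g V r s γ → IsUnparamGeodesic g M r s (fun τ => φ t (γ τ))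

/-- The Lie derivative `(L_v g)_{ij}` of a metric. -/
noncomputable def lieMetric (v : (ι → ℝ) → ι → ℝ) (g : (ι → ℝ) → Matrix ι ι ℝ) (p : ι → ℝ) :
    Matrix ι ι ℝ :=
  Matrix.of fun i j => ∑ k, (v p k * pd k (fun q => g q i j) p +
    pd i (fun q => v q k) p * g p k j + pd j (fun q => v q k) p * g p i k)

/-- The weighted tensor `σ^{ij} = |det g|^{1/(n+1)} g^{ij}` of a metric `g`, a section of
`S²(TM) ⊗ (Λⁿ T*M)^{2/(n+1)}`. -/
noncomputable def weightedInverse (g : (ι → ℝ) → Matrix ι ι ℝ) (p : ι → ℝ) : Matrix ι ι ℝ :=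
  |(g p).det| ^ (1 / ((Fintype.card ι : ℝ) + 1)) • (g p)⁻¹

/-- The Lie derivative of a section `σ^{ij}` of `S²(TM) ⊗ (Λⁿ T*M)^{2/(n+1)}`. -/
noncomputable def lieWeighted (v : (ι → ℝ) → ι → ℝ) (σ : (ι → ℝ) → Matrix ι ι ℝ) (p : ι → ℝ) :
    Matrix ι ι ℝ :=
  Matrix.of fun i j => ∑ k, (v p k * pd k (fun q => σ q i j) p -
    pd k (fun q => v q i) p * σ p k j - pd k (fun q => v q j) p * σ p i k +
    2 / ((Fintype.card ι : ℝ) + 1) * pd k (fun q => v q k) p * σ p i j)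

/-- `A = !![a, b; c, d]` is the matrix of `L_v` on the pair `(σ, σ')`:
`L_v σ = a σ + b σ'` and `L_v σ' = c σ + d σ'` on `M`. -/
def LieActsBy (M : Set (ι → ℝ)) (v : (ι → ℝ) → ι → ℝ) (σ σ' : (ι → ℝ) → Matrix ι ι ℝ)
    (A : Matrix (Fin 2) (Fin 2) ℝ) : Prop :=
  ∀ p ∈ M, lieWeighted v σ p = A 0 0 • σ p + A 0 1 • σ' p ∧
    lieWeighted v σ' p = A 1 0 • σ p + A 1 1 • σ' p

end Coordinates

/-! Points of the product `U × I` are written as `p : Fin 2 ⊕ Fin 1 → ℝ`, with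
`p (Sum.inl 0) = x`, `p (Sum.inl 1) = y` and `p (Sum.inr 0) = z`. -/

/-- The product of `U ⊆ ℝ²` and `I ⊆ ℝ`. -/
def prodDomain (U : Set (Fin 2 → ℝ)) (I : Set ℝ) : Set (Fin 2 ⊕ Fin 1 → ℝ) :=
  {p | p ∘ Sum.inl ∈ U ∧ p (Sum.inr 0) ∈ I}

/-- The metric `ζ(z) (h + dz²)`. -/
def metric21 (h : (Fin 2 → ℝ) → Matrix (Fin 2) (Fin 2) ℝ) (ζ : ℝ → ℝ)
    (p : Fin 2 ⊕ Fin 1 → ℝ) : Matrix (Fin 2 ⊕ Fin 1) (Fin 2 ⊕ Fin 1) ℝ :=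
  ζ (p (Sum.inr 0)) • Matrix.fromBlocks (h (p ∘ Sum.inl)) 0 0 1

/-- The vector field `v = u + α(z) ∂_z`, where `u = v¹(x,y) ∂_x + v²(x,y) ∂_y`. -/
def field21 (u : (Fin 2 → ℝ) → Fin 2 → ℝ) (α : ℝ → ℝ) (p : Fin 2 ⊕ Fin 1 → ℝ) :
    Fin 2 ⊕ Fin 1 → ℝ :=
  Sum.elim (u (p ∘ Sum.inl)) (fun _ => α (p (Sum.inr 0)))

/-- The metric `ζ / (|Z| ρ²) (h / ρ + dz² / Z)`, with `ζ = Z - ρ`, which is projectively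
equivalent to `ζ (h + dz²)` where `ρ`, `Z` and `ζ` do not vanish. -/
noncomputable def companion21 (h : (Fin 2 → ℝ) → Matrix (Fin 2) (Fin 2) ℝ) (ρ : ℝ) (Z : ℝ → ℝ)
    (p : Fin 2 ⊕ Fin 1 → ℝ) : Matrix (Fin 2 ⊕ Fin 1) (Fin 2 ⊕ Fin 1) ℝ :=
  ((Z (p (Sum.inr 0)) - ρ) / (|Z (p (Sum.inr 0))| * ρ ^ 2)) •
    Matrix.fromBlocks (ρ⁻¹ • h (p ∘ Sum.inl)) 0 0 ((Z (p (Sum.inr 0)))⁻¹ • 1)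

/-- The `(1,1)`-tensor `L = ρ (∂_x ⊗ dx + ∂_y ⊗ dy) + Z(z) ∂_z ⊗ dz`. Where `ρ` and `Z` do not
vanish, and `ζ = Z - ρ`, it is the Benenti tensor of `g = ζ (h + dz²)` and `companion21`. -/
def benenti21 (ρ : ℝ) (Z : ℝ → ℝ) (p : Fin 2 ⊕ Fin 1 → ℝ) :
    Matrix (Fin 2 ⊕ Fin 1) (Fin 2 ⊕ Fin 1) ℝ :=
  Matrix.fromBlocks (ρ • 1) 0 0 (Z (p (Sum.inr 0)) • 1)

/-- The weighted tensor `σ` of the metric `(Z(z) - ρ) (h + dz²)`. -/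
noncomputable def sigma21 (h : (Fin 2 → ℝ) → Matrix (Fin 2) (Fin 2) ℝ) (ρ : ℝ) (Z : ℝ → ℝ) :
    (Fin 2 ⊕ Fin 1 → ℝ) → Matrix (Fin 2 ⊕ Fin 1) (Fin 2 ⊕ Fin 1) ℝ :=
  weightedInverse (metric21 h fun z => Z z - ρ)

/-- The second weighted tensor `σ' = L σ`, so that `σ' σ⁻¹ = L`. It is the weighted tensor of
`companion21` where `ρ` and `Z` do not vanish, and it is of lower rank where one of them does. -/
noncomputable def sigmaBar21 (h : (Fin 2 → ℝ) → Matrix (Fin 2) (Fin 2) ℝ) (ρ : ℝ) (Z : ℝ → ℝ)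
    (p : Fin 2 ⊕ Fin 1 → ℝ) : Matrix (Fin 2 ⊕ Fin 1) (Fin 2 ⊕ Fin 1) ℝ :=
  benenti21 ρ Z p * sigma21 h ρ Z p

/-- Where `ρ`, `Z`, `ζ` and `det h` do not vanish, `σ'` is the weighted tensor of `companion21`. -/
theorem sigmaBar21_eq_weightedInverse_companion21 (h : (Fin 2 → ℝ) → Matrix (Fin 2) (Fin 2) ℝ)
    (ρ : ℝ) (Z : ℝ → ℝ) (p : Fin 2 ⊕ Fin 1 → ℝ) (hρ : ρ ≠ 0) (hZ : Z (p (Sum.inr 0)) ≠ 0)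
    (hζ : Z (p (Sum.inr 0)) - ρ ≠ 0) (hh : (h (p ∘ Sum.inl)).det ≠ 0) :
    sigmaBar21 h ρ Z p = weightedInverse (companion21 h ρ Z) p := by
  unfold sigmaBar21 sigma21 weightedInverse companion21 metric21 benenti21
  beta_reduce
  generalize Z (p (Sum.inr 0)) = w at *
  generalize h (p ∘ Sum.inl) = H at *
  have hw : |w| ≠ 0 := abs_ne_zero.mpr hZ
  have e1 : ((w - ρ) • Matrix.fromBlocks H 0 0 (1 : Matrix (Fin 1) (Fin 1) ℝ))⁻¹ =
      Matrix.fromBlocks ((w - ρ)⁻¹ • H⁻¹) 0 0 ((w - ρ)⁻¹ • 1) := by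
    apply Matrix.inv_eq_left_inv
    simp [Matrix.fromBlocks_smul, Matrix.fromBlocks_multiply, smul_smul, hζ,
      Matrix.nonsing_inv_mul H (isUnit_iff_ne_zero.mpr hh)]
  have e2 : (((w - ρ) / (|w| * ρ ^ 2)) •
      Matrix.fromBlocks (ρ⁻¹ • H) 0 0 (w⁻¹ • (1 : Matrix (Fin 1) (Fin 1) ℝ)))⁻¹ =
      Matrix.fromBlocks (((w - ρ)⁻¹ * (|w| * ρ ^ 2) * ρ) • H⁻¹) 0 0
        (((w - ρ)⁻¹ * (|w| * ρ ^ 2) * w) • 1) := by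
    apply Matrix.inv_eq_left_inv
    simp only [Matrix.fromBlocks_smul, Matrix.fromBlocks_multiply, smul_smul, Matrix.smul_mul,
      Matrix.mul_smul, Matrix.nonsing_inv_mul H (isUnit_iff_ne_zero.mpr hh), Matrix.mul_zero,
      Matrix.zero_mul, smul_zero, add_zero, zero_add, Matrix.mul_one]
    have k1 : (w - ρ) / (|w| * ρ ^ 2) * ρ⁻¹ * ((w - ρ)⁻¹ * (|w| * ρ ^ 2) * ρ) = 1 := by
      field_simp
    have k2 : (w - ρ) / (|w| * ρ ^ 2) * w⁻¹ * ((w - ρ)⁻¹ * (|w| * ρ ^ 2) * w) = 1 := by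
      field_simp
    rw [k1, k2, one_smul, one_smul, Matrix.fromBlocks_one]
  have d1 : |((w - ρ) • Matrix.fromBlocks H 0 0 (1 : Matrix (Fin 1) (Fin 1) ℝ)).det| =
      |(((w - ρ) / (|w| * ρ ^ 2)) •
        Matrix.fromBlocks (ρ⁻¹ • H) 0 0 (w⁻¹ • (1 : Matrix (Fin 1) (Fin 1) ℝ))).det| *
      (|w| * ρ ^ 2) ^ 4 := by
    simp only [Matrix.det_smul, Matrix.det_fromBlocks_zero₂₁, Fintype.card_sum, Fintype.card_fin,
      abs_mul, abs_pow, abs_div, abs_inv, Matrix.det_one, abs_one, abs_abs]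
    rw [← sq_abs ρ]
    have hr : |ρ| ≠ 0 := abs_ne_zero.mpr hρ
    norm_num only [div_pow]
    field_simp
  have hc : 0 ≤ |w| * ρ ^ 2 := by positivity
  rw [e1, e2, d1, Real.mul_rpow (abs_nonneg _) (by positivity)]
  have k : ((|w| * ρ ^ 2) ^ 4) ^ (1 / ((Fintype.card (Fin 2 ⊕ Fin 1) : ℝ) + 1)) =
      |w| * ρ ^ 2 := by
    have : (1 / ((Fintype.card (Fin 2 ⊕ Fin 1) : ℝ) + 1)) = ((4 : ℕ) : ℝ)⁻¹ := by
      simp; norm_num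
    rw [this, Real.pow_rpow_inv_natCast hc (by norm_num)]
  rw [k, Matrix.mul_smul, mul_smul, Matrix.fromBlocks_multiply, Matrix.fromBlocks_smul]
  congr 1
  ext i j
  rcases i with i | i <;> rcases j with j | j <;> simp <;> ring

end LeviCivita21

set_option linter.unusedSectionVars false

namespace LeviCivita21

section SmoothFlow

open Set Filter Topology

universe w

variable {K : Type*} [TopologicalSpace K] [CompactSpace K]

/-- A field of continuous linear maps over a compact space acts on continuous functions. -/
noncomputable def pointwiseCLM (K : Type*) [TopologicalSpace K] [CompactSpace K]
    (E F : Type*) [NormedAddCommGroup E] [NormedSpace ℝ E]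
    [NormedAddCommGroup F] [NormedSpace ℝ F] :
    C(K, E →L[ℝ] F) →L[ℝ] C(K, E) →L[ℝ] C(K, F) :=
  LinearMap.mkContinuous₂
    (LinearMap.mk₂ ℝ (fun (L : C(K, E →L[ℝ] F)) (y : C(K, E)) =>
      (⟨fun k => L k (y k), by fun_prop⟩ : C(K, F)))
      (fun _ _ _ => by ext; simp) (fun _ _ _ => by ext; simp)
      (fun _ _ _ => by ext; simp) (fun _ _ _ => by ext; simp)) 1
    (fun L y => by
      rw [ContinuousMap.norm_le _ (by positivity)]
      intro k
      simp only [LinearMap.mk₂_apply, ContinuousMap.coe_mk, one_mul]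
      exact (L k).le_of_opNorm_le_of_le (L.norm_coe_le_norm k) (y.norm_coe_le_norm k))

@[simp] lemma pointwiseCLM_apply {E F : Type*} [NormedAddCommGroup E] [NormedSpace ℝ E]
    [NormedAddCommGroup F] [NormedSpace ℝ F] (L : C(K, E →L[ℝ] F)) (y : C(K, E)) (k : K) :
    pointwiseCLM K E F L y k = L k (y k) := rfl

/-- The superposition operator `y ↦ f ∘ y` is differentiable if `f` is `C¹`. -/
lemma hasFDerivAt_postcomp {E F : Type*} [NormedAddCommGroup E] [NormedSpace ℝ E]
    [NormedAddCommGroup F] [NormedSpace ℝ F] (f : C(E, F)) (f' : C(E, E →L[ℝ] F))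
    (hf : ∀ x, HasFDerivAt f (f' x) x) (y : C(K, E)) :
    HasFDerivAt (fun y : C(K, E) => f.comp y) (pointwiseCLM K E F (f'.comp y)) y := by
  rw [hasFDerivAt_iff_isLittleO_nhds_zero, Asymptotics.isLittleO_iff]
  intro c hc
  have hcont := (ContinuousMap.continuous_postcomp (X := K) f').tendsto y
  obtain ⟨δ, hδ, hball⟩ := Metric.eventually_nhds_iff_ball.1
    (hcont.eventually (Metric.ball_mem_nhds (f'.comp y) hc))
  filter_upwards [Metric.ball_mem_nhds (0 : C(K, E)) hδ] with η hη
  rw [ContinuousMap.norm_le _ (by positivity)]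
  intro k
  have key := Convex.norm_image_sub_le_of_norm_hasFDerivWithin_le' (𝕜 := ℝ) (f := f)
    (s := Metric.ball (y k) δ) (x := y k) (y := y k + η k) (f' := f') (φ := f' (y k)) (C := c)
    (fun x _ => (hf x).hasFDerivWithinAt) ?_ (convex_ball _ _) (Metric.mem_ball_self hδ) ?_
  · simp only [add_sub_cancel_left] at key
    simp only [ContinuousMap.sub_apply, ContinuousMap.comp_apply, ContinuousMap.add_apply,
      pointwiseCLM_apply]
    exact key.trans (by gcongr; exact η.norm_coe_le_norm k)
  · intro x hx
    have h1 := hball (y + ContinuousMap.const K (x - y k)) (by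
      rw [mem_ball_iff_norm, add_sub_cancel_left]
      refine lt_of_le_of_lt ((ContinuousMap.norm_le _ (norm_nonneg (x - y k))).2 ?_)
        (mem_ball_iff_norm.1 hx)
      intro _; simp)
    have h2 := (ContinuousMap.norm_coe_le_norm
      (f'.comp (y + ContinuousMap.const K (x - y k)) - f'.comp y) k).trans
      (mem_ball_iff_norm.1 h1).le
    simpa using h2
  · rw [mem_ball_iff_norm, add_sub_cancel_left]
    exact (η.norm_coe_le_norm k).trans_lt (by simpa using hη)

/-- The superposition operator of a `C^n` map is `C^n`. -/
lemma contDiff_postcomp_nat {E : Type w} [NormedAddCommGroup E] [NormedSpace ℝ E] (n : ℕ) :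
    ∀ {F : Type w} [NormedAddCommGroup F] [NormedSpace ℝ F] (f : C(E, F)), ContDiff ℝ n f →
      ContDiff ℝ n (fun y : C(K, E) => f.comp y) := by
  induction n with
  | zero =>
    intro F _ _ f _
    exact contDiff_zero.2 (ContinuousMap.continuous_postcomp f)
  | succ n ih =>
    intro F _ _ f hf
    push_cast at hf ⊢
    obtain ⟨f', hf', hd⟩ := contDiff_succ_iff_hasFDerivAt.1 hf
    rw [contDiff_succ_iff_hasFDerivAt]
    have hc : ContDiff ℝ n (pointwiseCLM K E F) := ContinuousLinearMap.contDiff _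
    exact ⟨fun y => pointwiseCLM K E F ((⟨f', hf'.continuous⟩ : C(E, E →L[ℝ] F)).comp y),
      hc.comp (ih ⟨f', hf'.continuous⟩ hf'),
      fun y => hasFDerivAt_postcomp f ⟨f', hf'.continuous⟩ hd y⟩

lemma contDiff_postcomp {E : Type w} [NormedAddCommGroup E] [NormedSpace ℝ E]
    {F : Type w} [NormedAddCommGroup F] [NormedSpace ℝ F] (f : C(E, F)) (hf : ContDiff ℝ ∞ f) :
    ContDiff ℝ ∞ (fun y : C(K, E) => f.comp y) :=
  contDiff_infty.2 fun n => contDiff_postcomp_nat n f (contDiff_infty.1 hf n)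

/-- A smooth implicit function is smooth in a neighbourhood of the base point. -/
lemma eventually_contDiffAt_implicitFunction {E₁ E₂ F : Type*}
    [NormedAddCommGroup E₁] [NormedSpace ℝ E₁] [CompleteSpace E₁]
    [NormedAddCommGroup E₂] [NormedSpace ℝ E₂] [CompleteSpace E₂]
    [NormedAddCommGroup F] [NormedSpace ℝ F] [CompleteSpace F]
    {f : E₁ × E₂ → F} {x₀ : E₁ × E₂} (hf : ContDiff ℝ ∞ f)
    (hinv : (fderiv ℝ f x₀ ∘L .inr ℝ E₁ E₂).IsInvertible) :
    ∀ᶠ x in 𝓝 x₀.1,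
      ContDiffAt ℝ ∞ (hf.contDiffAt.implicitFunction (by simp) hinv) x := by
  set ψ := hf.contDiffAt.implicitFunction (by simp) hinv with hψ
  have hn : (∞ : WithTop ℕ∞) ≠ 0 := by simp
  have h0 : ψ x₀.1 = x₀.2 := hf.contDiffAt.implicitFunction_apply_self hn hinv
  have hc1 : ContDiffAt ℝ 1 ψ x₀.1 :=
    (hf.contDiffAt.contDiffAt_implicitFunction hn hinv).of_le (by norm_cast)
  have hinvnear : ∀ᶠ x in 𝓝 x₀.1, (fderiv ℝ f (x, ψ x) ∘L .inr ℝ E₁ E₂).IsInvertible := by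
    have hcont : ContinuousAt (fun x => fderiv ℝ f (x, ψ x) ∘L .inr ℝ E₁ E₂) x₀.1 := by
      have h1 : Continuous (fderiv ℝ f) := hf.continuous_fderiv (by simp)
      have h2 : ContinuousAt (fun x => fderiv ℝ f (x, ψ x)) x₀.1 :=
        h1.continuousAt.comp (continuousAt_id.prodMk hc1.continuousAt)
      exact h2.clm_comp continuousAt_const
    refine hcont.eventually (ContinuousLinearEquiv.isOpen.mem_nhds ?_)
    simp only [h0]
    exact hinv
  filter_upwards [(hf.contDiffAt.eventually_apply_implicitFunction hn hinv).eventually_nhds,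
    hc1.eventually (by simp), hinvnear] with x hx1 hx2 hx3
  have key := hf.contDiffAt.eventually_apply_eq_iff_implicitFunction hn hx3
  have hs := hf.contDiffAt.contDiffAt_implicitFunction hn hx3
  refine hs.congr_of_eventuallyEq ?_
  have ht : Tendsto (fun x' => (x', ψ x')) (𝓝 x) (𝓝 (x, ψ x)) :=
    continuousAt_id.prodMk hx2.continuousAt
  filter_upwards [ht.eventually key, hx1] with x' h1 h2
  exact (h1.1 (h2.trans hx1.self_of_nhds.symm)).symm

/-- Integration from `0` as an operator on continuous functions on `[-1, 1]`. -/
noncomputable def primitiveCLM (E : Type*) [NormedAddCommGroup E] [NormedSpace ℝ E] :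
    C(Icc (-1 : ℝ) 1, E) →L[ℝ] C(Icc (-1 : ℝ) 1, E) :=
  LinearMap.mkContinuous
    { toFun := fun y => ⟨fun s => ∫ r in (0 : ℝ)..s, IccExtend (by norm_num) y r, by
        have hy : Continuous (IccExtend (by norm_num : (-1 : ℝ) ≤ 1) y) :=
          y.continuous.Icc_extend'
        exact (intervalIntegral.continuous_primitive
          (fun _ _ => hy.intervalIntegrable _ _) 0).comp continuous_subtype_val⟩
      map_add' := fun y y' => by
        ext s
        have hy : Continuous (IccExtend (by norm_num : (-1 : ℝ) ≤ 1) y) :=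
          y.continuous.Icc_extend'
        have hy' : Continuous (IccExtend (by norm_num : (-1 : ℝ) ≤ 1) y') :=
          y'.continuous.Icc_extend'
        exact intervalIntegral.integral_add (hy.intervalIntegrable _ _)
          (hy'.intervalIntegrable _ _)
      map_smul' := fun c y => by
        ext s
        exact intervalIntegral.integral_smul c _ }
    1 (fun y => by
      rw [ContinuousMap.norm_le _ (by positivity)]
      intro s
      refine (intervalIntegral.norm_integral_le_of_norm_le_const
        (C := ‖y‖) fun r _ => y.norm_coe_le_norm _).trans ?_
      rw [one_mul]
      refine mul_le_of_le_one_right (norm_nonneg y) ?_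
      rw [sub_zero, abs_le]
      exact s.2)

lemma primitiveCLM_apply {E : Type*} [NormedAddCommGroup E] [NormedSpace ℝ E]
    (y : C(Icc (-1 : ℝ) 1, E)) (s : Icc (-1 : ℝ) 1) :
    primitiveCLM E y s = ∫ r in (0 : ℝ)..s, IccExtend (by norm_num) y r := rfl

/-- The defect of the equation `y(s) = t ∫₀ˢ v(p + y(r)) dr`, whose solution is the displacement
along the integral curve of `t v` through `p`. -/
noncomputable def flowDefect {E : Type w} [NormedAddCommGroup E] [NormedSpace ℝ E] (v : C(E, E))
    (x : (ℝ × E) × C(Icc (-1 : ℝ) 1, E)) : C(Icc (-1 : ℝ) 1, E) :=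
  x.2 - x.1.1 • primitiveCLM E (v.comp (ContinuousLinearMap.const ℝ _ x.1.2 + x.2))

lemma contDiff_flowDefect {E : Type w} [NormedAddCommGroup E] [NormedSpace ℝ E] {v : C(E, E)}
    (hv : ContDiff ℝ ∞ v) : ContDiff ℝ ∞ (flowDefect v) := by
  unfold flowDefect
  have h1 := contDiff_postcomp (K := Icc (-1 : ℝ) 1) v hv
  have h2 : ContDiff ℝ ∞ (primitiveCLM E) := ContinuousLinearMap.contDiff _
  have h3 : ContDiff ℝ ∞ (ContinuousLinearMap.const ℝ (M := E) (Icc (-1 : ℝ) 1)) :=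
    ContinuousLinearMap.contDiff _
  have h4 : ContDiff ℝ ∞ (fun x : (ℝ × E) × C(Icc (-1 : ℝ) 1, E) =>
      ContinuousLinearMap.const ℝ (Icc (-1 : ℝ) 1) x.1.2 + x.2) :=
    (h3.comp (contDiff_snd.comp contDiff_fst)).add contDiff_snd
  exact contDiff_snd.sub ((contDiff_fst.comp contDiff_fst).smul (h2.comp (h1.comp h4)))

lemma fderiv_flowDefect_inr {E : Type w} [NormedAddCommGroup E] [NormedSpace ℝ E] {v : C(E, E)}
    (hv : ContDiff ℝ ∞ v) (p : E) :
    fderiv ℝ (flowDefect v) ((0, p), 0) ∘L .inr ℝ (ℝ × E) C(Icc (-1 : ℝ) 1, E) =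
      .id ℝ C(Icc (-1 : ℝ) 1, E) := by
  have h1 : HasFDerivAt (flowDefect v) (fderiv ℝ (flowDefect v) ((0, p), 0)) ((0, p), 0) :=
    ((contDiff_flowDefect hv).differentiable (by simp) _).hasFDerivAt
  have h2 := h1.comp (0 : C(Icc (-1 : ℝ) 1, E))
    (hasFDerivAt_prodMk_right ((0, p) : ℝ × E) (0 : C(Icc (-1 : ℝ) 1, E)))
  refine h2.unique ?_
  have h3 : (flowDefect v ∘ fun y : C(Icc (-1 : ℝ) 1, E) => (((0, p) : ℝ × E), y)) = id := by
    funext y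
    simp [flowDefect]
  rw [h3]
  exact hasFDerivAt_id _

/-- Multiplication by `s ∈ [-1, 1]` as a map of `[-1, 1]`. -/
def scaleIcc (s : Icc (-1 : ℝ) 1) : C(Icc (-1 : ℝ) 1, Icc (-1 : ℝ) 1) where
  toFun r := ⟨s * r, by
    have := abs_le.2 s.2
    have := abs_le.2 r.2
    rw [mem_Icc, ← abs_le, abs_mul]
    exact mul_le_one₀ ‹_› (abs_nonneg _) ‹_›⟩
  continuous_toFun := by fun_prop

lemma flowDefect_scale {E : Type w} [NormedAddCommGroup E] [NormedSpace ℝ E] (v : C(E, E))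
    {t : ℝ} {p : E} {y : C(Icc (-1 : ℝ) 1, E)} (hy : flowDefect v ((t, p), y) = 0)
    (s : Icc (-1 : ℝ) 1) : flowDefect v ((t * s, p), y.comp (scaleIcc s)) = 0 := by
  ext r
  have h1 := DFunLike.congr_fun hy (scaleIcc s r)
  simp only [flowDefect, ContinuousMap.sub_apply, ContinuousMap.smul_apply,
    primitiveCLM_apply, ContinuousMap.zero_apply, ContinuousMap.comp_apply] at h1 ⊢
  rw [← h1, mul_smul]
  congr 2
  have h2 : ((scaleIcc s r : Icc (-1 : ℝ) 1) : ℝ) = s * r := rfl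
  rw [h2]
  have h3 := intervalIntegral.smul_integral_comp_mul_left (a := 0) (b := (r : ℝ))
    (IccExtend (by norm_num : (-1 : ℝ) ≤ 1)
      (v.comp (ContinuousLinearMap.const ℝ _ p + y))) (s : ℝ)
  rw [mul_zero] at h3
  rw [← h3]
  congr 1
  refine intervalIntegral.integral_congr fun r' hr' => ?_
  have hr1 : r' ∈ Icc (-1 : ℝ) 1 :=
    (uIcc_subset_Icc (by norm_num : (0 : ℝ) ∈ Icc (-1 : ℝ) 1) r.2) hr'
  have hr2 : (s : ℝ) * r' ∈ Icc (-1 : ℝ) 1 := (scaleIcc s ⟨r', hr1⟩).2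
  simp only [IccExtend_of_mem _ _ hr1, IccExtend_of_mem _ _ hr2]
  rfl

/-- A smooth vector field has a smooth local flow. -/
theorem exists_local_flow_of_contDiff {E : Type w} [NormedAddCommGroup E] [NormedSpace ℝ E]
    [CompleteSpace E] {v : E → E} (hv : ContDiff ℝ ∞ v) (p₀ : E) {W : Set E} (hW : W ∈ 𝓝 p₀) :
    ∃ ε > 0, ∃ r > 0, ∃ φ : ℝ → E → E,
      ContDiffOn ℝ ∞ (fun x : ℝ × E => φ x.1 x.2) (Ioo (-ε) ε ×ˢ Metric.ball p₀ r) ∧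
      (∀ t ∈ Ioo (-ε) ε, ∀ p ∈ Metric.ball p₀ r, φ t p ∈ W) ∧
      (∀ p ∈ Metric.ball p₀ r, φ 0 p = p) ∧
      ∀ t ∈ Ioo (-ε) ε, ∀ p ∈ Metric.ball p₀ r,
        HasDerivAt (fun t' => φ t' p) (v (φ t p)) t := by
  set V : C(E, E) := ⟨v, hv.continuous⟩ with hV
  have hΨ : ContDiff ℝ ∞ (flowDefect V) := contDiff_flowDefect hv
  have hn : (∞ : WithTop ℕ∞) ≠ 0 := by simp
  have hinv : (fderiv ℝ (flowDefect V) ((0, p₀), 0) ∘L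
      .inr ℝ (ℝ × E) C(Icc (-1 : ℝ) 1, E)).IsInvertible := by
    rw [fderiv_flowDefect_inr hv p₀]
    exact ⟨.refl ℝ _, rfl⟩
  set ψ := hΨ.contDiffAt.implicitFunction hn hinv with hψ
  have hzero : ∀ p, flowDefect V ((0, p), 0) = 0 := fun p => by simp [flowDefect]
  have hψ0 : ψ (0, p₀) = 0 := hΨ.contDiffAt.implicitFunction_apply_self hn hinv
  have hsm : ∀ᶠ x in 𝓝 ((0, p₀) : ℝ × E), ContDiffAt ℝ ∞ ψ x :=
    eventually_contDiffAt_implicitFunction hΨ hinv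
  have hsol : ∀ᶠ x in 𝓝 ((0, p₀) : ℝ × E), flowDefect V (x, ψ x) = 0 := by
    have := hΨ.contDiffAt.eventually_apply_implicitFunction hn hinv
    rwa [hzero] at this
  have hiff : ∀ᶠ x in 𝓝 (((0, p₀), 0) : (ℝ × E) × C(Icc (-1 : ℝ) 1, E)),
      flowDefect V x = 0 → ψ x.1 = x.2 := by
    have := hΨ.contDiffAt.eventually_apply_eq_iff_implicitFunction hn hinv
    rw [hzero] at this
    exact this.mono fun x hx => hx.1
  have hcont : ContinuousAt ψ (0, p₀) := hsm.self_of_nhds.continuousAt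
  set φ : ℝ → E → E := fun t p => p + ψ (t, p) ⟨1, by norm_num⟩ with hφ
  have hφsm : ∀ x : ℝ × E, ContDiffAt ℝ ∞ ψ x →
      ContDiffAt ℝ ∞ (fun x : ℝ × E => φ x.1 x.2) x := fun x hx => by
    have h1 : ContDiff ℝ ∞ (ContinuousMap.evalCLM ℝ (M := E) (⟨1, by norm_num⟩ : Icc (-1 : ℝ) 1)) :=
      ContinuousLinearMap.contDiff _
    exact contDiffAt_snd.add (h1.contDiffAt.comp x hx)
  have hφW : ∀ᶠ x in 𝓝 ((0, p₀) : ℝ × E), φ x.1 x.2 ∈ W := by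
    refine (hφsm _ hsm.self_of_nhds).continuousAt.eventually ?_
    simpa [hφ, hψ0] using hW
  rw [nhds_prod_eq, eventually_prod_iff] at hiff
  obtain ⟨P, hP, Q, hQ, hPQ⟩ := hiff
  obtain ⟨δ, hδ, hQδ⟩ := Metric.eventually_nhds_iff_ball.1 hQ
  have hψδ : ∀ᶠ x in 𝓝 ((0, p₀) : ℝ × E), ψ x ∈ Metric.ball 0 δ :=
    hcont.eventually (by rw [hψ0]; exact Metric.ball_mem_nhds _ hδ)
  have hall := hsm.and (hsol.and (hP.and (hψδ.and hφW)))
  obtain ⟨ε, hε, hbox⟩ := Metric.eventually_nhds_iff_ball.1 hall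
  have hmem : ∀ t ∈ Ioo (-ε) ε, ∀ p ∈ Metric.ball p₀ ε,
      ((t, p) : ℝ × E) ∈ Metric.ball ((0, p₀) : ℝ × E) ε := fun t ht p hp => by
    rw [← ball_prod_same]
    exact ⟨by simpa [abs_lt] using ht, hp⟩
  refine ⟨ε, hε, ε, hε, φ, ?_, ?_, ?_, ?_⟩
  · rintro ⟨t, p⟩ ⟨ht, hp⟩
    exact (hφsm _ (hbox _ (hmem t ht p hp)).1).contDiffWithinAt
  · exact fun t ht p hp => (hbox _ (hmem t ht p hp)).2.2.2.2
  · intro p hp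
    have h0 := hPQ (hbox _ (hmem 0 (by simpa using hε) p hp)).2.2.1
      (hQδ 0 (Metric.mem_ball_self hδ)) (hzero p)
    simp only [hφ]
    dsimp only at h0
    rw [h0]
    simp
  · intro t ht p hp
    obtain ⟨T, htT, hTε⟩ := exists_between (abs_lt.2 ht)
    have hT0 : 0 < T := (abs_nonneg t).trans_lt htT
    have hTmem : T ∈ Ioo (-ε) ε := ⟨by linarith, hTε⟩
    obtain ⟨-, hy, -, hyδ, -⟩ := hbox _ (hmem T hTmem p hp)
    set y := ψ (T, p) with hydef
    set G : ℝ → E := IccExtend (by norm_num : (-1 : ℝ) ≤ 1)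
      (V.comp (ContinuousLinearMap.const ℝ _ p + y)) with hG
    have hGc : Continuous G := (ContinuousMap.continuous _).Icc_extend'
    have hys : ∀ s : Icc (-1 : ℝ) 1, y s = T • ∫ r in (0 : ℝ)..s, G r := fun s => by
      have := DFunLike.congr_fun hy s
      exact sub_eq_zero.1 this
    have hscale : ∀ t' ∈ Ioo (-T) T, ∃ s : Icc (-1 : ℝ) 1, (s : ℝ) = t' / T ∧
        φ t' p = p + y s := fun t' ht' => by
      have hs : t' / T ∈ Icc (-1 : ℝ) 1 := by
        rw [mem_Icc, le_div_iff₀ hT0, div_le_iff₀ hT0]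
        constructor <;> linarith [ht'.1, ht'.2]
      refine ⟨⟨t' / T, hs⟩, rfl, ?_⟩
      have hTs : T * (t' / T) = t' := by field_simp
      have h1 := flowDefect_scale V hy ⟨t' / T, hs⟩
      have h2 : y.comp (scaleIcc ⟨t' / T, hs⟩) ∈ Metric.ball 0 δ := by
        rw [mem_ball_zero_iff] at hyδ ⊢
        refine lt_of_le_of_lt ((ContinuousMap.norm_le _ (norm_nonneg y)).2 fun r => ?_) hyδ
        exact y.norm_coe_le_norm _
      simp only [hTs] at h1
      have h3 := hPQ (hbox _ (hmem t' ⟨by linarith [ht'.1], by linarith [ht'.2]⟩ p hp)).2.2.1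
        (hQδ _ h2) h1
      simp only [hφ]
      dsimp only at h3
      rw [h3]
      simp only [ContinuousMap.comp_apply]
      congr 2
      ext
      simp [scaleIcc]
    have hev : ∀ᶠ t' in 𝓝 t, φ t' p = p + T • ∫ r in (0 : ℝ)..(t' / T), G r := by
      filter_upwards [Ioo_mem_nhds (abs_lt.1 htT).1 (abs_lt.1 htT).2] with t' ht'
      obtain ⟨s, hs1, hs2⟩ := hscale t' ht'
      rw [hs2, hys, hs1]
    obtain ⟨s, hs1, hs2⟩ := hscale t (abs_lt.1 htT)
    have hval : G (t / T) = v (φ t p) := by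
      rw [hs2, hG, ← hs1, IccExtend_val]
      rfl
    have hd1 : HasDerivAt (fun x => ∫ r in (0 : ℝ)..x, G r) (G (t / T)) (t / T) :=
      intervalIntegral.integral_hasDerivAt_right (hGc.intervalIntegrable _ _)
        hGc.stronglyMeasurable.stronglyMeasurableAtFilter hGc.continuousAt
    have hd2 : HasDerivAt (fun t' : ℝ => t' / T) (1 / T) t := (hasDerivAt_id t).div_const T
    have hd3 := ((hd1.scomp t hd2).const_smul T).const_add p
    rw [smul_smul, mul_one_div, div_self hT0.ne', one_smul, hval] at hd3
    exact hd3.congr_of_eventuallyEq hev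

/-- A vector field that is smooth on an open set agrees near a given point with one that is smooth
everywhere. -/
lemma exists_contDiff_eventuallyEq {E F : Type*} [NormedAddCommGroup E] [NormedSpace ℝ E]
    [FiniteDimensional ℝ E] [NormedAddCommGroup F] [NormedSpace ℝ F] {M : Set E} (hM : IsOpen M)
    {v : E → F} (hv : ContDiffOn ℝ ∞ v M) {p : E} (hp : p ∈ M) :
    ∃ w : E → F, ContDiff ℝ ∞ w ∧ w =ᶠ[𝓝 p] v := by
  obtain ⟨r, hr, hball⟩ := Metric.nhds_basis_closedBall.mem_iff.1 (hM.mem_nhds hp)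
  let f : ContDiffBump p := ⟨r / 2, r, by positivity, by linarith⟩
  refine ⟨fun x => f x • v x, ?_, ?_⟩
  · rw [contDiff_iff_contDiffAt]
    intro x
    by_cases hx : x ∈ M
    · exact f.contDiff.contDiffAt.smul (hv.contDiffAt (hM.mem_nhds hx))
    · have hx' : x ∈ (tsupport f)ᶜ := fun h => hx (hball (by rwa [f.tsupport_eq] at h))
      refine contDiffAt_const (c := (0 : F)) |>.congr_of_eventuallyEq ?_
      filter_upwards [(isClosed_tsupport f).isOpen_compl.mem_nhds hx'] with x' h'
      rw [image_eq_zero_of_notMem_tsupport h', zero_smul]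
  · filter_upwards [f.eventuallyEq_one] with x hx
    simp [hx]

/-- A vector field that is smooth on an open set has a smooth local flow near every point. -/
theorem exists_local_flow {E : Type w} [NormedAddCommGroup E] [NormedSpace ℝ E]
    [FiniteDimensional ℝ E] {M : Set E} (hM : IsOpen M) {v : E → E} (hv : ContDiffOn ℝ ∞ v M)
    {p₀ : E} (hp : p₀ ∈ M) :
    ∃ ε > 0, ∃ V, IsOpen V ∧ p₀ ∈ V ∧ V ⊆ M ∧ ∃ φ : ℝ → E → E,
      ContDiffOn ℝ ∞ (fun x : ℝ × E => φ x.1 x.2) (Ioo (-ε) ε ×ˢ V) ∧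
      (∀ t ∈ Ioo (-ε) ε, ∀ p ∈ V, φ t p ∈ M) ∧ (∀ p ∈ V, φ 0 p = p) ∧
      ∀ t ∈ Ioo (-ε) ε, ∀ p ∈ V, HasDerivAt (fun t' => φ t' p) (v (φ t p)) t := by
  have := FiniteDimensional.complete ℝ E
  obtain ⟨w, hw, hwv⟩ := exists_contDiff_eventuallyEq hM hv hp
  obtain ⟨ε, hε, r, hr, φ, h1, h2, h3, h4⟩ :=
    exists_local_flow_of_contDiff hw p₀ (inter_mem (hM.mem_nhds hp) hwv)
  have h0 : (0 : ℝ) ∈ Ioo (-ε) ε := by simpa using hε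
  refine ⟨ε, hε, Metric.ball p₀ r, Metric.isOpen_ball, Metric.mem_ball_self hr, ?_, φ, h1,
    fun t ht p hp => (h2 t ht p hp).1, h3, fun t ht p hp => ?_⟩
  · intro p hp
    have := (h2 0 h0 p hp).1
    rwa [h3 p hp] at this
  · have := (h2 t ht p hp).2
    have h5 := h4 t ht p hp
    rwa [show w (φ t p) = v (φ t p) from this] at h5

end SmoothFlow

section PartialDerivatives

open Set Filter Topology

variable {ι : Type} [Fintype ι] [DecidableEq ι]

lemma fderiv_apply_eq_sum_pd (f : (ι → ℝ) → ℝ) (p x : ι → ℝ) :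
    fderiv ℝ f p x = ∑ k, x k * pd k f p := by
  conv_lhs => rw [← Finset.univ_sum_single x, map_sum]
  refine Finset.sum_congr rfl fun k _ => ?_
  have : (Pi.single k (x k) : ι → ℝ) = x k • Pi.single k 1 := by
    rw [← Pi.single_smul, smul_eq_mul, mul_one]
  rw [this, map_smul, smul_eq_mul, pd]

lemma hasDerivAt_comp_pd {f : (ι → ℝ) → ℝ} {c : ℝ → ι → ℝ} {c' : ι → ℝ} {t : ℝ}
    (hf : DifferentiableAt ℝ f (c t)) (hc : HasDerivAt c c' t) :
    HasDerivAt (fun t' => f (c t')) (∑ k, c' k * pd k f (c t)) t := by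
  rw [← fderiv_apply_eq_sum_pd]
  exact hf.hasFDerivAt.comp_hasDerivAt t hc

lemma contDiffOn_pd {M : Set (ι → ℝ)} (hM : IsOpen M) {f : (ι → ℝ) → ℝ}
    (hf : ContDiffOn ℝ ∞ f M) (k : ι) : ContDiffOn ℝ ∞ (pd k f) M :=
  (hf.fderiv_of_isOpen hM (by simp)).clm_apply contDiffOn_const

lemma differentiableAt_of_contDiffOn {E F : Type*} [NormedAddCommGroup E] [NormedSpace ℝ E]
    [NormedAddCommGroup F] [NormedSpace ℝ F] {M : Set E} (hM : IsOpen M) {f : E → F}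
    (hf : ContDiffOn ℝ ∞ f M) {p : E} (hp : p ∈ M) : DifferentiableAt ℝ f p :=
  (hf.contDiffAt (hM.mem_nhds hp)).differentiableAt (by simp)

lemma pd_congr {M : Set (ι → ℝ)} (hM : IsOpen M) {f f' : (ι → ℝ) → ℝ} (hf : EqOn f f' M)
    {p : ι → ℝ} (hp : p ∈ M) (k : ι) : pd k f p = pd k f' p := by
  rw [pd, pd, (hf.eventuallyEq_of_mem (hM.mem_nhds hp)).fderiv_eq]

lemma pd_comm {M : Set (ι → ℝ)} (hM : IsOpen M) {f : (ι → ℝ) → ℝ} (hf : ContDiffOn ℝ ∞ f M)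
    {p : ι → ℝ} (hp : p ∈ M) (i j : ι) : pd i (pd j f) p = pd j (pd i f) p := by
  have h1 : DifferentiableAt ℝ (fderiv ℝ f) p :=
    differentiableAt_of_contDiffOn hM (hf.fderiv_of_isOpen hM (by simp)) hp
  have h2 : ∀ i j : ι, pd i (pd j f) p =
      fderiv ℝ (fderiv ℝ f) p (Pi.single i 1) (Pi.single j 1) := fun i j => by
    have : pd j f = fun q => fderiv ℝ f q (Pi.single j 1) := rfl
    rw [pd, this, fderiv_clm_apply h1 (differentiableAt_const _)]
    simp
  rw [h2, h2]
  exact ((hf.contDiffAt (hM.mem_nhds hp)).isSymmSndFDerivAt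
    (by rw [minSmoothness_of_isRCLikeNormedField]; norm_cast)) _ _

lemma pd_add {f f' : (ι → ℝ) → ℝ} {p : ι → ℝ} (hf : DifferentiableAt ℝ f p)
    (hf' : DifferentiableAt ℝ f' p) (k : ι) :
    pd k (fun q => f q + f' q) p = pd k f p + pd k f' p := by
  simp only [pd]
  rw [fderiv_fun_add hf hf']
  rfl

lemma pd_mul {f f' : (ι → ℝ) → ℝ} {p : ι → ℝ} (hf : DifferentiableAt ℝ f p)
    (hf' : DifferentiableAt ℝ f' p) (k : ι) :
    pd k (fun q => f q * f' q) p = pd k f p * f' p + f p * pd k f' p := by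
  simp only [pd]
  rw [fderiv_fun_mul hf hf']
  simp only [add_apply, smul_apply, smul_eq_mul]
  ring

lemma pd_sum {κ : Type*} (s : Finset κ) {f : κ → (ι → ℝ) → ℝ} {p : ι → ℝ}
    (hf : ∀ l ∈ s, DifferentiableAt ℝ (f l) p) (k : ι) :
    pd k (fun q => ∑ l ∈ s, f l q) p = ∑ l ∈ s, pd k (f l) p := by
  simp only [pd]
  rw [fderiv_fun_sum hf, sum_apply]

lemma pd_const_mul {f : (ι → ℝ) → ℝ} {p : ι → ℝ} (hf : DifferentiableAt ℝ f p) (a : ℝ) (k : ι) :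
    pd k (fun q => a * f q) p = a * pd k f p := by
  simp only [pd]
  rw [fderiv_const_mul hf]
  rfl

lemma pd_const (a : ℝ) (k : ι) (p : ι → ℝ) : pd k (fun _ => a) p = 0 := by
  simp [pd]

end PartialDerivatives

section Variation

open Set Filter Topology

/-- Mixed partial derivatives in two real variables commute. -/
lemma hasDerivAt_deriv_swap {F : Type*} [NormedAddCommGroup F] [NormedSpace ℝ F]
    {O : Set (ℝ × ℝ)} (hO : IsOpen O) {c : ℝ → ℝ → F}
    (hc : ContDiffOn ℝ ∞ (fun x : ℝ × ℝ => c x.1 x.2) O) {t τ : ℝ} (ht : (t, τ) ∈ O) :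
    HasDerivAt (fun t' => deriv (c t') τ) (deriv (fun τ' => deriv (fun t' => c t' τ') t) τ) t := by
  set f : ℝ × ℝ → F := fun x => c x.1 x.2 with hf
  have hd : ∀ x ∈ O, HasFDerivAt f (fderiv ℝ f x) x := fun x hx =>
    (differentiableAt_of_contDiffOn hO hc hx).hasFDerivAt
  have hd2 : HasFDerivAt (fderiv ℝ f) (fderiv ℝ (fderiv ℝ f) (t, τ)) (t, τ) :=
    (differentiableAt_of_contDiffOn hO (hc.fderiv_of_isOpen hO (by simp)) ht).hasFDerivAt
  have hfst : ∀ x : ℝ × ℝ, HasDerivAt (fun t' : ℝ => (t', x.2)) ((1, 0) : ℝ × ℝ) x.1 :=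
    fun x => (hasDerivAt_id _).prodMk (hasDerivAt_const _ _)
  have hsnd : ∀ x : ℝ × ℝ, HasDerivAt (fun τ' : ℝ => (x.1, τ')) ((0, 1) : ℝ × ℝ) x.2 :=
    fun x => (hasDerivAt_const _ _).prodMk (hasDerivAt_id _)
  have h1 : ∀ x ∈ O, deriv (fun t' => c t' x.2) x.1 = fderiv ℝ f x (1, 0) := fun x hx =>
    (HasFDerivAt.comp_hasDerivAt (l := f) x.1 (hd x hx) (hfst x)).deriv
  have h2 : ∀ x ∈ O, deriv (c x.1) x.2 = fderiv ℝ f x (0, 1) := fun x hx =>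
    (HasFDerivAt.comp_hasDerivAt (l := f) x.2 (hd x hx) (hsnd x)).deriv
  have e1 : (fun t' => deriv (c t') τ) =ᶠ[𝓝 t] fun t' => fderiv ℝ f (t', τ) (0, 1) := by
    filter_upwards [(hfst (t, τ)).continuousAt.eventually (hO.mem_nhds ht)] with t' h'
    exact h2 (t', τ) h'
  have e2 : (fun τ' => deriv (fun t' => c t' τ') t) =ᶠ[𝓝 τ]
      fun τ' => fderiv ℝ f (t, τ') (1, 0) := by
    filter_upwards [(hsnd (t, τ)).continuousAt.eventually (hO.mem_nhds ht)] with τ' h'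
    exact h1 (t, τ') h'
  have d1 := (HasFDerivAt.comp_hasDerivAt (l := fderiv ℝ f) t hd2 (hfst (t, τ))).clm_apply
    (hasDerivAt_const t ((0, 1) : ℝ × ℝ))
  have d2 := (HasFDerivAt.comp_hasDerivAt (l := fderiv ℝ f) τ hd2 (hsnd (t, τ))).clm_apply
    (hasDerivAt_const τ ((1, 0) : ℝ × ℝ))
  have hsymm := ((hc.contDiffAt (hO.mem_nhds ht)).isSymmSndFDerivAt
    (by rw [minSmoothness_of_isRCLikeNormedField]; norm_cast)) (1, 0) (0, 1)
  rw [e2.deriv_eq]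
  refine HasDerivAt.congr_of_eventuallyEq ?_ e1
  convert! d1 using 1
  rw [show deriv (fun τ' => fderiv ℝ f (t, τ') (1, 0)) τ = _ from d2.deriv]
  simpa using hsymm.symm

variable {ι : Type} [Fintype ι] [DecidableEq ι]

/-- The Lie derivative `(L_v Γ)^k_{ij}` of the connection with coefficients `Γ^k_{ij}`. -/
noncomputable def lieConnection (v : (ι → ℝ) → ι → ℝ) (Γ : ι → ι → ι → (ι → ℝ) → ℝ)
    (k i j : ι) (p : ι → ℝ) : ℝ :=
  ∑ m, (v p m * pd m (Γ k i j) p - Γ m i j p * pd m (fun q => v q k) p +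
    Γ k m j p * pd i (fun q => v q m) p + Γ k i m p * pd j (fun q => v q m) p) +
    pd i (pd j (fun q => v q k)) p

lemma variation_sum_identity (X X' V : ι → ℝ) (P : ι → ι → ℝ) (Γ : ι → ι → ι → ℝ)
    (dΓ : ι → ι → ι → ℝ) (H : ι → ι → ℝ) (k : ι) :
    (∑ m, (X' m * P m k + X m * ∑ n, X n * H n m)) +
      ∑ i, ∑ j, (((∑ m, V m * dΓ m i j) * X i + Γ k i j * ∑ m, X m * P m i) * X j +
        Γ k i j * X i * ∑ m, X m * P m j) =
    ∑ m, (X' m + ∑ i, ∑ j, Γ m i j * X i * X j) * P m k +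
      ∑ i, ∑ j, (∑ m, (V m * dΓ m i j - Γ m i j * P m k + Γ k m j * P i m + Γ k i m * P j m) +
        H i j) * X i * X j := by
  have e1 : ∑ m, (∑ i, ∑ j, Γ m i j * X i * X j) * P m k =
      ∑ i, ∑ j, ∑ m, Γ m i j * P m k * X i * X j := by
    simp only [Finset.sum_mul]
    rw [Finset.sum_comm]
    refine Finset.sum_congr rfl fun i _ => ?_
    rw [Finset.sum_comm]
    exact Finset.sum_congr rfl fun j _ => Finset.sum_congr rfl fun m _ => by ring
  have e2 : ∑ i, ∑ j, (Γ k i j * ∑ m, X m * P m i) * X j =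
      ∑ i, ∑ j, ∑ m, Γ k m j * P i m * X i * X j := by
    have : ∀ j, ∑ i, (Γ k i j * ∑ m, X m * P m i) * X j =
        ∑ i, ∑ m, Γ k m j * P i m * X i * X j := fun j => by
      simp only [Finset.mul_sum, Finset.sum_mul]
      rw [Finset.sum_comm]
      exact Finset.sum_congr rfl fun i _ => Finset.sum_congr rfl fun m _ => by ring
    rw [Finset.sum_comm, Finset.sum_congr rfl fun j _ => this j, Finset.sum_comm]
  have e3 : ∑ i, ∑ j, Γ k i j * X i * ∑ m, X m * P m j =
      ∑ i, ∑ j, ∑ m, Γ k i m * P j m * X i * X j := by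
    refine Finset.sum_congr rfl fun i _ => ?_
    simp only [Finset.mul_sum]
    rw [Finset.sum_comm]
    exact Finset.sum_congr rfl fun j _ => Finset.sum_congr rfl fun m _ => by ring
  have e4 : ∑ m, X m * ∑ n, X n * H n m = ∑ i, ∑ j, H i j * X i * X j := by
    simp only [Finset.mul_sum]
    rw [Finset.sum_comm]
    exact Finset.sum_congr rfl fun i _ => Finset.sum_congr rfl fun j _ => by ring
  have e5 : ∑ i, ∑ j, (∑ m, V m * dΓ m i j) * X i * X j =
      ∑ i, ∑ j, ∑ m, V m * dΓ m i j * X i * X j := by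
    simp only [Finset.sum_mul]
  simp only [add_mul, Finset.sum_add_distrib, sub_mul, Finset.sum_sub_distrib, Finset.sum_mul]
    at e1 e2 e3 e4 e5 ⊢
  linarith

/-- Along a one-parameter family of curves that is dragged by the vector field `v`, the velocity
evolves by the derivative of `v`. -/
lemma hasDerivAt_velocity {M : Set (ι → ℝ)} (hM : IsOpen M) {v : (ι → ℝ) → ι → ℝ}
    (hv : ContDiffOn ℝ ∞ v M) {O : Set (ℝ × ℝ)} (hO : IsOpen O) {c : ℝ → ℝ → ι → ℝ}
    (hc : ContDiffOn ℝ ∞ (fun x : ℝ × ℝ => c x.1 x.2) O) (hcM : ∀ x ∈ O, c x.1 x.2 ∈ M)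
    (hflow : ∀ x ∈ O, HasDerivAt (fun t' => c t' x.2) (v (c x.1 x.2)) x.1)
    {t τ : ℝ} (ht : (t, τ) ∈ O) :
    HasDerivAt (fun t' => deriv (c t') τ)
      (fun k => ∑ m, deriv (c t) τ m * pd m (fun q => v q k) (c t τ)) t := by
  have h := hasDerivAt_deriv_swap hO hc ht
  convert! h using 1
  have hline : ContinuousAt (fun τ' : ℝ => (t, τ')) τ := by fun_prop
  have e : (fun τ' => deriv (fun t' => c t' τ') t) =ᶠ[𝓝 τ] fun τ' => v (c t τ') := by
    filter_upwards [hline.eventually (hO.mem_nhds ht)] with τ' h'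
    exact (hflow (t, τ') h').deriv
  rw [e.deriv_eq]
  have hcτ : HasDerivAt (c t) (deriv (c t) τ) τ := by
    have h1 : DifferentiableAt ℝ (fun x : ℝ × ℝ => c x.1 x.2) (t, τ) :=
      differentiableAt_of_contDiffOn hO hc ht
    have h2 : DifferentiableAt ℝ (fun τ' : ℝ => (t, τ')) τ := by fun_prop
    exact (DifferentiableAt.comp τ h1 h2).hasDerivAt
  refine (HasDerivAt.deriv (hasDerivAt_pi.2 fun k => ?_)).symm
  exact hasDerivAt_comp_pd (differentiableAt_pi.1
    (differentiableAt_of_contDiffOn hM hv (hcM _ ht)) k) hcτ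

/-- Along a one-parameter family of curves that is dragged by the vector field `v`, the
acceleration evolves by the derivative of `v` and the Lie derivative of the connection. -/
lemma hasDerivAt_acceleration {M : Set (ι → ℝ)} (hM : IsOpen M) {g : (ι → ℝ) → Matrix ι ι ℝ}
    (hg : ∀ k i j, ContDiffOn ℝ ∞ (christoffel g k i j) M) {v : (ι → ℝ) → ι → ℝ}
    (hv : ContDiffOn ℝ ∞ v M) {O : Set (ℝ × ℝ)} (hO : IsOpen O) {c : ℝ → ℝ → ι → ℝ}
    (hc : ContDiffOn ℝ ∞ (fun x : ℝ × ℝ => c x.1 x.2) O) (hcM : ∀ x ∈ O, c x.1 x.2 ∈ M)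
    (hflow : ∀ x ∈ O, HasDerivAt (fun t' => c t' x.2) (v (c x.1 x.2)) x.1)
    {t τ : ℝ} (ht : (t, τ) ∈ O) (k : ι) :
    HasDerivAt (fun t' => acceleration g (c t') τ k)
      (∑ m, acceleration g (c t) τ m * pd m (fun q => v q k) (c t τ) +
        ∑ i, ∑ j, lieConnection v (christoffel g) k i j (c t τ) *
          deriv (c t) τ i * deriv (c t) τ j) t := by
  have hvk : ∀ k, ContDiffOn ℝ ∞ (fun q => v q k) M := fun k => contDiffOn_pi.1 hv k
  have hX := hasDerivAt_velocity hM hv hO hc hcM hflow ht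
  have hXs : ContDiffOn ℝ ∞ (fun x : ℝ × ℝ => deriv (c x.1) x.2) O := by
    have h1 : ContDiffOn ℝ ∞ (fun x : ℝ × ℝ =>
        fderiv ℝ (fun x : ℝ × ℝ => c x.1 x.2) x ((0, 1) : ℝ × ℝ)) O :=
      (hc.fderiv_of_isOpen hO (by simp)).clm_apply contDiffOn_const
    refine h1.congr fun x hx => ?_
    have h2 : HasDerivAt (fun τ' : ℝ => (x.1, τ')) ((0, 1) : ℝ × ℝ) x.2 :=
      (hasDerivAt_const _ _).prodMk (hasDerivAt_id _)
    exact (HasFDerivAt.comp_hasDerivAt (l := fun x : ℝ × ℝ => c x.1 x.2) x.2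
      (differentiableAt_of_contDiffOn hO hc hx).hasFDerivAt h2).deriv
  have hline : ContinuousAt (fun τ' : ℝ => (t, τ')) τ := by fun_prop
  have hlined : DifferentiableAt ℝ (fun τ' : ℝ => (t, τ')) τ := by fun_prop
  have hcτ : HasDerivAt (c t) (deriv (c t) τ) τ := by
    have h1 : DifferentiableAt ℝ (fun x : ℝ × ℝ => c x.1 x.2) (t, τ) :=
      differentiableAt_of_contDiffOn hO hc ht
    exact (DifferentiableAt.comp τ h1 hlined).hasDerivAt
  have hXτ : HasDerivAt (deriv (c t)) (deriv (deriv (c t)) τ) τ := by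
    have h1 : DifferentiableAt ℝ (fun x : ℝ × ℝ => deriv (c x.1) x.2) (t, τ) :=
      differentiableAt_of_contDiffOn hO hXs ht
    exact (DifferentiableAt.comp τ h1 hlined).hasDerivAt
  -- the second `τ`-derivative
  have hY : HasDerivAt (fun t' => deriv (deriv (c t')) τ k)
      (∑ m, (deriv (deriv (c t)) τ m * pd m (fun q => v q k) (c t τ) +
        deriv (c t) τ m * ∑ n, deriv (c t) τ n * pd n (pd m fun q => v q k) (c t τ))) t := by
    have h := hasDerivAt_pi.1 (hasDerivAt_deriv_swap hO (c := fun t' τ' => deriv (c t') τ')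
      hXs ht) k
    convert! h using 1
    have e : (fun τ' => deriv (fun t' => deriv (c t') τ') t) =ᶠ[𝓝 τ]
        fun τ' k => ∑ m, deriv (c t) τ' m * pd m (fun q => v q k) (c t τ') := by
      filter_upwards [hline.eventually (hO.mem_nhds ht)] with τ' h'
      exact (hasDerivAt_velocity hM hv hO hc hcM hflow h').deriv
    rw [e.deriv_eq]
    have hd : ∀ k, HasDerivAt (fun τ' => ∑ m, deriv (c t) τ' m * pd m (fun q => v q k) (c t τ'))
        (∑ m, (deriv (deriv (c t)) τ m * pd m (fun q => v q k) (c t τ) +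
        deriv (c t) τ m * ∑ n, deriv (c t) τ n * pd n (pd m fun q => v q k) (c t τ))) τ :=
      fun k => HasDerivAt.fun_sum fun m _ => (hasDerivAt_pi.1 hXτ m).mul
        (hasDerivAt_comp_pd (differentiableAt_of_contDiffOn hM
          (contDiffOn_pd hM (hvk k) m) (hcM _ ht)) hcτ)
    rw [(hasDerivAt_pi.2 hd).deriv]
  have hΓ : ∀ i j, HasDerivAt (fun t' => christoffel g k i j (c t' τ))
      (∑ m, v (c t τ) m * pd m (christoffel g k i j) (c t τ)) t := fun i j =>
    hasDerivAt_comp_pd (c := fun t' => c t' τ)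
      (differentiableAt_of_contDiffOn hM (hg k i j) (hcM _ ht)) (hflow _ ht)
  have hsum := hY.add (HasDerivAt.fun_sum (u := Finset.univ) fun i _ =>
    HasDerivAt.fun_sum (u := Finset.univ) fun j _ =>
      ((hΓ i j).mul (hasDerivAt_pi.1 hX i)).mul (hasDerivAt_pi.1 hX j))
  refine HasDerivAt.congr_deriv hsum ?_
  exact variation_sum_identity (deriv (c t) τ) (deriv (deriv (c t)) τ) (v (c t τ))
    (fun m k => pd m (fun q => v q k) (c t τ)) (fun k i j => christoffel g k i j (c t τ))
    (fun m i j => pd m (christoffel g k i j) (c t τ))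
    (fun i j => pd i (pd j fun q => v q k) (c t τ)) k

end Variation

section Projective

open Set Filter Topology

variable {ι : Type} [Fintype ι] [DecidableEq ι]

lemma acceleration_congr (g : (ι → ℝ) → Matrix ι ι ℝ) {γ γ' : ℝ → ι → ℝ} {t : ℝ}
    (h : γ =ᶠ[𝓝 t] γ') : acceleration g γ t = acceleration g γ' t := by
  have h1 : deriv γ =ᶠ[𝓝 t] deriv γ' := h.deriv
  unfold acceleration
  rw [h1.deriv_eq, h1.eq_of_nhds, h.eq_of_nhds]

lemma fderiv_apply_apply_eq_sum_pd {v : (ι → ℝ) → ι → ℝ} {p : ι → ℝ}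
    (hv : DifferentiableAt ℝ v p) (x : ι → ℝ) (k : ι) :
    fderiv ℝ v p x k = ∑ m, x m * pd m (fun q => v q k) p := by
  rw [← fderiv_apply_eq_sum_pd]
  have := (hasFDerivAt_pi'.1 hv.hasFDerivAt k).fderiv
  rw [this]
  rfl

/-- Geodesics exist for all initial positions and velocities. -/
lemma exists_geodesic {V : Set (ι → ℝ)} (hV : IsOpen V) {g : (ι → ℝ) → Matrix ι ι ℝ}
    (hg : ∀ k i j, ContDiffOn ℝ ∞ (christoffel g k i j) V) {p : ι → ℝ} (hp : p ∈ V)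
    (X : ι → ℝ) :
    ∃ δ > 0, ∃ γ : ℝ → ι → ℝ, ContDiffOn ℝ ∞ γ (Ioo (-δ) δ) ∧ (∀ t ∈ Ioo (-δ) δ, γ t ∈ V) ∧
      γ 0 = p ∧ deriv γ 0 = X ∧ ∀ t ∈ Ioo (-δ) δ, acceleration g γ t = 0 := by
  set w : (ι → ℝ) × (ι → ℝ) → (ι → ℝ) × (ι → ℝ) := fun x =>
    (x.2, fun k => -∑ i, ∑ j, christoffel g k i j x.1 * x.2 i * x.2 j) with hw
  have hws : ContDiffOn ℝ ∞ w (V ×ˢ univ) := by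
    refine contDiffOn_snd.prodMk (contDiffOn_pi.2 fun k => ContDiffOn.neg ?_)
    refine ContDiffOn.sum fun i _ => ContDiffOn.sum fun j _ => ?_
    have h1 : ContDiffOn ℝ ∞ (fun x : (ι → ℝ) × (ι → ℝ) => christoffel g k i j x.1) (V ×ˢ univ) :=
      (hg k i j).comp contDiffOn_fst fun x hx => hx.1
    have h2 : ∀ i, ContDiffOn ℝ ∞ (fun x : (ι → ℝ) × (ι → ℝ) => x.2 i) (V ×ˢ univ) := fun i =>
      contDiffOn_pi.1 contDiffOn_snd i
    exact (h1.mul (h2 i)).mul (h2 j)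
  obtain ⟨δ, hδ, O, hO, hpO, hOV, Φ, h1, h2, h3, h4⟩ :=
    exists_local_flow (hV.prod isOpen_univ) hws (p₀ := (p, X)) ⟨hp, mem_univ _⟩
  have h0 : (0 : ℝ) ∈ Ioo (-δ) δ := by simpa using hδ
  have hfst : ∀ t ∈ Ioo (-δ) δ, HasDerivAt (fun s => (Φ s (p, X)).1) (Φ t (p, X)).2 t :=
    fun t ht => (ContinuousLinearMap.fst ℝ (ι → ℝ) (ι → ℝ)).hasFDerivAt.comp_hasDerivAt t
      (h4 t ht _ hpO)
  have hsnd : ∀ t ∈ Ioo (-δ) δ, HasDerivAt (fun s => (Φ s (p, X)).2)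
      (w (Φ t (p, X))).2 t :=
    fun t ht => (ContinuousLinearMap.snd ℝ (ι → ℝ) (ι → ℝ)).hasFDerivAt.comp_hasDerivAt t
      (h4 t ht _ hpO)
  have hd : ∀ t ∈ Ioo (-δ) δ, deriv (fun s => (Φ s (p, X)).1) t = (Φ t (p, X)).2 :=
    fun t ht => (hfst t ht).deriv
  refine ⟨δ, hδ, fun t => (Φ t (p, X)).1, ?_, fun t ht => (h2 t ht _ hpO).1, ?_, ?_, ?_⟩
  · have h5 : ContDiffOn ℝ ∞ (fun t : ℝ => (t, (p, X))) (Ioo (-δ) δ) :=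
      contDiffOn_id.prodMk contDiffOn_const
    exact contDiff_fst.comp_contDiffOn (h1.comp h5 fun t ht => ⟨ht, hpO⟩)
  · simp only [h3 _ hpO]
  · rw [hd 0 h0, h3 _ hpO]
  · intro t ht
    have e : deriv (fun s => (Φ s (p, X)).1) =ᶠ[𝓝 t] fun s => (Φ s (p, X)).2 := by
      filter_upwards [Ioo_mem_nhds ht.1 ht.2] with s hs using hd s hs
    funext k
    simp only [acceleration]
    rw [e.deriv_eq, (hsnd t ht).deriv, hd t ht]
    simp [hw]

/-- If `v` is projective, then `(L_v Γ)(X, X)` is proportional to `X` for every vector `X`. -/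
theorem IsProjective.lieConnection_wedge {M : Set (ι → ℝ)} (hM : IsOpen M)
    {g : (ι → ℝ) → Matrix ι ι ℝ} (hg : ∀ k i j, ContDiffOn ℝ ∞ (christoffel g k i j) M)
    {v : (ι → ℝ) → ι → ℝ} (hv : ContDiffOn ℝ ∞ v M) (hproj : IsProjective M g v)
    {p : ι → ℝ} (hp : p ∈ M) (X : ι → ℝ) (k l : ι) :
    (∑ i, ∑ j, lieConnection v (christoffel g) k i j p * X i * X j) * X l =
      (∑ i, ∑ j, lieConnection v (christoffel g) l i j p * X i * X j) * X k := by
  obtain ⟨ε, hε, V, hV, hpV, hVM, φ, h1, h2, h3, h4⟩ := exists_local_flow hM hv hp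
  obtain ⟨δ, hδ, γ, hγ1, hγ2, hγ3, hγ4, hγ5⟩ :=
    exists_geodesic hV (fun k i j => (hg k i j).mono hVM) hpV X
  have hgeo : IsUnparamGeodesic g V (-δ) δ γ :=
    ⟨hγ1, hγ2, fun _ => 0, fun t ht => by rw [hγ5 t ht, zero_smul]⟩
  have himg := fun t ht => (hproj ε V φ hε ⟨hV, hVM, h1, h2, h3, h4⟩ t ht _ _ γ hgeo).2.2
  have h0ε : (0 : ℝ) ∈ Ioo (-ε) ε := by simpa using hε
  have h0δ : (0 : ℝ) ∈ Ioo (-δ) δ := by simpa using hδ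
  set c : ℝ → ℝ → ι → ℝ := fun t τ => φ t (γ τ) with hc
  set O := Ioo (-ε) ε ×ˢ Ioo (-δ) δ with hOdef
  have hO : IsOpen O := isOpen_Ioo.prod isOpen_Ioo
  have hcs : ContDiffOn ℝ ∞ (fun x : ℝ × ℝ => c x.1 x.2) O := by
    have h5 : ContDiffOn ℝ ∞ (fun x : ℝ × ℝ => (x.1, γ x.2)) O :=
      contDiffOn_fst.prodMk (hγ1.comp contDiffOn_snd fun x hx => hx.2)
    exact h1.comp h5 fun x hx => ⟨hx.1, hγ2 _ hx.2⟩
  have hcM : ∀ x ∈ O, c x.1 x.2 ∈ M := fun x hx => h2 _ hx.1 _ (hγ2 _ hx.2)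
  have hflow : ∀ x ∈ O, HasDerivAt (fun t' => c t' x.2) (v (c x.1 x.2)) x.1 := fun x hx =>
    h4 _ hx.1 _ (hγ2 _ hx.2)
  have h00 : ((0, 0) : ℝ × ℝ) ∈ O := ⟨h0ε, h0δ⟩
  have hc0 : c 0 =ᶠ[𝓝 0] γ := by
    filter_upwards [Ioo_mem_nhds h0δ.1 h0δ.2] with τ hτ using h3 _ (hγ2 τ hτ)
  have hX0 : deriv (c 0) 0 = X := by rw [hc0.deriv_eq, hγ4]
  have hA0 : ∀ m, acceleration g (c 0) 0 m = 0 := fun m => by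
    rw [acceleration_congr g hc0, hγ5 0 h0δ, Pi.zero_apply]
  have hp0 : c 0 0 = p := by rw [hc0.eq_of_nhds, hγ3]
  have hX := hasDerivAt_pi.1 (hasDerivAt_velocity hM hv hO hcs hcM hflow h00)
  have hA := hasDerivAt_acceleration hM hg hv hO hcs hcM hflow h00
  have hW := ((hA k).mul (hX l)).sub ((hA l).mul (hX k))
  have hW0 : HasDerivAt ((fun t => acceleration g (c t) 0 k) * (fun t => deriv (c t) 0 l) -
      (fun t => acceleration g (c t) 0 l) * (fun t => deriv (c t) 0 k)) 0 0 := by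
    refine (hasDerivAt_const (0 : ℝ) (0 : ℝ)).congr_of_eventuallyEq ?_
    filter_upwards [Ioo_mem_nhds h0ε.1 h0ε.2] with t ht
    obtain ⟨f, hf⟩ := himg t ht
    have hf0 : acceleration g (c t) 0 = f 0 • deriv (c t) 0 := hf 0 h0δ
    simp only [Pi.sub_apply, Pi.mul_apply, hf0, Pi.smul_apply, smul_eq_mul]
    ring
  have := hW.unique hW0
  simp only [hA0, hX0, hp0, zero_mul, Finset.sum_const_zero, zero_add, add_zero] at this
  linarith

/-- A solution of a linear differential equation that vanishes at one time vanishes. -/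
lemma eq_zero_of_linear_ode {E : Type*} [NormedAddCommGroup E] [NormedSpace ℝ E] {a b : ℝ}
    {L : ℝ → E →L[ℝ] E} (hL : ContinuousOn L (Ioo a b)) {y : ℝ → E}
    (hy : ∀ t ∈ Ioo a b, HasDerivAt y (L t (y t)) t) {t₀ : ℝ} (ht₀ : t₀ ∈ Ioo a b)
    (h0 : y t₀ = 0) {t : ℝ} (ht : t ∈ Ioo a b) : y t = 0 := by
  obtain ⟨a', ha1, ha2⟩ := exists_between (lt_min ht₀.1 ht.1)
  obtain ⟨b', hb1, hb2⟩ := exists_between (max_lt ht₀.2 ht.2)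
  have hsub : Icc a' b' ⊆ Ioo a b := fun s hs => ⟨ha1.trans_le hs.1, hs.2.trans_lt hb2⟩
  obtain ⟨K, hK⟩ := (isCompact_Icc.image_of_continuousOn (hL.mono hsub)).isBounded.exists_norm_le
  have ht₀' : t₀ ∈ Ioo a' b' :=
    ⟨ha2.trans_le (min_le_left _ _), (le_max_left _ _).trans_lt hb1⟩
  have ht' : t ∈ Icc a' b' :=
    ⟨(ha2.trans_le (min_le_right _ _)).le, ((le_max_right _ _).trans_lt hb1).le⟩
  have hy0 : ContinuousOn y (Icc a' b') := fun s hs =>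
    (hy s (hsub hs)).continuousAt.continuousWithinAt
  refine ODE_solution_unique_of_mem_Icc (v := fun t x => L t x) (s := fun _ => univ)
    (K := K.toNNReal) (f := y) (g := fun _ => 0) ?_ ht₀' hy0
    (fun s hs => hy s (hsub (Ioo_subset_Icc_self hs))) (fun _ _ => mem_univ _)
    continuousOn_const (fun s _ => by simpa using hasDerivAt_const s (0 : E))
    (fun _ _ => mem_univ _) h0 ht'
  intro s hs
  refine ((L s).lipschitz.weaken ?_).lipschitzOnWith
  rw [← NNReal.coe_le_coe, coe_nnnorm]
  exact (hK _ (mem_image_of_mem L (Ioo_subset_Icc_self hs))).trans (Real.le_coe_toNNReal K)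

/-- If `(L_v Γ)(X, X) = 2 μ(X) X` for a continuous one-form `μ`, then `v` is projective. -/
theorem isProjective_of_lieConnection {M : Set (ι → ℝ)} (hM : IsOpen M)
    {g : (ι → ℝ) → Matrix ι ι ℝ} (hg : ∀ k i j, ContDiffOn ℝ ∞ (christoffel g k i j) M)
    {v : (ι → ℝ) → ι → ℝ} (hv : ContDiffOn ℝ ∞ v M) (μ : ι → (ι → ℝ) → ℝ)
    (hμ : ∀ m, ContinuousOn (μ m) M)
    (hL : ∀ p ∈ M, ∀ X : ι → ℝ, ∀ k, ∑ i, ∑ j, lieConnection v (christoffel g) k i j p * X i * X j =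
      2 * (∑ m, μ m p * X m) * X k) : IsProjective M g v := by
  intro ε V φ hε hφ t ht r s γ hγ
  obtain ⟨hγ1, hγ2, f, hf⟩ := hγ
  have h0ε : (0 : ℝ) ∈ Ioo (-ε) ε := by simpa using hε
  set c : ℝ → ℝ → ι → ℝ := fun t τ => φ t (γ τ) with hc
  set O := Ioo (-ε) ε ×ˢ Ioo r s with hOdef
  have hO : IsOpen O := isOpen_Ioo.prod isOpen_Ioo
  have hcs : ContDiffOn ℝ ∞ (fun x : ℝ × ℝ => c x.1 x.2) O := by
    have h5 : ContDiffOn ℝ ∞ (fun x : ℝ × ℝ => (x.1, γ x.2)) O :=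
      contDiffOn_fst.prodMk (hγ1.comp contDiffOn_snd fun x hx => hx.2)
    exact hφ.smooth.comp h5 fun x hx => ⟨hx.1, hγ2 _ hx.2⟩
  have hcM : ∀ x ∈ O, c x.1 x.2 ∈ M := fun x hx => hφ.mem _ hx.1 _ (hγ2 _ hx.2)
  have hflow : ∀ x ∈ O, HasDerivAt (fun t' => c t' x.2) (v (c x.1 x.2)) x.1 := fun x hx =>
    hφ.hasDerivAt _ hx.1 _ (hγ2 _ hx.2)
  refine ⟨?_, fun τ hτ => hcM (t, τ) ⟨ht, hτ⟩, ?_⟩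
  · have h5 : ContDiffOn ℝ ∞ (fun τ : ℝ => (t, τ)) (Ioo r s) :=
      contDiffOn_const.prodMk contDiffOn_id
    exact hcs.comp h5 fun τ hτ => ⟨ht, hτ⟩
  suffices h : ∀ τ, ∃ a : ℝ, τ ∈ Ioo r s → acceleration g (c t) τ = a • deriv (c t) τ by
    choose F hF using h
    exact ⟨F, hF⟩
  intro τ
  by_cases hτ : τ ∈ Ioo r s
  swap
  · exact ⟨0, fun h => absurd h hτ⟩
  have hmem : ∀ t' ∈ Ioo (-ε) ε, (t', τ) ∈ O := fun t' ht' => ⟨ht', hτ⟩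
  have hX := fun t' ht' => hasDerivAt_velocity hM hv hO hcs hcM hflow (hmem t' ht')
  have hA := fun t' ht' => hasDerivAt_acceleration hM hg hv hO hcs hcM hflow (hmem t' ht')
  have hcont : ContinuousOn (fun t' => c t' τ) (Ioo (-ε) ε) := fun t' ht' =>
    (hflow _ (hmem t' ht')).continuousAt.continuousWithinAt
  have hmaps : MapsTo (fun t' => c t' τ) (Ioo (-ε) ε) M := fun t' ht' => hcM _ (hmem t' ht')
  have hXcont : ContinuousOn (fun t' => deriv (c t') τ) (Ioo (-ε) ε) := fun t' ht' =>
    (hX t' ht').continuousAt.continuousWithinAt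
  set m : ℝ → ℝ := fun t' => 2 * ∑ i, μ i (c t' τ) * deriv (c t') τ i with hm
  have hmc : ContinuousOn m (Ioo (-ε) ε) := by
    refine continuousOn_const.mul (continuousOn_finsetSum _ fun i _ => ?_)
    exact ((hμ i).comp hcont hmaps).mul (continuousOn_pi.1 hXcont i)
  set F : ℝ → ℝ := fun t' => f τ + ∫ x in (0 : ℝ)..t', m x with hF
  have hFd : ∀ t' ∈ Ioo (-ε) ε, HasDerivAt F (m t') t' := fun t' ht' => by
    refine (intervalIntegral.integral_hasDerivAt_right ?_ ?_ ?_).const_add _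
    · exact (hmc.mono (ordConnected_Ioo.uIcc_subset h0ε ht')).intervalIntegrable
    · exact hmc.stronglyMeasurableAtFilter isOpen_Ioo t' ht'
    · exact hmc.continuousAt (isOpen_Ioo.mem_nhds ht')
  set y : ℝ → ι → ℝ := fun t' k => acceleration g (c t') τ k - F t' * deriv (c t') τ k with hy
  have hyd : ∀ t' ∈ Ioo (-ε) ε, HasDerivAt y (fderiv ℝ v (c t' τ) (y t')) t' := fun t' ht' => by
    refine hasDerivAt_pi.2 fun k => ?_
    have h6 := (hA t' ht' k).sub ((hFd t' ht').mul (hasDerivAt_pi.1 (hX t' ht') k))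
    refine h6.congr_deriv ?_
    rw [fderiv_apply_apply_eq_sum_pd
      (differentiableAt_of_contDiffOn hM hv (hmaps ht')), hL _ (hmaps ht')]
    simp only [hy, hm, sub_mul, Finset.sum_sub_distrib, Finset.mul_sum, mul_assoc]
    ring
  have hLc : ContinuousOn (fun t' => fderiv ℝ v (c t' τ)) (Ioo (-ε) ε) :=
    (hv.fderiv_of_isOpen hM (by simp : (0 : WithTop ℕ∞) + 1 ≤ ∞)).continuousOn.comp hcont hmaps
  have hy0 : y 0 = 0 := by
    have hc0 : c 0 =ᶠ[𝓝 τ] γ := by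
      filter_upwards [Ioo_mem_nhds hτ.1 hτ.2] with τ' hτ' using hφ.zero _ (hγ2 τ' hτ')
    funext k
    simp only [hy, hF, acceleration_congr g hc0, hf τ hτ, hc0.deriv_eq,
      intervalIntegral.integral_same]
    simp
  have hyt := eq_zero_of_linear_ode hLc hyd h0ε hy0 ht
  refine ⟨F t, fun _ => ?_⟩
  funext k
  exact sub_eq_zero.1 (congrFun hyt k)

end Projective

section MetricCalculus

open Set Filter Topology

variable {ι : Type} [Fintype ι] [DecidableEq ι]

lemma contDiffOn_det {E : Type*} [NormedAddCommGroup E] [NormedSpace ℝ E] {M : Set E}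
    {A : E → Matrix ι ι ℝ} (hA : ∀ i j, ContDiffOn ℝ ∞ (fun p => A p i j) M) :
    ContDiffOn ℝ ∞ (fun p => (A p).det) M := by
  simp only [Matrix.det_apply']
  exact ContDiffOn.sum fun σ _ => contDiffOn_const.mul (contDiffOn_prod fun i _ => hA _ _)

lemma contDiffOn_inv_apply {E : Type*} [NormedAddCommGroup E] [NormedSpace ℝ E] {M : Set E}
    {A : E → Matrix ι ι ℝ} (hA : ∀ i j, ContDiffOn ℝ ∞ (fun p => A p i j) M)
    (hdet : ∀ p ∈ M, (A p).det ≠ 0) (k l : ι) :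
    ContDiffOn ℝ ∞ (fun p => (A p)⁻¹ k l) M := by
  have h1 : ∀ p, (A p)⁻¹ k l = ((A p).det)⁻¹ * ((A p).updateRow l (Pi.single k 1)).det := by
    intro p
    rw [Matrix.inv_def, Matrix.smul_apply, Matrix.adjugate_apply, Ring.inverse_eq_inv', smul_eq_mul]
  simp only [h1]
  refine ((contDiffOn_det hA).inv hdet).mul (contDiffOn_det fun i j => ?_)
  simp only [Matrix.updateRow_apply]
  split_ifs
  · exact contDiffOn_const
  · exact hA i j

lemma IsMetricOn.contDiffOn_christoffel {M : Set (ι → ℝ)} (hM : IsOpen M)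
    {g : (ι → ℝ) → Matrix ι ι ℝ} (hg : IsMetricOn M g) (k i j : ι) :
    ContDiffOn ℝ ∞ (christoffel g k i j) M := by
  unfold christoffel
  refine contDiffOn_const.mul (ContDiffOn.sum fun l _ => ?_)
  have h := fun i j k => contDiffOn_pd hM (hg.smooth i j) k
  exact (contDiffOn_inv_apply hg.smooth hg.nondeg k l).mul (((h j l i).add (h i l j)).sub (h i j l))

end MetricCalculus

section Product

open Set Filter Topology

lemma isOpen_prodDomain {U : Set (Fin 2 → ℝ)} {I : Set ℝ} (hU : IsOpen U) (hI : IsOpen I) :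
    IsOpen (prodDomain U I) := by
  have h1 : Continuous fun p : Fin 2 ⊕ Fin 1 → ℝ => p ∘ Sum.inl := by fun_prop
  have h2 : Continuous fun p : Fin 2 ⊕ Fin 1 → ℝ => p (Sum.inr 0) := by fun_prop
  exact (hU.preimage h1).inter (hI.preimage h2)

lemma hasFDerivAt_comp_inl {f : (Fin 2 → ℝ) → ℝ} {p : Fin 2 ⊕ Fin 1 → ℝ}
    (hf : DifferentiableAt ℝ f (p ∘ Sum.inl)) :
    HasFDerivAt (fun p : Fin 2 ⊕ Fin 1 → ℝ => f (p ∘ Sum.inl))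
      (fderiv ℝ f (p ∘ Sum.inl) ∘L ContinuousLinearMap.pi fun a =>
        ContinuousLinearMap.proj (R := ℝ) (φ := fun _ : Fin 2 ⊕ Fin 1 => ℝ) (Sum.inl a)) p :=
  HasFDerivAt.comp (g := f) (f := fun p : Fin 2 ⊕ Fin 1 → ℝ => p ∘ Sum.inl) p hf.hasFDerivAt
    (ContinuousLinearMap.pi fun a => ContinuousLinearMap.proj (R := ℝ)
      (φ := fun _ : Fin 2 ⊕ Fin 1 => ℝ) (Sum.inl a)).hasFDerivAt

lemma hasFDerivAt_comp_inr {F : ℝ → ℝ} {p : Fin 2 ⊕ Fin 1 → ℝ}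
    (hF : DifferentiableAt ℝ F (p (Sum.inr 0))) :
    HasFDerivAt (fun p : Fin 2 ⊕ Fin 1 → ℝ => F (p (Sum.inr 0)))
      (fderiv ℝ F (p (Sum.inr 0)) ∘L
        ContinuousLinearMap.proj (R := ℝ) (φ := fun _ : Fin 2 ⊕ Fin 1 => ℝ) (Sum.inr 0)) p :=
  HasFDerivAt.comp (g := F) (f := fun p : Fin 2 ⊕ Fin 1 → ℝ => p (Sum.inr 0)) p hF.hasFDerivAt
    (ContinuousLinearMap.proj (R := ℝ)
      (φ := fun _ : Fin 2 ⊕ Fin 1 => ℝ) (Sum.inr 0)).hasFDerivAt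

lemma pd_inl_comp_inl {f : (Fin 2 → ℝ) → ℝ} {p : Fin 2 ⊕ Fin 1 → ℝ}
    (hf : DifferentiableAt ℝ f (p ∘ Sum.inl)) (a : Fin 2) :
    pd (Sum.inl a) (fun p => f (p ∘ Sum.inl)) p = pd a f (p ∘ Sum.inl) := by
  rw [pd, (hasFDerivAt_comp_inl hf).fderiv, pd]
  simp only [ContinuousLinearMap.comp_apply]
  congr 1
  ext b
  simp [Pi.single_apply]

lemma pd_inr_comp_inl {f : (Fin 2 → ℝ) → ℝ} {p : Fin 2 ⊕ Fin 1 → ℝ}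
    (hf : DifferentiableAt ℝ f (p ∘ Sum.inl)) (c : Fin 1) :
    pd (Sum.inr c) (fun p => f (p ∘ Sum.inl)) p = 0 := by
  rw [pd, (hasFDerivAt_comp_inl hf).fderiv]
  simp only [ContinuousLinearMap.comp_apply]
  convert! map_zero (fderiv ℝ f (p ∘ Sum.inl))

lemma pd_inl_comp_inr {F : ℝ → ℝ} {p : Fin 2 ⊕ Fin 1 → ℝ}
    (hF : DifferentiableAt ℝ F (p (Sum.inr 0))) (a : Fin 2) :
    pd (Sum.inl a) (fun p => F (p (Sum.inr 0))) p = 0 := by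
  rw [pd, (hasFDerivAt_comp_inr hF).fderiv]
  simp

lemma pd_inr_comp_inr {F : ℝ → ℝ} {p : Fin 2 ⊕ Fin 1 → ℝ}
    (hF : DifferentiableAt ℝ F (p (Sum.inr 0))) (c : Fin 1) :
    pd (Sum.inr c) (fun p => F (p (Sum.inr 0))) p = deriv F (p (Sum.inr 0)) := by
  rw [pd, (hasFDerivAt_comp_inr hF).fderiv]
  simp [Subsingleton.elim c 0]

lemma pd_inl_mul {f : (Fin 2 → ℝ) → ℝ} {F : ℝ → ℝ} {p : Fin 2 ⊕ Fin 1 → ℝ}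
    (hF : DifferentiableAt ℝ F (p (Sum.inr 0))) (hf : DifferentiableAt ℝ f (p ∘ Sum.inl))
    (a : Fin 2) :
    pd (Sum.inl a) (fun p => F (p (Sum.inr 0)) * f (p ∘ Sum.inl)) p =
      F (p (Sum.inr 0)) * pd a f (p ∘ Sum.inl) := by
  rw [pd_mul (hasFDerivAt_comp_inr hF).differentiableAt
    (hasFDerivAt_comp_inl hf).differentiableAt, pd_inl_comp_inl hf,
    pd_inl_comp_inr hF, zero_mul, zero_add]

lemma pd_inr_mul {f : (Fin 2 → ℝ) → ℝ} {F : ℝ → ℝ} {p : Fin 2 ⊕ Fin 1 → ℝ}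
    (hF : DifferentiableAt ℝ F (p (Sum.inr 0))) (hf : DifferentiableAt ℝ f (p ∘ Sum.inl))
    (c : Fin 1) :
    pd (Sum.inr c) (fun p => F (p (Sum.inr 0)) * f (p ∘ Sum.inl)) p =
      deriv F (p (Sum.inr 0)) * f (p ∘ Sum.inl) := by
  rw [pd_mul (hasFDerivAt_comp_inr hF).differentiableAt
    (hasFDerivAt_comp_inl hf).differentiableAt, pd_inr_comp_inl hf,
    pd_inr_comp_inr hF, mul_zero, add_zero]

section Entries

variable (h : (Fin 2 → ℝ) → Matrix (Fin 2) (Fin 2) ℝ) (ζ : ℝ → ℝ)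

lemma metric21_inl_inl (a b : Fin 2) : (fun p => metric21 h ζ p (Sum.inl a) (Sum.inl b)) =
    fun p => ζ (p (Sum.inr 0)) * h (p ∘ Sum.inl) a b := by
  funext p; simp [metric21]

lemma metric21_inl_inr (a : Fin 2) (c : Fin 1) :
    (fun p => metric21 h ζ p (Sum.inl a) (Sum.inr c)) = fun _ => 0 := by
  funext p; simp [metric21]

lemma metric21_inr_inl (a : Fin 2) (c : Fin 1) :
    (fun p => metric21 h ζ p (Sum.inr c) (Sum.inl a)) = fun _ => 0 := by
  funext p; simp [metric21]

lemma metric21_inr_inr (c d : Fin 1) : (fun p => metric21 h ζ p (Sum.inr c) (Sum.inr d)) =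
    fun p => ζ (p (Sum.inr 0)) := by
  funext p; simp [metric21, Subsingleton.elim c d]

variable {h ζ}

lemma metric21_inv {p : Fin 2 ⊕ Fin 1 → ℝ} (hζ : ζ (p (Sum.inr 0)) ≠ 0)
    (hh : (h (p ∘ Sum.inl)).det ≠ 0) :
    (metric21 h ζ p)⁻¹ = Matrix.fromBlocks ((ζ (p (Sum.inr 0)))⁻¹ • (h (p ∘ Sum.inl))⁻¹) 0 0
      ((ζ (p (Sum.inr 0)))⁻¹ • 1) := by
  apply Matrix.inv_eq_left_inv
  simp [metric21, Matrix.fromBlocks_smul, Matrix.fromBlocks_multiply, smul_smul, hζ,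
    Matrix.nonsing_inv_mul _ (isUnit_iff_ne_zero.mpr hh)]

end Entries

/-- Standing assumptions on the data of a metric `ζ (h + dz²)` on `U × I`. -/
structure IsData (U : Set (Fin 2 → ℝ)) (I : Set ℝ) (h : (Fin 2 → ℝ) → Matrix (Fin 2) (Fin 2) ℝ)
    (ζ : ℝ → ℝ) : Prop where
  openU : IsOpen U
  openI : IsOpen I
  metric : IsMetricOn U h
  smooth : ContDiffOn ℝ ∞ ζ I
  ne_zero : ∀ z ∈ I, ζ z ≠ 0

/-- Half of the logarithmic derivative of `ζ`. -/
noncomputable def halfLogDeriv (ζ : ℝ → ℝ) (z : ℝ) : ℝ := deriv ζ z / (2 * ζ z)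

namespace IsData

variable {U : Set (Fin 2 → ℝ)} {I : Set ℝ} {h : (Fin 2 → ℝ) → Matrix (Fin 2) (Fin 2) ℝ}
  {ζ : ℝ → ℝ} (D : IsData U I h ζ)

include D

lemma isOpen : IsOpen (prodDomain U I) := isOpen_prodDomain D.openU D.openI

lemma diff_ζ {z : ℝ} (hz : z ∈ I) : DifferentiableAt ℝ ζ z :=
  differentiableAt_of_contDiffOn D.openI D.smooth hz

lemma diff_h {q : Fin 2 → ℝ} (hq : q ∈ U) (a b : Fin 2) :
    DifferentiableAt ℝ (fun q => h q a b) q :=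
  differentiableAt_of_contDiffOn D.openU (D.metric.smooth a b) hq

lemma contDiffOn_halfLogDeriv : ContDiffOn ℝ ∞ (halfLogDeriv ζ) I :=
  (D.smooth.deriv_of_isOpen D.openI (by simp)).div (contDiffOn_const.mul D.smooth)
    fun z hz => mul_ne_zero two_ne_zero (D.ne_zero z hz)

lemma diff_halfLogDeriv {z : ℝ} (hz : z ∈ I) : DifferentiableAt ℝ (halfLogDeriv ζ) z :=
  differentiableAt_of_contDiffOn D.openI D.contDiffOn_halfLogDeriv hz

lemma diff_christoffel {q : Fin 2 → ℝ} (hq : q ∈ U) (c a b : Fin 2) :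
    DifferentiableAt ℝ (christoffel h c a b) q :=
  differentiableAt_of_contDiffOn D.openU (D.metric.contDiffOn_christoffel D.openU c a b) hq

lemma christoffel_inl_inl_inl (c a b : Fin 2) :
    EqOn (christoffel (metric21 h ζ) (Sum.inl c) (Sum.inl a) (Sum.inl b))
      (fun p => christoffel h c a b (p ∘ Sum.inl)) (prodDomain U I) := by
  rintro p ⟨hq, hz⟩
  have hζ := D.ne_zero _ hz
  have dh := D.diff_h hq
  simp only [christoffel, metric21_inv hζ (D.metric.nondeg _ hq), Fintype.sum_sum_type,
    metric21_inl_inl, pd_inl_mul (D.diff_ζ hz) (dh _ _), Matrix.fromBlocks_apply₁₁,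
    Matrix.fromBlocks_apply₁₂, Matrix.zero_apply, zero_mul, Finset.sum_const_zero, add_zero,
    Matrix.smul_apply, smul_eq_mul]
  congr 1
  refine Finset.sum_congr rfl fun l _ => ?_
  field_simp

lemma christoffel_inr_inl_inl (e : Fin 1) (a b : Fin 2) :
    EqOn (christoffel (metric21 h ζ) (Sum.inr e) (Sum.inl a) (Sum.inl b))
      (fun p => -halfLogDeriv ζ (p (Sum.inr 0)) * h (p ∘ Sum.inl) a b) (prodDomain U I) := by
  rintro p ⟨hq, hz⟩
  have hζ := D.ne_zero _ hz
  have dh := D.diff_h hq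
  simp only [christoffel, metric21_inv hζ (D.metric.nondeg _ hq), Fintype.sum_sum_type,
    metric21_inl_inl, metric21_inl_inr, pd_const, pd_inr_mul (D.diff_ζ hz) (dh _ _),
    Matrix.fromBlocks_apply₂₁, Matrix.fromBlocks_apply₂₂, Matrix.zero_apply, zero_mul,
    Finset.sum_const_zero, zero_add, Matrix.smul_apply, smul_eq_mul, halfLogDeriv,
    Finset.univ_unique, Finset.sum_singleton, Subsingleton.elim e default, Matrix.one_apply_eq]
  field_simp
  ring

lemma christoffel_inl_inl_inr (c a : Fin 2) (e : Fin 1) :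
    EqOn (christoffel (metric21 h ζ) (Sum.inl c) (Sum.inl a) (Sum.inr e))
      (fun p => halfLogDeriv ζ (p (Sum.inr 0)) * (1 : Matrix (Fin 2) (Fin 2) ℝ) c a)
      (prodDomain U I) := by
  rintro p ⟨hq, hz⟩
  have hζ := D.ne_zero _ hz
  have dh := D.diff_h hq
  have hinv : ∑ l, (h (p ∘ Sum.inl))⁻¹ c l * h (p ∘ Sum.inl) a l =
      (1 : Matrix (Fin 2) (Fin 2) ℝ) c a := by
    rw [← Matrix.nonsing_inv_mul _ (isUnit_iff_ne_zero.mpr (D.metric.nondeg _ hq)),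
      Matrix.mul_apply]
    exact Finset.sum_congr rfl fun l _ => by rw [(D.metric.symm _ hq).apply]
  simp only [christoffel, metric21_inv hζ (D.metric.nondeg _ hq), Fintype.sum_sum_type,
    metric21_inl_inl, metric21_inr_inl, metric21_inl_inr, pd_const,
    pd_inr_mul (D.diff_ζ hz) (dh _ _), Matrix.fromBlocks_apply₁₁, Matrix.fromBlocks_apply₁₂,
    Matrix.zero_apply, zero_mul, Finset.sum_const_zero, add_zero, zero_add, sub_zero,
    Matrix.smul_apply, smul_eq_mul, halfLogDeriv]
  rw [← hinv, Finset.mul_sum, Finset.mul_sum]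
  refine Finset.sum_congr rfl fun l _ => ?_
  field_simp

lemma christoffel_symm (k i j : Fin 2 ⊕ Fin 1) :
    EqOn (christoffel (metric21 h ζ) k i j) (christoffel (metric21 h ζ) k j i)
      (prodDomain U I) := by
  intro p hp
  have hs : ∀ i j : Fin 2 ⊕ Fin 1, EqOn (fun q => metric21 h ζ q i j)
      (fun q => metric21 h ζ q j i) (prodDomain U I) := by
    rintro (i | i) (j | j) q hq
    · simp [metric21, (D.metric.symm _ hq.1).apply i j]
    · simp [metric21]
    · simp [metric21]
    · simp [metric21, Subsingleton.elim i j]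
  unfold christoffel
  congr 1
  refine Finset.sum_congr rfl fun l _ => ?_
  rw [pd_congr D.isOpen (hs i j) hp l]
  ring

lemma christoffel_inl_inr_inl (c a : Fin 2) (e : Fin 1) :
    EqOn (christoffel (metric21 h ζ) (Sum.inl c) (Sum.inr e) (Sum.inl a))
      (fun p => halfLogDeriv ζ (p (Sum.inr 0)) * (1 : Matrix (Fin 2) (Fin 2) ℝ) c a)
      (prodDomain U I) :=
  (D.christoffel_symm _ _ _).trans (D.christoffel_inl_inl_inr c a e)

lemma christoffel_inl_inr_inr (c : Fin 2) (d e : Fin 1) :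
    EqOn (christoffel (metric21 h ζ) (Sum.inl c) (Sum.inr d) (Sum.inr e)) (fun _ => 0)
      (prodDomain U I) := by
  rintro p ⟨hq, hz⟩
  have hζ := D.ne_zero _ hz
  simp only [christoffel, metric21_inv hζ (D.metric.nondeg _ hq), Fintype.sum_sum_type,
    metric21_inr_inl, metric21_inr_inr, pd_const, pd_inl_comp_inr (D.diff_ζ hz),
    Matrix.fromBlocks_apply₁₂, Matrix.zero_apply, zero_mul, Finset.sum_const_zero, add_zero,
    sub_zero, mul_zero]

lemma christoffel_inr_inl_inr (a : Fin 2) (d e : Fin 1) :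
    EqOn (christoffel (metric21 h ζ) (Sum.inr d) (Sum.inl a) (Sum.inr e)) (fun _ => 0)
      (prodDomain U I) := by
  rintro p ⟨hq, hz⟩
  have hζ := D.ne_zero _ hz
  simp only [christoffel, metric21_inv hζ (D.metric.nondeg _ hq), Fintype.sum_sum_type,
    metric21_inl_inr, metric21_inr_inr, pd_const, pd_inl_comp_inr (D.diff_ζ hz),
    Matrix.fromBlocks_apply₂₁, Matrix.zero_apply, zero_mul, Finset.sum_const_zero, add_zero,
    sub_zero, mul_zero]

lemma christoffel_inr_inr_inl (a : Fin 2) (d e : Fin 1) :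
    EqOn (christoffel (metric21 h ζ) (Sum.inr d) (Sum.inr e) (Sum.inl a)) (fun _ => 0)
      (prodDomain U I) :=
  (D.christoffel_symm _ _ _).trans (D.christoffel_inr_inl_inr a d e)

lemma christoffel_inr_inr_inr (c d e : Fin 1) :
    EqOn (christoffel (metric21 h ζ) (Sum.inr c) (Sum.inr d) (Sum.inr e))
      (fun p => halfLogDeriv ζ (p (Sum.inr 0))) (prodDomain U I) := by
  rintro p ⟨hq, hz⟩
  have hζ := D.ne_zero _ hz
  simp only [christoffel, metric21_inv hζ (D.metric.nondeg _ hq), Fintype.sum_sum_type,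
    metric21_inr_inr, pd_inr_comp_inr (D.diff_ζ hz), Matrix.fromBlocks_apply₂₁,
    Matrix.fromBlocks_apply₂₂, Matrix.zero_apply, zero_mul, Finset.sum_const_zero, zero_add,
    Matrix.smul_apply, smul_eq_mul, halfLogDeriv, Finset.univ_unique, Finset.sum_singleton,
    Subsingleton.elim c default, Matrix.one_apply_eq]
  field_simp
  ring

end IsData

end Product

section ProductLie

open Set Filter Topology

variable {u : (Fin 2 → ℝ) → Fin 2 → ℝ} {α : ℝ → ℝ}

lemma contDiffOn_field21 {U : Set (Fin 2 → ℝ)} {I : Set ℝ} (hu : ContDiffOn ℝ ∞ u U)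
    (hα : ContDiffOn ℝ ∞ α I) : ContDiffOn ℝ ∞ (field21 u α) (prodDomain U I) := by
  have h1 : ContDiff ℝ ∞ fun p : Fin 2 ⊕ Fin 1 → ℝ => p ∘ Sum.inl :=
    contDiff_pi.2 fun a => contDiff_apply ℝ ℝ (Sum.inl a)
  have h2 : ContDiff ℝ ∞ fun p : Fin 2 ⊕ Fin 1 → ℝ => p (Sum.inr 0) :=
    contDiff_apply ℝ ℝ (Sum.inr 0)
  refine contDiffOn_pi.2 ?_
  rintro (a | e)
  · exact (contDiffOn_pi.1 hu a).comp h1.contDiffOn fun p hp => hp.1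
  · exact hα.comp h2.contDiffOn fun p hp => hp.2

lemma pd_inl_field21_inl {p : Fin 2 ⊕ Fin 1 → ℝ} {c : Fin 2}
    (hu : DifferentiableAt ℝ (fun q => u q c) (p ∘ Sum.inl)) (a : Fin 2) :
    pd (Sum.inl a) (fun p => field21 u α p (Sum.inl c)) p = pd a (fun q => u q c) (p ∘ Sum.inl) :=
  pd_inl_comp_inl (f := fun q => u q c) hu a

lemma pd_inr_field21_inl {p : Fin 2 ⊕ Fin 1 → ℝ} {c : Fin 2}
    (hu : DifferentiableAt ℝ (fun q => u q c) (p ∘ Sum.inl)) (e : Fin 1) :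
    pd (Sum.inr e) (fun p => field21 u α p (Sum.inl c)) p = 0 :=
  pd_inr_comp_inl (f := fun q => u q c) hu e

lemma pd_inl_field21_inr {p : Fin 2 ⊕ Fin 1 → ℝ} (hα : DifferentiableAt ℝ α (p (Sum.inr 0)))
    (a : Fin 2) (e : Fin 1) : pd (Sum.inl a) (fun p => field21 u α p (Sum.inr e)) p = 0 :=
  pd_inl_comp_inr hα a

lemma pd_inr_field21_inr {p : Fin 2 ⊕ Fin 1 → ℝ} (hα : DifferentiableAt ℝ α (p (Sum.inr 0)))
    (d e : Fin 1) :
    pd (Sum.inr d) (fun p => field21 u α p (Sum.inr e)) p = deriv α (p (Sum.inr 0)) :=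
  pd_inr_comp_inr hα d

namespace IsData

variable {U : Set (Fin 2 → ℝ)} {I : Set ℝ} {h : (Fin 2 → ℝ) → Matrix (Fin 2) (Fin 2) ℝ}
  {ζ : ℝ → ℝ} (D : IsData U I h ζ) {p : Fin 2 ⊕ Fin 1 → ℝ} (hp : p ∈ prodDomain U I)

include D hp

lemma pd_inl_christoffel_inl_inl_inl (m c a b : Fin 2) :
    pd (Sum.inl m) (christoffel (metric21 h ζ) (Sum.inl c) (Sum.inl a) (Sum.inl b)) p =
      pd m (christoffel h c a b) (p ∘ Sum.inl) := by
  rw [pd_congr D.isOpen (D.christoffel_inl_inl_inl c a b) hp,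
    pd_inl_comp_inl (D.diff_christoffel hp.1 c a b)]

lemma pd_inr_christoffel_inl_inl_inl (e : Fin 1) (c a b : Fin 2) :
    pd (Sum.inr e) (christoffel (metric21 h ζ) (Sum.inl c) (Sum.inl a) (Sum.inl b)) p = 0 := by
  rw [pd_congr D.isOpen (D.christoffel_inl_inl_inl c a b) hp,
    pd_inr_comp_inl (D.diff_christoffel hp.1 c a b)]

lemma pd_inl_christoffel_inr_inl_inl (m : Fin 2) (e : Fin 1) (a b : Fin 2) :
    pd (Sum.inl m) (christoffel (metric21 h ζ) (Sum.inr e) (Sum.inl a) (Sum.inl b)) p =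
      -halfLogDeriv ζ (p (Sum.inr 0)) * pd m (fun q => h q a b) (p ∘ Sum.inl) := by
  rw [pd_congr D.isOpen (D.christoffel_inr_inl_inl e a b) hp,
    pd_inl_mul (F := fun z => -halfLogDeriv ζ z) (f := fun q => h q a b)
      (D.diff_halfLogDeriv hp.2).neg (D.diff_h hp.1 a b)]

lemma pd_inr_christoffel_inr_inl_inl (d e : Fin 1) (a b : Fin 2) :
    pd (Sum.inr d) (christoffel (metric21 h ζ) (Sum.inr e) (Sum.inl a) (Sum.inl b)) p =
      -deriv (halfLogDeriv ζ) (p (Sum.inr 0)) * h (p ∘ Sum.inl) a b := by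
  rw [pd_congr D.isOpen (D.christoffel_inr_inl_inl e a b) hp,
    pd_inr_mul (F := fun z => -halfLogDeriv ζ z) (f := fun q => h q a b)
      (D.diff_halfLogDeriv hp.2).neg (D.diff_h hp.1 a b), deriv.fun_neg]

lemma pd_inl_christoffel_inl_inl_inr (m c a : Fin 2) (e : Fin 1) :
    pd (Sum.inl m) (christoffel (metric21 h ζ) (Sum.inl c) (Sum.inl a) (Sum.inr e)) p = 0 := by
  rw [pd_congr D.isOpen (D.christoffel_inl_inl_inr c a e) hp,
    pd_inl_mul (f := fun _ => (1 : Matrix (Fin 2) (Fin 2) ℝ) c a) (D.diff_halfLogDeriv hp.2)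
      (differentiableAt_const _), pd_const, mul_zero]

lemma pd_inr_christoffel_inl_inl_inr (d : Fin 1) (c a : Fin 2) (e : Fin 1) :
    pd (Sum.inr d) (christoffel (metric21 h ζ) (Sum.inl c) (Sum.inl a) (Sum.inr e)) p =
      deriv (halfLogDeriv ζ) (p (Sum.inr 0)) * (1 : Matrix (Fin 2) (Fin 2) ℝ) c a := by
  rw [pd_congr D.isOpen (D.christoffel_inl_inl_inr c a e) hp,
    pd_inr_mul (f := fun _ => (1 : Matrix (Fin 2) (Fin 2) ℝ) c a) (D.diff_halfLogDeriv hp.2)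
      (differentiableAt_const _)]

lemma pd_inl_christoffel_inr_inr_inr (m : Fin 2) (c d e : Fin 1) :
    pd (Sum.inl m) (christoffel (metric21 h ζ) (Sum.inr c) (Sum.inr d) (Sum.inr e)) p = 0 := by
  rw [pd_congr D.isOpen (D.christoffel_inr_inr_inr c d e) hp,
    pd_inl_comp_inr (D.diff_halfLogDeriv hp.2)]

lemma pd_inr_christoffel_inr_inr_inr (b c d e : Fin 1) :
    pd (Sum.inr b) (christoffel (metric21 h ζ) (Sum.inr c) (Sum.inr d) (Sum.inr e)) p =
      deriv (halfLogDeriv ζ) (p (Sum.inr 0)) := by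
  rw [pd_congr D.isOpen (D.christoffel_inr_inr_inr c d e) hp,
    pd_inr_comp_inr (D.diff_halfLogDeriv hp.2)]

lemma pd_christoffel_inl_inr_inr (m : Fin 2 ⊕ Fin 1) (c : Fin 2) (d e : Fin 1) :
    pd m (christoffel (metric21 h ζ) (Sum.inl c) (Sum.inr d) (Sum.inr e)) p = 0 := by
  rw [pd_congr D.isOpen (D.christoffel_inl_inr_inr c d e) hp, pd_const]

lemma pd_christoffel_inr_inl_inr (m : Fin 2 ⊕ Fin 1) (a : Fin 2) (d e : Fin 1) :
    pd m (christoffel (metric21 h ζ) (Sum.inr d) (Sum.inl a) (Sum.inr e)) p = 0 := by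
  rw [pd_congr D.isOpen (D.christoffel_inr_inl_inr a d e) hp, pd_const]

variable (hu : ContDiffOn ℝ ∞ u U) (hα : ContDiffOn ℝ ∞ α I)

include hu

lemma diff_field_inl (c : Fin 2) : DifferentiableAt ℝ (fun q => u q c) (p ∘ Sum.inl) :=
  differentiableAt_of_contDiffOn D.openU (contDiffOn_pi.1 hu c) hp.1

omit hu in
include hα in
lemma diff_field_inr : DifferentiableAt ℝ α (p (Sum.inr 0)) :=
  differentiableAt_of_contDiffOn D.openI hα hp.2

lemma pd_pd_inl_field21_inl (i : Fin 2 ⊕ Fin 1) (b c : Fin 2) :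
    pd i (pd (Sum.inl b) fun p => field21 u α p (Sum.inl c)) p =
      Sum.elim (fun a => pd a (pd b fun q => u q c) (p ∘ Sum.inl)) (fun _ => 0) i := by
  have hd : DifferentiableAt ℝ (pd b fun q => u q c) (p ∘ Sum.inl) :=
    differentiableAt_of_contDiffOn D.openU (contDiffOn_pd D.openU (contDiffOn_pi.1 hu c) b) hp.1
  rw [pd_congr D.isOpen (fun q hq => pd_inl_field21_inl (D.diff_field_inl hq hu c) b) hp]
  rcases i with a | e
  · rw [pd_inl_comp_inl hd, Sum.elim_inl]
  · rw [pd_inr_comp_inl hd, Sum.elim_inr]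

lemma pd_pd_inr_field21_inl (i : Fin 2 ⊕ Fin 1) (e : Fin 1) (c : Fin 2) :
    pd i (pd (Sum.inr e) fun p => field21 u α p (Sum.inl c)) p = 0 := by
  rw [pd_congr D.isOpen (f' := fun _ => 0)
    (fun q hq => pd_inr_field21_inl (D.diff_field_inl hq hu c) e) hp, pd_const]

omit hu
include hα

lemma pd_pd_inl_field21_inr (i : Fin 2 ⊕ Fin 1) (b : Fin 2) (e : Fin 1) :
    pd i (pd (Sum.inl b) fun p => field21 u α p (Sum.inr e)) p = 0 := by
  rw [pd_congr D.isOpen (f' := fun _ => 0)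
    (fun q hq => pd_inl_field21_inr (D.diff_field_inr hq hα) b e) hp, pd_const]

lemma pd_pd_inr_field21_inr (i : Fin 2 ⊕ Fin 1) (d e : Fin 1) :
    pd i (pd (Sum.inr d) fun p => field21 u α p (Sum.inr e)) p =
      Sum.elim (fun _ => 0) (fun _ => deriv (deriv α) (p (Sum.inr 0))) i := by
  have hd : DifferentiableAt ℝ (deriv α) (p (Sum.inr 0)) :=
    differentiableAt_of_contDiffOn D.openI (hα.deriv_of_isOpen D.openI (by simp)) hp.2
  rw [pd_congr D.isOpen (fun q hq => pd_inr_field21_inr (D.diff_field_inr hq hα) d e) hp]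
  rcases i with a | e
  · rw [pd_inl_comp_inr hd, Sum.elim_inl]
  · rw [pd_inr_comp_inr hd, Sum.elim_inr]

include hu

lemma lieConnection_inl_inl_inl (c a b : Fin 2) :
    lieConnection (field21 u α) (christoffel (metric21 h ζ)) (Sum.inl c) (Sum.inl a) (Sum.inl b) p =
      lieConnection u (christoffel h) c a b (p ∘ Sum.inl) := by
  have du := D.diff_field_inl hp hu
  have dα := D.diff_field_inr hp hα
  simp only [lieConnection, Fintype.sum_sum_type, D.pd_inl_christoffel_inl_inl_inl hp,
    D.pd_inr_christoffel_inl_inl_inl hp, D.christoffel_inl_inl_inl _ _ _ hp,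
    pd_inl_field21_inl (du _), pd_inr_field21_inl (du _), pd_inl_field21_inr dα,
    D.pd_pd_inl_field21_inl hp hu]
  simp [field21]

lemma lieConnection_inr_inl_inl (e : Fin 1) (a b : Fin 2) :
    lieConnection (field21 u α) (christoffel (metric21 h ζ)) (Sum.inr e) (Sum.inl a) (Sum.inl b) p =
      -(halfLogDeriv ζ (p (Sum.inr 0)) * lieMetric u h (p ∘ Sum.inl) a b +
        (α (p (Sum.inr 0)) * deriv (halfLogDeriv ζ) (p (Sum.inr 0)) -
          deriv α (p (Sum.inr 0)) * halfLogDeriv ζ (p (Sum.inr 0))) * h (p ∘ Sum.inl) a b) := by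
  have du := D.diff_field_inl hp hu
  have dα := D.diff_field_inr hp hα
  simp only [lieConnection, Fintype.sum_sum_type, D.pd_inl_christoffel_inr_inl_inl hp,
    D.pd_inr_christoffel_inr_inl_inl hp, D.christoffel_inr_inl_inl _ _ _ hp,
    D.christoffel_inr_inl_inr _ _ _ hp, D.christoffel_inr_inr_inl _ _ _ hp,
    pd_inl_field21_inl (du _), pd_inl_field21_inr dα, pd_inr_field21_inr dα,
    D.pd_pd_inl_field21_inr hp hα, lieMetric, Matrix.of_apply, Fin.sum_univ_two]
  simp [field21]
  ring

lemma lieConnection_inl_inl_inr (c a : Fin 2) (e : Fin 1) :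
    lieConnection (field21 u α) (christoffel (metric21 h ζ)) (Sum.inl c) (Sum.inl a) (Sum.inr e) p =
      (α (p (Sum.inr 0)) * deriv (halfLogDeriv ζ) (p (Sum.inr 0)) +
          deriv α (p (Sum.inr 0)) * halfLogDeriv ζ (p (Sum.inr 0))) *
        (1 : Matrix (Fin 2) (Fin 2) ℝ) c a := by
  have du := D.diff_field_inl hp hu
  have dα := D.diff_field_inr hp hα
  simp only [lieConnection, Fintype.sum_sum_type, D.pd_inl_christoffel_inl_inl_inr hp,
    D.pd_inr_christoffel_inl_inl_inr hp, D.christoffel_inl_inl_inr _ _ _ hp,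
    D.christoffel_inl_inl_inl _ _ _ hp, D.christoffel_inr_inl_inr _ _ _ hp,
    D.christoffel_inl_inr_inr _ _ _ hp,
    pd_inl_field21_inl (du _), pd_inr_field21_inl (du _), pd_inl_field21_inr dα,
    pd_inr_field21_inr dα, D.pd_pd_inr_field21_inl hp hu, Fin.sum_univ_two]
  obtain rfl | rfl : c = 0 ∨ c = 1 := by omega
  all_goals obtain rfl | rfl : a = 0 ∨ a = 1 := by omega
  all_goals simp [field21] <;> ring

lemma lieConnection_symm (k i j : Fin 2 ⊕ Fin 1) :
    lieConnection (field21 u α) (christoffel (metric21 h ζ)) k i j p =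
      lieConnection (field21 u α) (christoffel (metric21 h ζ)) k j i p := by
  have hv := contDiffOn_pi.1 (contDiffOn_field21 hu hα) k
  simp only [lieConnection]
  rw [pd_comm D.isOpen hv hp]
  congr 1
  refine Finset.sum_congr rfl fun m _ => ?_
  rw [pd_congr D.isOpen (D.christoffel_symm k i j) hp, D.christoffel_symm m i j hp,
    D.christoffel_symm k m j hp, D.christoffel_symm k i m hp]
  ring

lemma lieConnection_inr_inr_inr (c d e : Fin 1) :
    lieConnection (field21 u α) (christoffel (metric21 h ζ)) (Sum.inr c) (Sum.inr d) (Sum.inr e) p =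
      α (p (Sum.inr 0)) * deriv (halfLogDeriv ζ) (p (Sum.inr 0)) +
          deriv α (p (Sum.inr 0)) * halfLogDeriv ζ (p (Sum.inr 0)) +
        deriv (deriv α) (p (Sum.inr 0)) := by
  have du := D.diff_field_inl hp hu
  have dα := D.diff_field_inr hp hα
  simp only [lieConnection, Fintype.sum_sum_type, D.pd_inl_christoffel_inr_inr_inr hp,
    D.pd_inr_christoffel_inr_inr_inr hp, D.christoffel_inr_inr_inr _ _ _ hp,
    D.christoffel_inl_inr_inr _ _ _ hp, D.christoffel_inr_inl_inr _ _ _ hp,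
    D.christoffel_inr_inr_inl _ _ _ hp,
    pd_inr_field21_inl (du _), pd_inl_field21_inr dα,
    pd_inr_field21_inr dα, D.pd_pd_inr_field21_inr hp hα, Fin.sum_univ_two]
  simp [field21]
  ring

lemma lieConnection_inl_inr_inr (c : Fin 2) (d e : Fin 1) :
    lieConnection (field21 u α) (christoffel (metric21 h ζ)) (Sum.inl c) (Sum.inr d) (Sum.inr e) p =
      0 := by
  have du := D.diff_field_inl hp hu
  simp only [lieConnection, Fintype.sum_sum_type, D.pd_christoffel_inl_inr_inr hp,
    D.christoffel_inl_inr_inr _ _ _ hp,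
    pd_inr_field21_inl (du _), D.pd_pd_inr_field21_inl hp hu]
  simp

lemma lieConnection_inr_inl_inr (a : Fin 2) (d e : Fin 1) :
    lieConnection (field21 u α) (christoffel (metric21 h ζ)) (Sum.inr d) (Sum.inl a) (Sum.inr e) p =
      0 := by
  have du := D.diff_field_inl hp hu
  have dα := D.diff_field_inr hp hα
  simp only [lieConnection, Fintype.sum_sum_type, D.pd_christoffel_inr_inl_inr hp,
    D.christoffel_inr_inl_inr _ _ _ hp, pd_inl_field21_inr dα,
    pd_inr_field21_inl (du _), D.pd_pd_inr_field21_inr hp hα]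
  simp

/-- The horizontal part of `(L_v Γ)(X, X)`. -/
lemma sum_lieConnection_inl (X : Fin 2 ⊕ Fin 1 → ℝ) (c : Fin 2) :
    ∑ i, ∑ j, lieConnection (field21 u α) (christoffel (metric21 h ζ)) (Sum.inl c) i j p *
        X i * X j =
      ∑ a, ∑ b, lieConnection u (christoffel h) c a b (p ∘ Sum.inl) * X (Sum.inl a) *
        X (Sum.inl b) +
      2 * (α (p (Sum.inr 0)) * deriv (halfLogDeriv ζ) (p (Sum.inr 0)) +
          deriv α (p (Sum.inr 0)) * halfLogDeriv ζ (p (Sum.inr 0))) * X (Sum.inl c) *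
        X (Sum.inr 0) := by
  simp only [Fintype.sum_sum_type, D.lieConnection_inl_inl_inl hp hu hα,
    D.lieConnection_symm hp hu hα (Sum.inl c) (Sum.inr _) (Sum.inl _),
    D.lieConnection_inl_inl_inr hp hu hα, D.lieConnection_inl_inr_inr hp hu hα,
    Finset.univ_unique, Fin.default_eq_zero, Finset.sum_singleton, Fin.sum_univ_two]
  obtain rfl | rfl : c = 0 ∨ c = 1 := by omega
  all_goals (simp; ring)

/-- The vertical part of `(L_v Γ)(X, X)`. -/
lemma sum_lieConnection_inr (X : Fin 2 ⊕ Fin 1 → ℝ) (e : Fin 1) :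
    ∑ i, ∑ j, lieConnection (field21 u α) (christoffel (metric21 h ζ)) (Sum.inr e) i j p *
        X i * X j =
      -∑ a, ∑ b, (halfLogDeriv ζ (p (Sum.inr 0)) * lieMetric u h (p ∘ Sum.inl) a b +
        (α (p (Sum.inr 0)) * deriv (halfLogDeriv ζ) (p (Sum.inr 0)) -
          deriv α (p (Sum.inr 0)) * halfLogDeriv ζ (p (Sum.inr 0))) * h (p ∘ Sum.inl) a b) *
          X (Sum.inl a) * X (Sum.inl b) +
      (α (p (Sum.inr 0)) * deriv (halfLogDeriv ζ) (p (Sum.inr 0)) +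
          deriv α (p (Sum.inr 0)) * halfLogDeriv ζ (p (Sum.inr 0)) +
        deriv (deriv α) (p (Sum.inr 0))) * X (Sum.inr 0) ^ 2 := by
  simp only [Fintype.sum_sum_type, D.lieConnection_inr_inl_inl hp hu hα,
    D.lieConnection_symm hp hu hα (Sum.inr e) (Sum.inr _) (Sum.inl _),
    D.lieConnection_inr_inl_inr hp hu hα, D.lieConnection_inr_inr_inr hp hu hα,
    Finset.univ_unique, Fin.default_eq_zero, Finset.sum_singleton, Fin.sum_univ_two]
  ring

end IsData

end ProductLie

section Symmetry

open Set Filter Topology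

variable {ι : Type} [Fintype ι] [DecidableEq ι] {M : Set (ι → ℝ)} {g : (ι → ℝ) → Matrix ι ι ℝ}

lemma IsMetricOn.pd_symm (hM : IsOpen M) (hg : IsMetricOn M g) {p : ι → ℝ} (hp : p ∈ M)
    (k i j : ι) : pd k (fun q => g q i j) p = pd k (fun q => g q j i) p :=
  pd_congr hM (fun q hq => ((hg.symm q hq).apply i j).symm) hp k

lemma IsMetricOn.christoffel_symm (hM : IsOpen M) (hg : IsMetricOn M g) (k i j : ι) :
    EqOn (christoffel g k i j) (christoffel g k j i) M := by
  intro p hp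
  unfold christoffel
  congr 1
  refine Finset.sum_congr rfl fun l _ => ?_
  rw [hg.pd_symm hM hp l i j]
  ring

lemma IsMetricOn.lieConnection_symm (hM : IsOpen M) (hg : IsMetricOn M g) {v : (ι → ℝ) → ι → ℝ}
    (hv : ContDiffOn ℝ ∞ v M) {p : ι → ℝ} (hp : p ∈ M) (k i j : ι) :
    lieConnection v (christoffel g) k i j p = lieConnection v (christoffel g) k j i p := by
  simp only [lieConnection]
  rw [pd_comm hM (contDiffOn_pi.1 hv k) hp]
  congr 1
  refine Finset.sum_congr rfl fun m _ => ?_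
  rw [pd_congr hM (hg.christoffel_symm hM k i j) hp, hg.christoffel_symm hM m i j hp,
    hg.christoffel_symm hM k m j hp, hg.christoffel_symm hM k i m hp]
  ring

lemma IsMetricOn.lieMetric_symm (hM : IsOpen M) (hg : IsMetricOn M g) (v : (ι → ℝ) → ι → ℝ)
    {p : ι → ℝ} (hp : p ∈ M) (i j : ι) : lieMetric v g p i j = lieMetric v g p j i := by
  simp only [lieMetric, Matrix.of_apply]
  refine Finset.sum_congr rfl fun k _ => ?_
  rw [hg.pd_symm hM hp k i j, (hg.symm p hp).apply k j, (hg.symm p hp).apply k i]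
  ring

end Symmetry

section Criterion

open Set Filter Topology

lemma eq_zero_of_quadraticForm_eq_zero {B : Fin 2 → Fin 2 → ℝ} (hs : ∀ a b, B a b = B b a)
    (hB : ∀ x : Fin 2 → ℝ, ∑ a, ∑ b, B a b * x a * x b = 0) (a b : Fin 2) : B a b = 0 := by
  have h1 := hB ![1, 0]
  have h2 := hB ![0, 1]
  have h3 := hB ![1, 1]
  have h4 := hs 0 1
  simp [Fin.sum_univ_two] at h1 h2 h3
  obtain rfl | rfl : a = 0 ∨ a = 1 := by omega
  all_goals obtain rfl | rfl : b = 0 ∨ b = 1 := by omega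
  all_goals linarith

namespace IsData

variable {U : Set (Fin 2 → ℝ)} {I : Set ℝ} {h : (Fin 2 → ℝ) → Matrix (Fin 2) (Fin 2) ℝ}
  {ζ : ℝ → ℝ} (D : IsData U I h ζ) {u : (Fin 2 → ℝ) → Fin 2 → ℝ} {α : ℝ → ℝ}
  (hu : ContDiffOn ℝ ∞ u U) (hα : ContDiffOn ℝ ∞ α I)

include D

lemma isMetricOn : IsMetricOn (prodDomain U I) (metric21 h ζ) where
  smooth i j := by
    have h1 : ContDiff ℝ ∞ fun p : Fin 2 ⊕ Fin 1 → ℝ => p ∘ Sum.inl :=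
      contDiff_pi.2 fun a => contDiff_apply ℝ ℝ (Sum.inl a)
    have h2 : ContDiff ℝ ∞ fun p : Fin 2 ⊕ Fin 1 → ℝ => p (Sum.inr 0) :=
      contDiff_apply ℝ ℝ (Sum.inr 0)
    have h3 : ContDiffOn ℝ ∞ (fun p : Fin 2 ⊕ Fin 1 → ℝ => ζ (p (Sum.inr 0))) (prodDomain U I) :=
      D.smooth.comp h2.contDiffOn fun p hp => hp.2
    rcases i with a | d <;> rcases j with b | e
    · rw [metric21_inl_inl]
      exact h3.mul ((D.metric.smooth a b).comp h1.contDiffOn fun p hp => hp.1)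
    · rw [metric21_inl_inr]
      exact contDiffOn_const
    · rw [metric21_inr_inl]
      exact contDiffOn_const
    · rw [metric21_inr_inr]
      exact h3
  symm p hp := by
    refine Matrix.IsSymm.smul ?_ _
    exact Matrix.IsSymm.fromBlocks (D.metric.symm _ hp.1) (by simp) Matrix.isSymm_one
  nondeg p hp := by
    simp only [metric21, Matrix.det_smul, Matrix.det_fromBlocks_zero₂₁, Matrix.det_one, mul_one]
    exact mul_ne_zero (pow_ne_zero _ (D.ne_zero _ hp.2)) (D.metric.nondeg _ hp.1)

include hu hα

/-- The equations that a projective field `u + α(z) ∂_z` satisfies. -/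
theorem equations_of_isProjective (hUn : U.Nonempty) (hIn : I.Nonempty)
    (hproj : IsProjective (prodDomain U I) (metric21 h ζ) (field21 u α)) :
    (∀ q ∈ U, ∀ c a b, lieConnection u (christoffel h) c a b q = 0) ∧
    (∀ z ∈ I, α z * deriv (halfLogDeriv ζ) z + deriv α z * halfLogDeriv ζ z =
      deriv (deriv α) z) ∧
    ∀ q ∈ U, ∀ z ∈ I, ∀ a b, halfLogDeriv ζ z * lieMetric u h q a b +
      (α z * deriv (halfLogDeriv ζ) z - deriv α z * halfLogDeriv ζ z) * h q a b = 0 := by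
  have key : ∀ q ∈ U, ∀ z ∈ I, ∀ (x : Fin 2 → ℝ) (w : ℝ) (c : Fin 2),
      (∑ a, ∑ b, lieConnection u (christoffel h) c a b q * x a * x b +
        2 * (α z * deriv (halfLogDeriv ζ) z + deriv α z * halfLogDeriv ζ z) * x c * w) * w =
      (-∑ a, ∑ b, (halfLogDeriv ζ z * lieMetric u h q a b +
        (α z * deriv (halfLogDeriv ζ) z - deriv α z * halfLogDeriv ζ z) * h q a b) * x a * x b +
        (α z * deriv (halfLogDeriv ζ) z + deriv α z * halfLogDeriv ζ z +
          deriv (deriv α) z) * w ^ 2) * x c := by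
    intro q hq z hz x w c
    have hp : (Sum.elim q fun _ => z : Fin 2 ⊕ Fin 1 → ℝ) ∈ prodDomain U I := ⟨hq, hz⟩
    have h1 := hproj.lieConnection_wedge D.isOpen (D.isMetricOn.contDiffOn_christoffel D.isOpen)
      (contDiffOn_field21 hu hα) hp (Sum.elim x fun _ => w) (Sum.inl c) (Sum.inr 0)
    rw [D.sum_lieConnection_inl hp hu hα, D.sum_lieConnection_inr hp hu hα] at h1
    exact h1
  have hD : ∀ q ∈ U, ∀ c a b, lieConnection u (christoffel h) c a b q = 0 := by
    intro q hq c
    obtain ⟨z, hz⟩ := hIn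
    refine eq_zero_of_quadraticForm_eq_zero
      (fun a b => D.metric.lieConnection_symm D.openU hu hq c a b) fun x => ?_
    linarith [key q hq z hz x 1 c, key q hq z hz x (-1) c, key q hq z hz x 0 c]
  refine ⟨hD, ?_, ?_⟩
  · intro z hz
    obtain ⟨q, hq⟩ := hUn
    have h1 := key q hq z hz ![1, 0] 1 0
    have h2 := key q hq z hz ![1, 0] 0 0
    simp only [hD q hq, Fin.sum_univ_two] at h1 h2
    simp at h1 h2
    linarith
  · intro q hq z hz
    refine eq_zero_of_quadraticForm_eq_zero (fun a b => ?_) fun x => ?_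
    · rw [D.metric.lieMetric_symm D.openU u hq a b, (D.metric.symm q hq).apply b a]
    · by_cases hx : x = 0
      · simp [hx]
      · obtain ⟨c, hc⟩ := Function.ne_iff.1 hx
        have h1 := key q hq z hz x 0 c
        refine (mul_eq_zero.1 (?_ : _ * x c = 0)).resolve_right hc
        linarith

/-- The equations on `u`, `α` and `ζ` under which the field `u + α(z) ∂_z` is projective. -/
theorem isProjective_of_equations
    (hD : ∀ q ∈ U, ∀ c a b, lieConnection u (christoffel h) c a b q = 0)
    (hα' : ∀ z ∈ I, α z * deriv (halfLogDeriv ζ) z + deriv α z * halfLogDeriv ζ z =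
      deriv (deriv α) z)
    (hT : ∀ q ∈ U, ∀ z ∈ I, ∀ a b, halfLogDeriv ζ z * lieMetric u h q a b +
      (α z * deriv (halfLogDeriv ζ) z - deriv α z * halfLogDeriv ζ z) * h q a b = 0) :
    IsProjective (prodDomain U I) (metric21 h ζ) (field21 u α) := by
  refine isProjective_of_lieConnection D.isOpen (D.isMetricOn.contDiffOn_christoffel D.isOpen)
    (contDiffOn_field21 hu hα)
    (Sum.elim (fun _ _ => 0) fun _ p => deriv (deriv α) (p (Sum.inr 0))) ?_ ?_
  · have h2 : ContDiffOn ℝ ∞ (deriv (deriv α)) I :=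
      (hα.deriv_of_isOpen D.openI (m := ∞) (by simp)).deriv_of_isOpen D.openI (by simp)
    rintro (a | e)
    · exact continuousOn_const
    · exact h2.continuousOn.comp (by fun_prop : Continuous fun p : Fin 2 ⊕ Fin 1 → ℝ =>
        p (Sum.inr 0)).continuousOn fun p hp => hp.2
  · rintro p hp X (c | e)
    · rw [D.sum_lieConnection_inl hp hu hα, hα' _ hp.2]
      simp only [hD _ hp.1, Fintype.sum_sum_type]
      simp
      ring
    · rw [D.sum_lieConnection_inr hp hu hα, hα' _ hp.2]
      simp only [hT _ hp.1 _ hp.2, Fintype.sum_sum_type]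
      simp [Subsingleton.elim e 0]
      ring

end IsData

end Criterion

section Parallel

open Set Filter Topology Matrix

/-- A function on a connected open set whose derivative is locally bounded by a multiple of the
function vanishes identically if it vanishes at one point. -/
lemma eqOn_zero_of_norm_fderiv_le {E F : Type*} [NormedAddCommGroup E] [NormedSpace ℝ E]
    [NormedAddCommGroup F] [NormedSpace ℝ F] {U : Set E} (hU : IsOpen U) (hUc : IsPreconnected U)
    {f : E → F} (hf : ∀ q ∈ U, DifferentiableAt ℝ f q) {K : E → ℝ} (hK : ContinuousOn K U)
    (hbound : ∀ q ∈ U, ‖fderiv ℝ f q‖ ≤ K q * ‖f q‖) {q₀ : E} (hq₀ : q₀ ∈ U) (h0 : f q₀ = 0) :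
    ∀ q ∈ U, f q = 0 := by
  have hloc : ∀ q ∈ U, f q = 0 → ∀ᶠ q' in 𝓝 q, f q' = 0 := by
    intro q hq hfq
    have h1 : ∀ᶠ q' in 𝓝 q, q' ∈ U ∧ K q' < K q + 1 :=
      Filter.Eventually.and (hU.mem_nhds hq)
        ((hK.continuousAt (hU.mem_nhds hq)).eventually_lt_const (by linarith))
    obtain ⟨r, hr, hball⟩ := Metric.eventually_nhds_iff_ball.1 h1
    filter_upwards [Metric.ball_mem_nhds q hr] with q' hq'
    have hseg : ∀ s ∈ Icc (0 : ℝ) 1, q + s • (q' - q) ∈ Metric.ball q r := fun s hs => by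
      have := (convex_ball q r).add_smul_sub_mem (Metric.mem_ball_self hr) hq' hs
      exact this
    have hline : ∀ s : ℝ, HasDerivAt (fun s : ℝ => q + s • (q' - q)) (q' - q) s := fun s => by
      simpa using ((hasDerivAt_id s).smul_const (q' - q)).const_add q
    have hy : ∀ s ∈ Icc (0 : ℝ) 1, HasDerivAt (fun s : ℝ => f (q + s • (q' - q)))
        (fderiv ℝ f (q + s • (q' - q)) (q' - q)) s := fun s hs =>
      HasFDerivAt.comp_hasDerivAt (l := f) s (hf _ (hball _ (hseg s hs)).1).hasFDerivAt (hline s)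
    have := eq_zero_of_abs_deriv_le_mul_abs_self_of_eq_zero_right
      (f := fun s : ℝ => f (q + s • (q' - q))) (K := (K q + 1) * ‖q' - q‖) (a := 0) (b := 1)
      (fun s hs => (hy s hs).continuousAt.continuousWithinAt)
      (fun s hs => (hy s (Ico_subset_Icc_self hs)).hasDerivWithinAt) (by simpa using hfq)
      (fun s hs => by
        obtain ⟨hsU, hsK⟩ := hball _ (hseg s (Ico_subset_Icc_self hs))
        refine ((fderiv ℝ f _).le_opNorm _).trans ?_
        refine (mul_le_mul_of_nonneg_right (hbound _ hsU) (norm_nonneg _)).trans ?_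
        rw [mul_right_comm]
        gcongr) 1 (by simp)
    simpa using this
  have hsub : U ⊆ {q | ∀ᶠ q' in 𝓝 q, f q' = 0} := by
    refine hUc.subset_of_closure_inter_subset isOpen_setOfPred_eventually_nhds
      ⟨q₀, hq₀, hloc q₀ hq₀ h0⟩ ?_
    rintro q ⟨hqc, hqU⟩
    refine hloc q hqU ?_
    by_contra hne
    obtain ⟨q', h1, h2⟩ := mem_closure_iff_nhds.1 hqc _
      ((hf q hqU).continuousAt.eventually_ne hne)
    have h3 : ∀ᶠ q'' in 𝓝 q', f q'' = 0 := h2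
    exact h1 h3.self_of_nhds
  exact fun q hq => (hsub hq).self_of_nhds

section General

variable {ι : Type} [Fintype ι] [DecidableEq ι] {M : Set (ι → ℝ)} {g : (ι → ℝ) → Matrix ι ι ℝ}

lemma IsMetricOn.christoffel_lower (hg : IsMetricOn M g) {p : ι → ℝ} (hp : p ∈ M)
    (i j k : ι) : ∑ l, christoffel g l i j p * g p l k =
      (1 / 2) * (pd i (fun q => g q j k) p + pd j (fun q => g q i k) p -
        pd k (fun q => g q i j) p) := by
  have hinv : ∀ m, ∑ l, (g p)⁻¹ l m * g p l k = (1 : Matrix ι ι ℝ) m k := fun m => by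
    have h1 : ((g p)⁻¹)ᵀ = (g p)⁻¹ := by
      rw [Matrix.transpose_nonsing_inv, (hg.symm p hp).eq]
    rw [← Matrix.nonsing_inv_mul _ (isUnit_iff_ne_zero.mpr (hg.nondeg p hp)), Matrix.mul_apply]
    refine Finset.sum_congr rfl fun l _ => ?_
    rw [show (g p)⁻¹ l m = (g p)⁻¹ m l by
      conv_lhs => rw [← h1]
      rfl]
  simp only [christoffel, mul_assoc, ← Finset.mul_sum, Finset.sum_mul]
  congr 1
  rw [Finset.sum_comm]
  have h2 : ∀ m, ∑ l, (g p)⁻¹ l m * ((pd i (fun q => g q j m) p + pd j (fun q => g q i m) p -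
      pd m (fun q => g q i j) p) * g p l k) = (pd i (fun q => g q j m) p +
      pd j (fun q => g q i m) p - pd m (fun q => g q i j) p) * (1 : Matrix ι ι ℝ) m k := fun m => by
    rw [← hinv, Finset.mul_sum]
    exact Finset.sum_congr rfl fun l _ => by ring
  rw [Finset.sum_congr rfl fun m _ => h2 m]
  simp [Matrix.one_apply]

/-- The tensor field `T` is parallel for the Levi-Civita connection of `g`. -/
def IsParallelOn (M : Set (ι → ℝ)) (g T : (ι → ℝ) → Matrix ι ι ℝ) : Prop :=
  ∀ p ∈ M, ∀ k i j, pd k (fun q => T q i j) p =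
    ∑ l, (christoffel g l k i p * T p l j + christoffel g l k j p * T p i l)

/-- A metric is parallel for its Levi-Civita connection. -/
lemma IsMetricOn.isParallelOn (hM : IsOpen M) (hg : IsMetricOn M g) : IsParallelOn M g g := by
  intro p hp k i j
  have h1 := hg.christoffel_lower hp k i j
  have h2 := hg.christoffel_lower hp k j i
  have h3 : ∑ l, christoffel g l k j p * g p i l = ∑ l, christoffel g l k j p * g p l i :=
    Finset.sum_congr rfl fun l _ => by rw [(hg.symm p hp).apply]
  rw [Finset.sum_add_distrib, h3, h1, h2, hg.pd_symm hM hp k j i]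
  ring

/-- The lowered tensor `g_{lj} (L_v Γ)^l_{ki}` determines `L_v Γ`. -/
lemma IsMetricOn.lieConnection_eq_zero_of_lower (hg : IsMetricOn M g)
    {v : (ι → ℝ) → ι → ℝ} {p : ι → ℝ} (hp : p ∈ M) {k i : ι}
    (h : ∀ j, ∑ l, g p l j * lieConnection v (christoffel g) l k i p = 0) (l : ι) :
    lieConnection v (christoffel g) l k i p = 0 := by
  have h1 : Matrix.vecMul (fun l => lieConnection v (christoffel g) l k i p) (g p) = 0 := by
    funext j
    rw [Matrix.vecMul, Pi.zero_apply, ← h j, dotProduct]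
    exact Finset.sum_congr rfl fun l _ => mul_comm _ _
  exact congrFun (Matrix.eq_zero_of_vecMul_eq_zero (hg.nondeg p hp) h1) l

end General

variable {U : Set (Fin 2 → ℝ)} {h T : (Fin 2 → ℝ) → Matrix (Fin 2) (Fin 2) ℝ}

/-- The second derivatives of the components of a parallel tensor. -/
lemma IsParallelOn.pd_pd (hU : IsOpen U) (hh : IsMetricOn U h)
    (hT : ∀ i j, ContDiffOn ℝ ∞ (fun q => T q i j) U) (hpar : IsParallelOn U h T)
    {q : Fin 2 → ℝ} (hq : q ∈ U) (m k i j : Fin 2) :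
    pd m (pd k fun q => T q i j) q =
      ∑ l, (pd m (christoffel h l k i) q * T q l j +
        christoffel h l k i q * pd m (fun q => T q l j) q +
        (pd m (christoffel h l k j) q * T q i l +
        christoffel h l k j q * pd m (fun q => T q i l) q)) := by
  have dΓ : ∀ l a b, DifferentiableAt ℝ (christoffel h l a b) q := fun l a b =>
    differentiableAt_of_contDiffOn hU (hh.contDiffOn_christoffel hU l a b) hq
  have dT : ∀ a b, DifferentiableAt ℝ (fun q => T q a b) q := fun a b =>
    differentiableAt_of_contDiffOn hU (hT a b) hq
  rw [pd_congr hU (fun q hq => hpar q hq k i j) hq, pd_sum]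
  · refine Finset.sum_congr rfl fun l _ => ?_
    rw [pd_add ((dΓ l k i).fun_mul (dT l j)) ((dΓ l k j).fun_mul (dT i l)),
      pd_mul (dΓ l k i) (dT l j), pd_mul (dΓ l k j) (dT i l)]
  · exact fun l _ => ((dΓ l k i).fun_mul (dT l j)).fun_add ((dΓ l k j).fun_mul (dT i l))

/-- The curvature annihilates a parallel tensor. -/
lemma IsParallelOn.riemann (hU : IsOpen U) (hh : IsMetricOn U h)
    (hT : ∀ i j, ContDiffOn ℝ ∞ (fun q => T q i j) U) (hpar : IsParallelOn U h T)
    {q : Fin 2 → ℝ} (hq : q ∈ U) (m k i j : Fin 2) :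
    ∑ l, (riemann h l i m k q * T q l j + riemann h l j m k q * T q i l) = 0 := by
  have h1 := hpar.pd_pd hU hh hT hq m k i j
  have h2 := hpar.pd_pd hU hh hT hq k m i j
  have h3 := pd_comm hU (hT i j) hq m k
  simp only [hpar q hq, Fin.sum_univ_two] at h1 h2
  simp only [LeviCivita21.riemann, Fin.sum_univ_two]
  linear_combination h3 - h1 + h2

lemma contDiffOn_lieMetric (hU : IsOpen U) (hh : IsMetricOn U h) {u : (Fin 2 → ℝ) → Fin 2 → ℝ}
    (hu : ContDiffOn ℝ ∞ u U) (i j : Fin 2) :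
    ContDiffOn ℝ ∞ (fun q => lieMetric u h q i j) U := by
  have hu' := contDiffOn_pi.1 hu
  simp only [lieMetric, Matrix.of_apply]
  exact ContDiffOn.sum fun k _ => (((hu' k).mul (contDiffOn_pd hU (hh.smooth i j) k)).add
    ((contDiffOn_pd hU (hu' k) i).mul (hh.smooth k j))).add
      ((contDiffOn_pd hU (hu' k) j).mul (hh.smooth i k))

/-- The covariant derivative of `L_u h` in terms of `L_u Γ`. -/
lemma pd_lieMetric (hU : IsOpen U) (hh : IsMetricOn U h) {u : (Fin 2 → ℝ) → Fin 2 → ℝ}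
    (hu : ContDiffOn ℝ ∞ u U) {q : Fin 2 → ℝ} (hq : q ∈ U) (k i j : Fin 2) :
    pd k (fun q => lieMetric u h q i j) q =
      ∑ l, (christoffel h l k i q * lieMetric u h q l j +
        christoffel h l k j q * lieMetric u h q i l) +
      (∑ l, h q l j * lieConnection u (christoffel h) l k i q +
        ∑ l, h q i l * lieConnection u (christoffel h) l k j q) := by
  have hu' := contDiffOn_pi.1 hu
  have du : ∀ m, DifferentiableAt ℝ (fun q => u q m) q := fun m =>
    differentiableAt_of_contDiffOn hU (hu' m) hq
  have ddu : ∀ m i, DifferentiableAt ℝ (pd i fun q => u q m) q := fun m i =>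
    differentiableAt_of_contDiffOn hU (contDiffOn_pd hU (hu' m) i) hq
  have dh : ∀ a b, DifferentiableAt ℝ (fun q => h q a b) q := fun a b =>
    differentiableAt_of_contDiffOn hU (hh.smooth a b) hq
  have ddh : ∀ a b m, DifferentiableAt ℝ (pd m fun q => h q a b) q := fun a b m =>
    differentiableAt_of_contDiffOn hU (contDiffOn_pd hU (hh.smooth a b) m) hq
  have h1 : pd k (fun q => lieMetric u h q i j) q = ∑ m,
      (pd k (fun q => u q m) q * pd m (fun q => h q i j) q +
        u q m * pd m (pd k fun q => h q i j) q +
        (pd k (pd i fun q => u q m) q * h q m j +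
          pd i (fun q => u q m) q * pd k (fun q => h q m j) q) +
        (pd k (pd j fun q => u q m) q * h q i m +
          pd j (fun q => u q m) q * pd k (fun q => h q i m) q)) := by
    simp only [lieMetric, Matrix.of_apply]
    rw [pd_sum _ fun m _ => (((du m).fun_mul (ddh i j m)).fun_add
      ((ddu m i).fun_mul (dh m j))).fun_add ((ddu m j).fun_mul (dh i m))]
    refine Finset.sum_congr rfl fun m _ => ?_
    rw [pd_add (((du m).fun_mul (ddh i j m)).fun_add ((ddu m i).fun_mul (dh m j)))
      ((ddu m j).fun_mul (dh i m)), pd_add ((du m).fun_mul (ddh i j m))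
      ((ddu m i).fun_mul (dh m j)), pd_mul (du m) (ddh i j m), pd_mul (ddu m i) (dh m j),
      pd_mul (ddu m j) (dh i m), pd_comm hU (hh.smooth i j) hq k m]
  have hpar := hh.isParallelOn hU
  rw [h1]
  simp only [hpar.pd_pd hU hh hh.smooth hq, hpar q hq, lieMetric, Matrix.of_apply, lieConnection,
    Fin.sum_univ_two]
  ring

/-- A homothetic field is affine. -/
lemma lieConnection_eq_zero_of_homothetic (hU : IsOpen U) (hh : IsMetricOn U h)
    {u : (Fin 2 → ℝ) → Fin 2 → ℝ} (hu : ContDiffOn ℝ ∞ u U) {C : ℝ}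
    (hC : ∀ q ∈ U, lieMetric u h q = -C • h q) {q : Fin 2 → ℝ} (hq : q ∈ U) (c a b : Fin 2) :
    lieConnection u (christoffel h) c a b q = 0 := by
  have hpar := hh.isParallelOn hU
  have key : ∀ k i j, ∑ l, h q l j * lieConnection u (christoffel h) l k i q +
      ∑ l, h q l i * lieConnection u (christoffel h) l k j q = 0 := fun k i j => by
    have h1 := pd_lieMetric hU hh hu hq k i j
    have h2 : pd k (fun q => lieMetric u h q i j) q = -C * pd k (fun q => h q i j) q := by
      rw [pd_congr hU (f' := fun q => -C * h q i j) (fun q hq => by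
          simp only [hC q hq, Matrix.smul_apply, smul_eq_mul]) hq,
        pd_const_mul (differentiableAt_of_contDiffOn hU (hh.smooth i j) hq)]
    rw [h2, hpar q hq k i j] at h1
    have h3 : ∑ l, h q i l * lieConnection u (christoffel h) l k j q =
        ∑ l, h q l i * lieConnection u (christoffel h) l k j q :=
      Finset.sum_congr rfl fun l _ => by rw [(hh.symm q hq).apply]
    simp only [hC q hq, Matrix.smul_apply, smul_eq_mul] at h1
    rw [h3, Finset.mul_sum] at h1
    have h4 : ∑ l, (christoffel h l k i q * (-C * h q l j) +
        christoffel h l k j q * (-C * h q i l)) = ∑ l, -C * (christoffel h l k i q * h q l j +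
        christoffel h l k j q * h q i l) := Finset.sum_congr rfl fun l _ => by ring
    rw [h4] at h1
    linarith
  refine hh.lieConnection_eq_zero_of_lower hq (fun j => ?_) c
  have hs := hh.lieConnection_symm hU hu hq
  have k1 := key a b j
  have k2 := key b j a
  have k3 := key j a b
  simp only [hs _ j a, hs _ b a, hs _ b j] at k1 k2 k3
  linarith

/-- The Lie derivative of `h` along an affine field is parallel. -/
lemma isParallelOn_lieMetric (hU : IsOpen U) (hh : IsMetricOn U h)
    {u : (Fin 2 → ℝ) → Fin 2 → ℝ} (hu : ContDiffOn ℝ ∞ u U)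
    (hD : ∀ q ∈ U, ∀ c a b, lieConnection u (christoffel h) c a b q = 0) :
    IsParallelOn U h (lieMetric u h) := by
  intro q hq k i j
  rw [pd_lieMetric hU hh hu hq]
  simp [hD q hq]

/-- A parallel tensor on a connected surface that vanishes at a point vanishes. -/
lemma IsParallelOn.eq_zero (hU : IsOpen U) (hUc : IsPreconnected U) (hh : IsMetricOn U h)
    (hT : ∀ i j, ContDiffOn ℝ ∞ (fun q => T q i j) U) (hpar : IsParallelOn U h T)
    {q₀ : Fin 2 → ℝ} (hq₀ : q₀ ∈ U) (h0 : T q₀ = 0) : ∀ q ∈ U, T q = 0 := by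
  have hdT : ∀ q ∈ U, ∀ i j, DifferentiableAt ℝ (fun q => T q i j) q := fun q hq i j =>
    differentiableAt_of_contDiffOn hU (hT i j) hq
  set f : (Fin 2 → ℝ) → Fin 2 → Fin 2 → ℝ := fun q i j => T q i j with hf
  have hdf : ∀ q ∈ U, DifferentiableAt ℝ f q := fun q hq =>
    differentiableAt_pi.2 fun i => differentiableAt_pi.2 fun j => hdT q hq i j
  have hΓc : ∀ l k i, ContinuousOn (fun q => |christoffel h l k i q|) U := fun l k i =>
    (hh.contDiffOn_christoffel hU l k i).continuousOn.abs
  set G : (Fin 2 → ℝ) → ℝ := fun q => ∑ l, ∑ k, ∑ i, |christoffel h l k i q| with hG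
  have hGc : ContinuousOn G U := continuousOn_finsetSum _ fun l _ =>
    continuousOn_finsetSum _ fun k _ => continuousOn_finsetSum _ fun i _ => hΓc l k i
  have hΓG : ∀ q l k i, |christoffel h l k i q| ≤ G q := fun q l k i => by
    have e3 : ∀ l k, |christoffel h l k i q| ≤ ∑ i, |christoffel h l k i q| := fun l k =>
      Finset.single_le_sum (f := fun i => |christoffel h l k i q|)
        (fun _ _ => abs_nonneg _) (Finset.mem_univ i)
    have e2 : ∑ i, |christoffel h l k i q| ≤ ∑ k, ∑ i, |christoffel h l k i q| :=
      Finset.single_le_sum (f := fun k => ∑ i, |christoffel h l k i q|)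
        (fun _ _ => Finset.sum_nonneg fun _ _ => abs_nonneg _) (Finset.mem_univ k)
    have e1 : ∑ k, ∑ i, |christoffel h l k i q| ≤ G q :=
      Finset.single_le_sum (f := fun l => ∑ k, ∑ i, |christoffel h l k i q|)
        (fun _ _ => Finset.sum_nonneg fun _ _ => Finset.sum_nonneg fun _ _ => abs_nonneg _)
        (Finset.mem_univ l)
    exact (e3 l k).trans (e2.trans e1)
  have hzero := eqOn_zero_of_norm_fderiv_le hU hUc hdf (K := fun q => 8 * G q)
    (continuousOn_const.mul hGc) (fun q hq => ?_) hq₀ (by funext i j; simp [hf, h0])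
  · intro q hq
    ext i j
    exact congrFun (congrFun (hzero q hq) i) j
  have hG0 : 0 ≤ G q := (abs_nonneg _).trans (hΓG q 0 0 0)
  refine ContinuousLinearMap.opNorm_le_bound _ (by positivity) fun w => ?_
  rw [pi_norm_le_iff_of_nonneg (by positivity)]
  intro i
  rw [pi_norm_le_iff_of_nonneg (by positivity)]
  intro j
  have h1 : fderiv ℝ f q w i j = ∑ k, w k * pd k (fun q => T q i j) q := by
    rw [← fderiv_apply_eq_sum_pd]
    have h2 := hasFDerivAt_pi'.1 (hasFDerivAt_pi'.1 (hdf q hq).hasFDerivAt i) j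
    rw [show fderiv ℝ (fun q => T q i j) q = _ from h2.fderiv]
    rfl
  have hTf : ∀ a b, |T q a b| ≤ ‖f q‖ := fun a b =>
    (norm_le_pi_norm (f q a) b).trans (norm_le_pi_norm (f q) a)
  have hw : ∀ k, |w k| ≤ ‖w‖ := fun k => norm_le_pi_norm w k
  have hterm : ∀ l k a b c, |christoffel h l k a q * T q b c| ≤ G q * ‖f q‖ :=
    fun l k a b c => by
      rw [abs_mul]
      exact mul_le_mul (hΓG q l k a) (hTf b c) (abs_nonneg _) hG0
  have hk : ∀ k, |w k * pd k (fun q => T q i j) q| ≤ ‖w‖ * (4 * (G q * ‖f q‖)) := fun k => by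
    rw [abs_mul, hpar q hq, Fin.sum_univ_two]
    refine mul_le_mul (hw k) ?_ (abs_nonneg _) (norm_nonneg _)
    have s1 := abs_le.1 (hterm 0 k i 0 j)
    have s2 := abs_le.1 (hterm 0 k j i 0)
    have s3 := abs_le.1 (hterm 1 k i 1 j)
    have s4 := abs_le.1 (hterm 1 k j i 1)
    exact abs_le.2 ⟨by linarith, by linarith⟩
  rw [h1, Real.norm_eq_abs]
  refine (Finset.abs_sum_le_sum_abs _ _).trans ((Finset.sum_le_sum fun k _ => hk k).trans ?_)
  rw [Fin.sum_univ_two]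
  linarith

end Parallel

section Flat

open Set Filter Topology

/-- A skew endomorphism of a plane that is also skew for a second symmetric form vanishes, unless
the second form is a multiple of the first. -/
lemma eq_zero_or_proportional {H S r : Matrix (Fin 2) (Fin 2) ℝ} (hH : H.IsSymm)
    (hdet : H.det ≠ 0) (hS : S.IsSymm)
    (h1 : ∀ i j, ∑ l, (r l i * H l j + r l j * H i l) = 0)
    (h2 : ∀ i j, ∑ l, (r l i * S l j + r l j * S i l) = 0) :
    r = 0 ∨ ∃ c : ℝ, S = c • H := by
  have hH01 := hH.apply 0 1
  have hS01 := hS.apply 0 1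
  rw [Matrix.det_fin_two] at hdet
  simp only [Fin.sum_univ_two, Fin.forall_fin_two, hH01, hS01] at h1 h2
  rw [hH01] at hdet
  obtain ⟨⟨e1, e2⟩, e3, e4⟩ := h1
  obtain ⟨⟨f1, f2⟩, f3, f4⟩ := h2
  set d := H 0 0 * H 1 1 - H 0 1 * H 0 1 with hd
  set θ := r 0 0 * H 0 1 + r 1 0 * H 1 1 with hθ
  have r00 : d * r 0 0 = -H 0 1 * θ := by rw [hd, hθ]; linear_combination (H 1 1 / 2) * e1
  have r10 : d * r 1 0 = H 0 0 * θ := by rw [hd, hθ]; linear_combination (-H 0 1 / 2) * e1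
  have r01 : d * r 0 1 = -H 1 1 * θ := by
    rw [hd, hθ]; linear_combination H 1 1 * e2 - (H 0 1 / 2) * e4
  have r11 : d * r 1 1 = H 0 1 * θ := by
    rw [hd, hθ]; linear_combination -H 0 1 * e2 + (H 0 0 / 2) * e4
  by_cases h0 : θ = 0
  · left
    rw [h0, mul_zero] at r00 r10 r01 r11
    ext i j
    obtain rfl | rfl : i = 0 ∨ i = 1 := by omega
    all_goals obtain rfl | rfl : j = 0 ∨ j = 1 := by omega
    exacts [(mul_eq_zero.1 r00).resolve_left hdet, (mul_eq_zero.1 r01).resolve_left hdet,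
      (mul_eq_zero.1 r10).resolve_left hdet, (mul_eq_zero.1 r11).resolve_left hdet]
  · right
    have g1 : H 0 0 * S 0 1 = H 0 1 * S 0 0 := by
      refine mul_left_cancel₀ h0 ?_
      linear_combination (d / 2) * f1 - S 0 0 * r00 - S 0 1 * r10
    have g2 : H 0 1 * S 1 1 = H 1 1 * S 0 1 := by
      refine mul_left_cancel₀ h0 ?_
      linear_combination (d / 2) * f4 - S 0 1 * r01 - S 1 1 * r11
    have g3 : H 0 0 * S 1 1 = H 1 1 * S 0 0 := by
      refine mul_left_cancel₀ h0 ?_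
      linear_combination d * f2 - S 0 1 * r00 - S 1 1 * r10 - S 0 0 * r01 - S 0 1 * r11
    have hc : ∀ i j, S i j = (H 0 0 * S 1 1 + H 1 1 * S 0 0 - 2 * H 0 1 * S 0 1) / (2 * d) *
        H i j := by
      simp only [Fin.forall_fin_two, hH01, hS01, div_mul_eq_mul_div,
        eq_div_iff (mul_ne_zero two_ne_zero hdet)]
      refine ⟨⟨?_, ?_⟩, ?_, ?_⟩
      · rw [hd]; linear_combination -H 0 0 * g3 + 2 * H 0 1 * g1
      · rw [hd]; linear_combination H 1 1 * g1 - H 0 0 * g2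
      · rw [hd]; linear_combination H 1 1 * g1 - H 0 0 * g2
      · rw [hd]; linear_combination H 1 1 * g3 - 2 * H 0 1 * g2
    exact ⟨_, by ext i j; exact hc i j⟩

lemma riemann_antisymm {ι : Type} [Fintype ι] [DecidableEq ι] (g : (ι → ℝ) → Matrix ι ι ℝ)
    (l k i j : ι) (p : ι → ℝ) : riemann g l k i j p = -riemann g l k j i p := by
  simp only [riemann, Finset.sum_sub_distrib]
  ring

variable {U : Set (Fin 2 → ℝ)} {h : (Fin 2 → ℝ) → Matrix (Fin 2) (Fin 2) ℝ}

/-- An affine field on a connected surface that is not flat is homothetic. -/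
lemma flat_or_homothetic_of_affine (hU : IsOpen U) (hUc : IsPreconnected U) (hh : IsMetricOn U h)
    {u : (Fin 2 → ℝ) → Fin 2 → ℝ} (hu : ContDiffOn ℝ ∞ u U)
    (hD : ∀ q ∈ U, ∀ c a b, lieConnection u (christoffel h) c a b q = 0) :
    (∀ q ∈ U, ∀ l k i j, riemann h l k i j q = 0) ∨
      ∃ C : ℝ, ∀ q ∈ U, lieMetric u h q = -C • h q := by
  have hS := isParallelOn_lieMetric hU hh hu hD
  have hSs := contDiffOn_lieMetric hU hh hu
  have hpar := hh.isParallelOn hU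
  by_cases hR : ∀ q ∈ U, ∀ l k, riemann h l k 0 1 q = 0
  · left
    intro q hq l k i j
    obtain rfl | rfl : i = 0 ∨ i = 1 := by omega
    all_goals obtain rfl | rfl : j = 0 ∨ j = 1 := by omega
    · linarith [riemann_antisymm h l k 0 0 q]
    · exact hR q hq l k
    · rw [riemann_antisymm, hR q hq l k, neg_zero]
    · linarith [riemann_antisymm h l k 1 1 q]
  · right
    push Not at hR
    obtain ⟨q₀, hq₀, l, k, hne⟩ := hR
    obtain hr | ⟨c, hc⟩ := eq_zero_or_proportional
      (r := Matrix.of fun l k => riemann h l k 0 1 q₀) (hh.symm q₀ hq₀) (hh.nondeg q₀ hq₀)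
      (S := lieMetric u h q₀)
      (Matrix.IsSymm.ext fun i j => hh.lieMetric_symm hU u hq₀ j i)
      (fun i j => hpar.riemann hU hh hh.smooth hq₀ 0 1 i j)
      (fun i j => hS.riemann hU hh hSs hq₀ 0 1 i j)
    · exact absurd (congrFun (congrFun hr l) k) hne
    · refine ⟨-c, ?_⟩
      have hT : IsParallelOn U h fun q => Matrix.of fun i j =>
          lieMetric u h q i j + (-c) * h q i j := by
        intro q hq k i j
        have d1 := differentiableAt_of_contDiffOn hU (hSs i j) hq
        have d2 := differentiableAt_of_contDiffOn hU (hh.smooth i j) hq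
        simp only [Matrix.of_apply]
        rw [pd_add d1 (d2.const_mul (-c)), pd_const_mul d2, hS q hq, hpar q hq]
        simp only [Fin.sum_univ_two]
        ring
      have h0 := hT.eq_zero hU hUc hh
        (fun i j => (hSs i j).add (contDiffOn_const.mul (hh.smooth i j))) hq₀
        (by ext i j; simp [hc])
      intro q hq
      ext i j
      have h1 := congrFun (congrFun (h0 q hq) i) j
      simp only [Matrix.zero_apply] at h1
      simp only [neg_neg, Matrix.smul_apply, smul_eq_mul]
      linarith

namespace IsData

variable {I : Set ℝ} {ζ : ℝ → ℝ} (D : IsData U I h ζ)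

include D

/-- The product of a flat surface and an interval is of constant curvature. -/
lemma hasConstantCurvature_of_flat (hζ' : ∀ z ∈ I, deriv ζ z = 0)
    (hR : ∀ q ∈ U, ∀ l k i j, riemann h l k i j q = 0) :
    HasConstantCurvature (prodDomain U I) (metric21 h ζ) := by
  have hκ : ∀ z ∈ I, halfLogDeriv ζ z = 0 := fun z hz => by simp [halfLogDeriv, hζ' z hz]
  have hΓ1 : ∀ e i j, EqOn (christoffel (metric21 h ζ) (Sum.inr e) i j) (fun _ => 0)
      (prodDomain U I) := by
    rintro e (a | c) (b | d) p hp
    · simp [D.christoffel_inr_inl_inl e a b hp, hκ _ hp.2]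
    · rw [D.christoffel_inr_inl_inr _ _ _ hp]
    · rw [D.christoffel_inr_inr_inl _ _ _ hp]
    · simp [D.christoffel_inr_inr_inr _ _ _ hp, hκ _ hp.2]
  have hΓ2 : ∀ e k j, EqOn (christoffel (metric21 h ζ) k (Sum.inr e) j) (fun _ => 0)
      (prodDomain U I) := by
    rintro e (a | c) (b | d) p hp
    · simp [D.christoffel_inl_inr_inl _ _ _ hp, hκ _ hp.2]
    · rw [D.christoffel_inl_inr_inr _ _ _ hp]
    · exact hΓ1 _ _ _ hp
    · exact hΓ1 _ _ _ hp
  have hΓ3 : ∀ e k i, EqOn (christoffel (metric21 h ζ) k i (Sum.inr e)) (fun _ => 0)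
      (prodDomain U I) := fun e k i =>
    (D.isMetricOn.christoffel_symm D.isOpen _ _ _).trans (hΓ2 e k i)
  have d1 : ∀ m e i j, ∀ p ∈ prodDomain U I,
      pd m (christoffel (metric21 h ζ) (Sum.inr e) i j) p = 0 := fun m e i j p hp => by
    rw [pd_congr D.isOpen (hΓ1 e i j) hp, pd_const]
  have d2 : ∀ m e i j, ∀ p ∈ prodDomain U I,
      pd m (christoffel (metric21 h ζ) i (Sum.inr e) j) p = 0 := fun m e i j p hp => by
    rw [pd_congr D.isOpen (hΓ2 e i j) hp, pd_const]
  have d3 : ∀ m e i j, ∀ p ∈ prodDomain U I,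
      pd m (christoffel (metric21 h ζ) i j (Sum.inr e)) p = 0 := fun m e i j p hp => by
    rw [pd_congr D.isOpen (hΓ3 e i j) hp, pd_const]
  have hflat : ∀ p ∈ prodDomain U I, ∀ l k i j, riemann (metric21 h ζ) l k i j p = 0 := by
    rintro p hp (l | l) (k | k) (i | i) (j | j)
    · rw [← hR _ hp.1 l k i j]
      simp only [riemann, Fintype.sum_sum_type, hΓ1 _ _ _ hp, hΓ3 _ _ _ hp,
        D.pd_inl_christoffel_inl_inl_inl hp, D.christoffel_inl_inl_inl _ _ _ hp]
      simp
    all_goals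
      simp only [riemann, hΓ1 _ _ _ hp, hΓ2 _ _ _ hp, hΓ3 _ _ _ hp, d1 _ _ _ _ _ hp,
        d2 _ _ _ _ _ hp, d3 _ _ _ _ _ hp, D.pd_inr_christoffel_inl_inl_inl hp,
        Fintype.sum_sum_type]
      simp
  refine ⟨0, fun p hp X Y _ => ?_⟩
  have h0 : curvature (metric21 h ζ) p X Y Y = 0 := by
    funext l
    simp [curvature, hflat p hp]
  simp [sectional, h0, metricInner]

variable {u : (Fin 2 → ℝ) → Fin 2 → ℝ} {α : ℝ → ℝ}
  (hu : ContDiffOn ℝ ∞ u U) (hα : ContDiffOn ℝ ∞ α I)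

include hu hα

/-- If the curvature of `ζ (h + dz²)` is not constant, then the horizontal part of a projective
field is homothetic for `h`. -/
theorem exists_homothetic_of_isProjective (hUc : IsConnected U) (hIn : I.Nonempty)
    (hcurv : ¬ HasConstantCurvature (prodDomain U I) (metric21 h ζ))
    (hproj : IsProjective (prodDomain U I) (metric21 h ζ) (field21 u α)) :
    ∃ C : ℝ, ∀ q ∈ U, lieMetric u h q = -C • h q := by
  obtain ⟨hD, -, hT⟩ := D.equations_of_isProjective hu hα hUc.nonempty hIn hproj
  by_cases hζ' : ∀ z ∈ I, deriv ζ z = 0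
  · refine (flat_or_homothetic_of_affine D.openU hUc.isPreconnected D.metric hu hD).resolve_left
      fun hR => hcurv (D.hasConstantCurvature_of_flat hζ' hR)
  · push Not at hζ'
    obtain ⟨z, hz, hne⟩ := hζ'
    have hκ : halfLogDeriv ζ z ≠ 0 :=
      div_ne_zero hne (mul_ne_zero two_ne_zero (D.ne_zero z hz))
    refine ⟨(α z * deriv (halfLogDeriv ζ) z - deriv α z * halfLogDeriv ζ z) / halfLogDeriv ζ z,
      fun q hq => ?_⟩
    ext a b
    have h1 := hT q hq z hz a b
    rw [Matrix.smul_apply, smul_eq_mul, ← mul_right_inj' hκ]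
    field_simp
    linarith

omit hu

/-- The ordinary differential equations for a projective extension of a homothetic field. -/
theorem exists_ode_of_isProjective (hUn : U.Nonempty) (hIc : IsConnected I)
    (hu : ContDiffOn ℝ ∞ u U)
    (hproj : IsProjective (prodDomain U I) (metric21 h ζ) (field21 u α)) {C : ℝ}
    (hC : ∀ q ∈ U, lieMetric u h q = -C • h q) :
    ∃ b B : ℝ, ∀ z ∈ I, -2 * deriv α z = C + b * ζ z ∧
      α z * deriv ζ z = -b * ζ z ^ 2 + (2 * B - C) * ζ z := by
  obtain ⟨-, hα', hT⟩ := D.equations_of_isProjective hu hα hUn hIc.nonempty hproj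
  have hκC : ∀ z ∈ I, α z * deriv (halfLogDeriv ζ) z - deriv α z * halfLogDeriv ζ z =
      C * halfLogDeriv ζ z := by
    intro z hz
    obtain ⟨q, hq⟩ := hUn
    have hne : h q ≠ 0 := fun h0 => D.metric.nondeg q hq (by rw [h0]; simp)
    obtain ⟨a, ha⟩ := Function.ne_iff.1 hne
    obtain ⟨b, hb⟩ := Function.ne_iff.1 ha
    have h1 := hT q hq z hz a b
    rw [hC q hq, Matrix.smul_apply, smul_eq_mul] at h1
    refine mul_right_cancel₀ (hb : h q a b ≠ 0) ?_
    linarith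
  have hdα : ∀ z ∈ I, HasDerivAt α (deriv α z) z := fun z hz =>
    (differentiableAt_of_contDiffOn D.openI hα hz).hasDerivAt
  have hdα' : ∀ z ∈ I, HasDerivAt (deriv α) (deriv (deriv α) z) z := fun z hz =>
    (differentiableAt_of_contDiffOn D.openI
      (hα.deriv_of_isOpen D.openI (m := ∞) (by simp)) hz).hasDerivAt
  have hdζ : ∀ z ∈ I, HasDerivAt ζ (deriv ζ z) z := fun z hz => (D.diff_ζ hz).hasDerivAt
  have hdκ : ∀ z ∈ I, HasDerivAt (halfLogDeriv ζ) (deriv (halfLogDeriv ζ) z) z := fun z hz =>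
    (D.diff_halfLogDeriv hz).hasDerivAt
  have hκ : ∀ z ∈ I, 2 * ζ z * halfLogDeriv ζ z = deriv ζ z := fun z hz => by
    have := D.ne_zero z hz
    rw [halfLogDeriv]
    field_simp
  have hconst : ∀ {f : ℝ → ℝ}, (∀ z ∈ I, HasDerivAt f 0 z) → ∃ k, ∀ z ∈ I, f z = k := by
    intro f hf
    obtain ⟨z₀, hz₀⟩ := hIc.nonempty
    exact ⟨f z₀, fun z hz => D.openI.is_const_of_deriv_eq_zero hIc.isPreconnected
      (fun z hz => (hf z hz).differentiableAt.differentiableWithinAt)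
      (fun z hz => (hf z hz).deriv) hz hz₀⟩
  obtain ⟨b, hb⟩ := hconst (f := fun z => (2 * deriv α z + C) / ζ z) fun z hz => by
    refine ((((hdα' z hz).const_mul 2).add_const C).div (hdζ z hz) (D.ne_zero z hz)).congr_deriv ?_
    rw [div_eq_zero_iff]
    left
    rw [← hα' z hz, ← hκ z hz]
    linear_combination 2 * ζ z * hκC z hz
  obtain ⟨k, hk⟩ := hconst (f := fun z => deriv α z - α z * halfLogDeriv ζ z) fun z hz => by
    refine ((hdα' z hz).sub ((hdα z hz).mul (hdκ z hz))).congr_deriv ?_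
    rw [← hα' z hz]
    ring
  refine ⟨-b, -k, fun z hz => ?_⟩
  have h1 := hb z hz
  have h2 := hk z hz
  rw [div_eq_iff (D.ne_zero z hz)] at h1
  refine ⟨by linarith, ?_⟩
  rw [← hκ z hz]
  linear_combination -2 * ζ z * h2 + ζ z * h1

/-- The ordinary differential equations are sufficient for an extension of a homothetic field to be
projective. -/
theorem isProjective_of_ode (hu : ContDiffOn ℝ ∞ u U) {C : ℝ}
    (hC : ∀ q ∈ U, lieMetric u h q = -C • h q) {b B : ℝ}
    (hode : ∀ z ∈ I, -2 * deriv α z = C + b * ζ z ∧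
      α z * deriv ζ z = -b * ζ z ^ 2 + (2 * B - C) * ζ z) :
    IsProjective (prodDomain U I) (metric21 h ζ) (field21 u α) := by
  have hdα : ∀ z ∈ I, HasDerivAt α (deriv α z) z := fun z hz =>
    (differentiableAt_of_contDiffOn D.openI hα hz).hasDerivAt
  have hdζ : ∀ z ∈ I, HasDerivAt ζ (deriv ζ z) z := fun z hz => (D.diff_ζ hz).hasDerivAt
  have hdκ : ∀ z ∈ I, HasDerivAt (halfLogDeriv ζ) (deriv (halfLogDeriv ζ) z) z := fun z hz =>
    (D.diff_halfLogDeriv hz).hasDerivAt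
  have hκ : ∀ z ∈ I, 2 * ζ z * halfLogDeriv ζ z = deriv ζ z := fun z hz => by
    have := D.ne_zero z hz
    rw [halfLogDeriv]
    field_simp
  have h1 : ∀ z ∈ I, deriv (deriv α) z = -b / 2 * deriv ζ z := fun z hz => by
    have e : deriv α =ᶠ[𝓝 z] fun z => -C / 2 + -b / 2 * ζ z := by
      filter_upwards [D.openI.mem_nhds hz] with z' hz'
      linarith [(hode z' hz').1]
    rw [e.deriv_eq, (((hdζ z hz).const_mul (-b / 2)).const_add (-C / 2)).deriv]
  have h2 : ∀ z ∈ I, α z * deriv (halfLogDeriv ζ) z + deriv α z * halfLogDeriv ζ z =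
      -b / 2 * deriv ζ z := fun z hz => by
    have e : (fun z => α z * halfLogDeriv ζ z) =ᶠ[𝓝 z]
        fun z => (2 * B - C) / 2 + -b / 2 * ζ z := by
      filter_upwards [D.openI.mem_nhds hz] with z' hz'
      have := (hode z' hz').2
      refine mul_left_cancel₀ (mul_ne_zero two_ne_zero (D.ne_zero z' hz')) ?_
      rw [← hκ z' hz'] at this
      linear_combination this
    have h3 := ((((hdζ z hz).const_mul (-b / 2)).const_add ((2 * B - C) / 2)).congr_of_eventuallyEq
      e).unique ((hdα z hz).mul (hdκ z hz))
    linarith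
  refine D.isProjective_of_equations hu hα
    (fun q hq => lieConnection_eq_zero_of_homothetic D.openU D.metric hu hC hq)
    (fun z hz => (h2 z hz).trans (h1 z hz).symm) fun q hq z hz a c => ?_
  rw [hC q hq, Matrix.smul_apply, smul_eq_mul]
  linear_combination h q a c * (h2 z hz + halfLogDeriv ζ z * (hode z hz).1 +
    b / 2 * hκ z hz)

end IsData

end Flat

section Weighted

open Set Filter Topology

/-- The derivative of `|f|^r` where `f` does not vanish. -/
lemma hasFDerivAt_abs_rpow {E : Type*} [NormedAddCommGroup E] [NormedSpace ℝ E] {f : E → ℝ}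
    {f' : E →L[ℝ] ℝ} {p : E} (hf : HasFDerivAt f f' p) (h0 : f p ≠ 0) (r : ℝ) :
    HasFDerivAt (fun q => |f q| ^ r) ((r * |f p| ^ r / f p) • f') p := by
  have hev : (fun q => |f q| ^ r) =ᶠ[𝓝 p] fun q => Real.exp (Real.log (f q) * r) := by
    filter_upwards [hf.continuousAt.eventually_ne h0] with q hq
    rw [Real.rpow_def_of_pos (abs_pos.2 hq), Real.log_abs]
  have h1 := ((hf.log h0).mul_const r).exp
  refine (h1.congr_of_eventuallyEq hev).congr_fderiv ?_
  rw [hev.eq_of_nhds, smul_smul, smul_smul]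
  congr 1
  field_simp

variable {U : Set (Fin 2 → ℝ)} {I : Set ℝ} {h : (Fin 2 → ℝ) → Matrix (Fin 2) (Fin 2) ℝ}

/-- The density `|det h|^{1/4}` on the surface. -/
noncomputable def surfaceDensity (h : (Fin 2 → ℝ) → Matrix (Fin 2) (Fin 2) ℝ)
    (q : Fin 2 → ℝ) : ℝ :=
  |(h q).det| ^ (1 / 4 : ℝ)

/-- The weighted inverse `|det h|^{1/4} h⁻¹` on the surface. -/
noncomputable def surfaceWeighted (h : (Fin 2 → ℝ) → Matrix (Fin 2) (Fin 2) ℝ)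
    (q : Fin 2 → ℝ) : Matrix (Fin 2) (Fin 2) ℝ :=
  surfaceDensity h q • (h q)⁻¹

section Surface

variable {u : (Fin 2 → ℝ) → Fin 2 → ℝ} {C : ℝ} {q : Fin 2 → ℝ}

lemma pd_det (hU : IsOpen U) (hh : IsMetricOn U h) (hq : q ∈ U) (k : Fin 2) :
    pd k (fun q => (h q).det) q =
      pd k (fun q => h q 0 0) q * h q 1 1 + h q 0 0 * pd k (fun q => h q 1 1) q -
        2 * h q 0 1 * pd k (fun q => h q 0 1) q := by
  have dh : ∀ a b, DifferentiableAt ℝ (fun q => h q a b) q := fun a b =>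
    differentiableAt_of_contDiffOn hU (hh.smooth a b) hq
  have e : EqOn (fun q => (h q).det) (fun q => h q 0 0 * h q 1 1 + -1 * (h q 0 1 * h q 0 1)) U :=
    fun q hq => by
      simp only [Matrix.det_fin_two, (hh.symm q hq).apply 0 1]
      ring
  rw [pd_congr hU e hq, pd_add ((dh 0 0).fun_mul (dh 1 1))
    (((dh 0 1).fun_mul (dh 0 1)).const_mul _), pd_mul (dh 0 0) (dh 1 1),
    pd_const_mul ((dh 0 1).fun_mul (dh 0 1)), pd_mul (dh 0 1) (dh 0 1)]
  ring

lemma differentiableAt_det (hU : IsOpen U) (hh : IsMetricOn U h) (hq : q ∈ U) :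
    DifferentiableAt ℝ (fun q => (h q).det) q :=
  differentiableAt_of_contDiffOn hU (contDiffOn_det hh.smooth) hq

lemma differentiableAt_surfaceDensity (hU : IsOpen U) (hh : IsMetricOn U h) (hq : q ∈ U) :
    DifferentiableAt ℝ (surfaceDensity h) q :=
  (hasFDerivAt_abs_rpow (differentiableAt_det hU hh hq).hasFDerivAt
    (hh.nondeg q hq) _).differentiableAt

lemma pd_surfaceDensity (hU : IsOpen U) (hh : IsMetricOn U h) (hq : q ∈ U) (k : Fin 2) :
    pd k (surfaceDensity h) q =
      1 / 4 * surfaceDensity h q / (h q).det * pd k (fun q => (h q).det) q := by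
  have h1 := hasFDerivAt_abs_rpow (differentiableAt_det hU hh hq).hasFDerivAt
    (hh.nondeg q hq) (1 / 4 : ℝ)
  rw [pd, show fderiv ℝ (surfaceDensity h) q = _ from h1.fderiv]
  rfl

lemma differentiableAt_surfaceWeighted (hU : IsOpen U) (hh : IsMetricOn U h) (hq : q ∈ U)
    (a b : Fin 2) : DifferentiableAt ℝ (fun q => surfaceWeighted h q a b) q :=
  (differentiableAt_surfaceDensity hU hh hq).fun_mul
    (differentiableAt_of_contDiffOn hU (contDiffOn_inv_apply hh.smooth hh.nondeg a b) hq)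

/-- The logarithmic derivative of `det h` along a homothetic field. -/
lemma sum_pd_det_of_homothetic (hU : IsOpen U) (hh : IsMetricOn U h)
    (hC : ∀ q ∈ U, lieMetric u h q = -C • h q) (hq : q ∈ U) :
    ∑ k, u q k * pd k (fun q => (h q).det) q =
      -2 * (C + ∑ k, pd k (fun q => u q k) q) * (h q).det := by
  have e := fun i j => congrFun (congrFun (hC q hq) i) j
  simp only [lieMetric, Matrix.of_apply, Fin.sum_univ_two, Matrix.smul_apply, smul_eq_mul] at e
  simp only [pd_det hU hh hq]
  simp only [Matrix.det_fin_two, Fin.sum_univ_two, (hh.symm q hq).apply 0 1]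
  have e00 := e 0 0
  have e01 := e 0 1
  have e11 := e 1 1
  simp only [(hh.symm q hq).apply 0 1] at e00 e01 e11
  linear_combination h q 1 1 * e00 + h q 0 0 * e11 - 2 * h q 0 1 * e01

/-- The density `|det h|^{1/4}` is rescaled by a homothetic field. -/
lemma lie_surfaceDensity (hU : IsOpen U) (hh : IsMetricOn U h)
    (hC : ∀ q ∈ U, lieMetric u h q = -C • h q) (hq : q ∈ U) :
    ∑ k, (u q k * pd k (surfaceDensity h) q +
      1 / 2 * pd k (fun q => u q k) q * surfaceDensity h q) = -C / 2 * surfaceDensity h q := by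
  have hd := hh.nondeg q hq
  have h1 := sum_pd_det_of_homothetic hU hh hC hq
  simp only [pd_surfaceDensity hU hh hq, Fin.sum_univ_two] at h1 ⊢
  field_simp
  linear_combination 2 * surfaceDensity h q * h1

/-- The weighted inverse `|det h|^{1/4} h⁻¹` is rescaled by a homothetic field. -/
lemma lie_surfaceWeighted (hU : IsOpen U) (hh : IsMetricOn U h)
    (hC : ∀ q ∈ U, lieMetric u h q = -C • h q) (hq : q ∈ U) (a b : Fin 2) :
    ∑ k, (u q k * pd k (fun q => surfaceWeighted h q a b) q -
      pd k (fun q => u q a) q * surfaceWeighted h q k b -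
      pd k (fun q => u q b) q * surfaceWeighted h q a k +
      1 / 2 * pd k (fun q => u q k) q * surfaceWeighted h q a b) =
      C / 2 * surfaceWeighted h q a b := by
  have hd := hh.nondeg q hq
  have dw := differentiableAt_surfaceDensity hU hh hq
  have ddet := differentiableAt_det hU hh hq
  have dh : ∀ a b, DifferentiableAt ℝ (fun q => h q a b) q := fun a b =>
    differentiableAt_of_contDiffOn hU (hh.smooth a b) hq
  have dinv : DifferentiableAt ℝ (fun q => ((h q).det)⁻¹) q := ddet.inv hd
  have hinv : ∀ k, pd k (fun q => ((h q).det)⁻¹) q =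
      -pd k (fun q => (h q).det) q / (h q).det ^ 2 := fun k => by
    have := (hasDerivAt_inv hd).comp_hasFDerivAt q ddet.hasFDerivAt
    rw [pd, show fderiv ℝ (fun q => ((h q).det)⁻¹) q = _ from this.fderiv, pd, smul_apply,
      smul_eq_mul]
    ring
  -- the adjugate has the same entries as `h`, up to order and sign
  have hN : ∀ (N : (Fin 2 → ℝ) → ℝ), DifferentiableAt ℝ N q → ∀ k,
      pd k (fun q => surfaceDensity h q * (((h q).det)⁻¹ * N q)) q =
        -(3 / 4) * surfaceDensity h q / (h q).det ^ 2 * pd k (fun q => (h q).det) q * N q +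
          surfaceDensity h q / (h q).det * pd k N q := fun N hN k => by
    rw [pd_mul dw (dinv.fun_mul hN), pd_mul dinv hN, hinv, pd_surfaceDensity hU hh hq]
    field_simp
    ring
  have hW : ∀ q a b, surfaceWeighted h q a b = surfaceDensity h q *
      (((h q).det)⁻¹ * (!![h q 1 1, -h q 0 1; -h q 1 0, h q 0 0] : Matrix _ _ ℝ) a b) := by
    intro q a b
    rw [surfaceWeighted, Matrix.inv_def, Matrix.adjugate_fin_two, Ring.inverse_eq_inv']
    rfl
  have h1 := sum_pd_det_of_homothetic hU hh hC hq
  have e := fun i j => congrFun (congrFun (hC q hq) i) j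
  simp only [lieMetric, Matrix.of_apply, Fin.sum_univ_two, Matrix.smul_apply, smul_eq_mul] at e
  have e00 := e 0 0
  have e01 := e 0 1
  have e10 := e 1 0
  have e11 := e 1 1
  have hneg : ∀ a b k, pd k (fun q => -h q a b) q = -pd k (fun q => h q a b) q := fun a b k => by
    have := pd_const_mul (dh a b) (-1) k
    simpa using this
  set w := surfaceDensity h q
  set d := (h q).det
  have key : -(3 / 4) * w / d ^ 2 * (∑ k, u q k * pd k (fun q => (h q).det) q) =
      3 / 2 * (C + ∑ k, pd k (fun q => u q k) q) * w * d⁻¹ := by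
    rw [h1]
    field_simp
    ring
  rw [Fin.sum_univ_two, Fin.sum_univ_two] at key
  obtain rfl | rfl : a = 0 ∨ a = 1 := by omega
  all_goals obtain rfl | rfl : b = 0 ∨ b = 1 := by omega
  all_goals simp only [hW, Fin.sum_univ_two, Matrix.of_apply, Matrix.cons_val', Matrix.cons_val_zero,
    Matrix.cons_val_one, Matrix.cons_val_fin_one]
  · simp only [hN _ (dh 1 1)]
    linear_combination h q 1 1 * key + w * d⁻¹ * e11
  · simp only [hN _ (dh 0 1).fun_neg, hneg]
    linear_combination -h q 0 1 * key - w * d⁻¹ * e01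
  · simp only [hN _ (dh 1 0).fun_neg, hneg]
    linear_combination -h q 1 0 * key - w * d⁻¹ * e10
  · simp only [hN _ (dh 0 0)]
    linear_combination h q 0 0 * key + w * d⁻¹ * e00

end Surface

/-- The `z`-dependent factor of the weighted tensor of `ζ (h + dz²)`. -/
noncomputable def fibreFactor (ζ : ℝ → ℝ) (z : ℝ) : ℝ := |ζ z ^ 3| ^ (1 / 4 : ℝ) * (ζ z)⁻¹

/-- A weighted tensor whose horizontal part is `F₁(z) |det h|^{1/4} h⁻¹` and whose vertical part is
`F₂(z) |det h|^{1/4} ∂_z²`. -/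
noncomputable def splitWeighted (h : (Fin 2 → ℝ) → Matrix (Fin 2) (Fin 2) ℝ) (F₁ F₂ : ℝ → ℝ)
    (p : Fin 2 ⊕ Fin 1 → ℝ) : Matrix (Fin 2 ⊕ Fin 1) (Fin 2 ⊕ Fin 1) ℝ :=
  Matrix.fromBlocks (F₁ (p (Sum.inr 0)) • surfaceWeighted h (p ∘ Sum.inl)) 0 0
    ((F₂ (p (Sum.inr 0)) * surfaceDensity h (p ∘ Sum.inl)) • 1)

lemma lieWeighted_congr {ι : Type} [Fintype ι] [DecidableEq ι] {M : Set (ι → ℝ)} (hM : IsOpen M)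
    (v : (ι → ℝ) → ι → ℝ) {σ τ : (ι → ℝ) → Matrix ι ι ℝ} (hστ : EqOn σ τ M) {p : ι → ℝ}
    (hp : p ∈ M) : lieWeighted v σ p = lieWeighted v τ p := by
  ext i j
  simp only [lieWeighted, Matrix.of_apply]
  refine Finset.sum_congr rfl fun k _ => ?_
  rw [pd_congr hM (f' := fun q => τ q i j) (fun q hq => by simp only [hστ hq]) hp, hστ hp]

namespace IsData

variable {ζ : ℝ → ℝ} (D : IsData U I h ζ) {u : (Fin 2 → ℝ) → Fin 2 → ℝ} {α : ℝ → ℝ}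

include D

lemma hasDerivAt_fibreFactor {z : ℝ} (hz : z ∈ I) :
    HasDerivAt (fibreFactor ζ) (-(1 / 4) * (deriv ζ z / ζ z) * fibreFactor ζ z) z := by
  have h0 := D.ne_zero z hz
  have h1 := (D.diff_ζ hz).hasDerivAt
  have h2 := hasFDerivAt_abs_rpow (h1.fun_pow 3).hasFDerivAt (pow_ne_zero 3 h0) (1 / 4 : ℝ)
  refine (h2.hasDerivAt.mul (h1.fun_inv h0)).congr_deriv ?_
  simp [fibreFactor]
  field_simp
  ring

lemma fibreFactor_ne_zero {z : ℝ} (hz : z ∈ I) : fibreFactor ζ z ≠ 0 := by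
  have h0 := D.ne_zero z hz
  have h1 : 0 < |ζ z ^ 3| := abs_pos.2 (pow_ne_zero 3 h0)
  exact mul_ne_zero (Real.rpow_pos_of_pos h1 _).ne' (inv_ne_zero h0)

lemma surfaceDensity_ne_zero {q : Fin 2 → ℝ} (hq : q ∈ U) : surfaceDensity h q ≠ 0 :=
  (Real.rpow_pos_of_pos (abs_pos.2 (D.metric.nondeg q hq)) _).ne'

lemma weightedInverse_metric21 :
    EqOn (weightedInverse (metric21 h ζ)) (splitWeighted h (fibreFactor ζ) (fibreFactor ζ))
      (prodDomain U I) := by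
  intro p hp
  have h0 := D.ne_zero _ hp.2
  have hdet : |(metric21 h ζ p).det| ^ (1 / ((Fintype.card (Fin 2 ⊕ Fin 1) : ℝ) + 1)) =
      |ζ (p (Sum.inr 0)) ^ 3| ^ (1 / 4 : ℝ) * surfaceDensity h (p ∘ Sum.inl) := by
    have hcard : (1 / ((Fintype.card (Fin 2 ⊕ Fin 1) : ℝ) + 1)) = (1 / 4 : ℝ) := by
      simp; norm_num
    rw [hcard, surfaceDensity, ← Real.mul_rpow (abs_nonneg _) (abs_nonneg _), ← abs_mul]
    simp only [metric21, Matrix.det_smul, Matrix.det_fromBlocks_zero₂₁, Matrix.det_one, mul_one,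
      Fintype.card_sum, Fintype.card_fin]
  simp only [weightedInverse]
  rw [hdet, metric21_inv h0 (D.metric.nondeg _ hp.1), splitWeighted, Matrix.fromBlocks_smul,
    surfaceWeighted]
  simp only [smul_smul, smul_zero, fibreFactor]
  congr 2 <;> ring

/-- The Lie derivative of a split weighted tensor along a field whose horizontal part is
homothetic. -/
lemma lieWeighted_splitWeighted (hu : ContDiffOn ℝ ∞ u U) (hα : ContDiffOn ℝ ∞ α I) {C : ℝ}
    (hC : ∀ q ∈ U, lieMetric u h q = -C • h q) {F₁ F₂ : ℝ → ℝ} {p : Fin 2 ⊕ Fin 1 → ℝ}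
    (hp : p ∈ prodDomain U I) (hF₁ : DifferentiableAt ℝ F₁ (p (Sum.inr 0)))
    (hF₂ : DifferentiableAt ℝ F₂ (p (Sum.inr 0))) :
    lieWeighted (field21 u α) (splitWeighted h F₁ F₂) p =
      splitWeighted h (fun z => C / 2 * F₁ z + α z * deriv F₁ z + 1 / 2 * deriv α z * F₁ z)
        (fun z => -C / 2 * F₂ z + α z * deriv F₂ z - 3 / 2 * deriv α z * F₂ z) p := by
  have du := D.diff_field_inl hp hu
  have dα := D.diff_field_inr hp hα
  have dW := differentiableAt_surfaceWeighted D.openU D.metric hp.1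
  have dw := differentiableAt_surfaceDensity D.openU D.metric hp.1
  have s11 : ∀ a b, (fun p => splitWeighted h F₁ F₂ p (Sum.inl a) (Sum.inl b)) =
      fun p => F₁ (p (Sum.inr 0)) * surfaceWeighted h (p ∘ Sum.inl) a b := fun a b => rfl
  have s12 : ∀ a e, (fun p => splitWeighted h F₁ F₂ p (Sum.inl a) (Sum.inr e)) = fun _ => 0 :=
    fun a e => rfl
  have s21 : ∀ a e, (fun p => splitWeighted h F₁ F₂ p (Sum.inr e) (Sum.inl a)) = fun _ => 0 :=
    fun a e => rfl
  have s22 : ∀ d e, (fun p => splitWeighted h F₁ F₂ p (Sum.inr d) (Sum.inr e)) =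
      fun p => F₂ (p (Sum.inr 0)) * surfaceDensity h (p ∘ Sum.inl) := fun d e => by
    funext p
    simp [splitWeighted, Subsingleton.elim d e]
  have hcard : (2 : ℝ) / ((Fintype.card (Fin 2 ⊕ Fin 1) : ℝ) + 1) = 1 / 2 := by
    simp; norm_num
  ext i j
  simp only [lieWeighted, Matrix.of_apply, Fintype.sum_sum_type, hcard]
  rcases i with a | d <;> rcases j with b | e
  · have hL := lie_surfaceWeighted D.openU D.metric hC hp.1 a b
    simp only [s11, pd_inl_mul hF₁ (dW _ _), pd_inr_mul hF₁ (dW _ _), pd_inl_field21_inl (du _),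
      pd_inr_field21_inl (du _), pd_inr_field21_inr dα, Fin.sum_univ_two] at hL ⊢
    simp [splitWeighted, field21]
    linear_combination F₁ (p (Sum.inr 0)) * hL
  · simp only [s12, pd_const, pd_inl_field21_inr dα, pd_inr_field21_inl (du _)]
    simp [splitWeighted]
  · simp only [s21, pd_const, pd_inl_field21_inr dα, pd_inr_field21_inl (du _)]
    simp [splitWeighted]
  · have hL := lie_surfaceDensity D.openU D.metric hC hp.1
    simp only [s22, pd_inl_mul hF₂ dw, pd_inr_mul hF₂ dw, pd_inl_field21_inl (du _),
      pd_inl_field21_inr dα, pd_inr_field21_inr dα, Fin.sum_univ_two] at hL ⊢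
    simp [splitWeighted, field21, Subsingleton.elim d e, Subsingleton.elim e 0]
    linear_combination F₂ (p (Sum.inr 0)) * hL

lemma splitWeighted_injective {F₁ F₂ G₁ G₂ : ℝ → ℝ} {p : Fin 2 ⊕ Fin 1 → ℝ}
    (hp : p ∈ prodDomain U I) (heq : splitWeighted h F₁ F₂ p = splitWeighted h G₁ G₂ p) :
    F₁ (p (Sum.inr 0)) = G₁ (p (Sum.inr 0)) ∧ F₂ (p (Sum.inr 0)) = G₂ (p (Sum.inr 0)) := by
  have hw := D.surfaceDensity_ne_zero hp.1
  obtain ⟨h1, -, -, h2⟩ := Matrix.fromBlocks_inj.1 heq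
  constructor
  · have h3 := congrArg (fun A => (A * h (p ∘ Sum.inl)) 0 0) h1
    simp only [surfaceWeighted, Matrix.smul_mul, Matrix.smul_apply, smul_eq_mul,
      Matrix.nonsing_inv_mul _ (isUnit_iff_ne_zero.mpr (D.metric.nondeg _ hp.1)),
      Matrix.one_apply_eq, mul_one] at h3
    exact mul_right_cancel₀ hw h3
  · have h3 := congrFun (congrFun h2 0) 0
    simp only [Matrix.smul_apply, smul_eq_mul, Matrix.one_apply_eq, mul_one] at h3
    exact mul_right_cancel₀ hw h3

end IsData

lemma splitWeighted_combination (F₁ F₂ G₁ G₂ : ℝ → ℝ) (x y : ℝ) (p : Fin 2 ⊕ Fin 1 → ℝ) :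
    x • splitWeighted h F₁ F₂ p + y • splitWeighted h G₁ G₂ p =
      splitWeighted h (fun z => x * F₁ z + y * G₁ z) (fun z => x * F₂ z + y * G₂ z) p := by
  simp only [splitWeighted, Matrix.fromBlocks_smul, Matrix.fromBlocks_add, smul_smul, smul_zero,
    add_zero, ← add_smul]
  congr 2
  ring

lemma splitWeighted_congr {F₁ F₂ G₁ G₂ : ℝ → ℝ} {p : Fin 2 ⊕ Fin 1 → ℝ}
    (h1 : F₁ (p (Sum.inr 0)) = G₁ (p (Sum.inr 0)))
    (h2 : F₂ (p (Sum.inr 0)) = G₂ (p (Sum.inr 0))) :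
    splitWeighted h F₁ F₂ p = splitWeighted h G₁ G₂ p := by
  rw [splitWeighted, splitWeighted, h1, h2]

section Action

variable {ρ : ℝ} {Z : ℝ → ℝ} (D : IsData U I h fun z => Z z - ρ)

include D

lemma IsData.sigmaBar21_eq :
    EqOn (sigmaBar21 h ρ Z) (splitWeighted h (fun z => ρ * fibreFactor (fun z => Z z - ρ) z)
      fun z => Z z * fibreFactor (fun z => Z z - ρ) z) (prodDomain U I) := by
  intro p hp
  rw [sigmaBar21, sigma21, D.weightedInverse_metric21 hp]
  simp only [benenti21, splitWeighted, Matrix.fromBlocks_multiply]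
  simp [smul_smul, mul_assoc]
  exact ⟨by rw [mul_comm], by ring⟩

variable {u : (Fin 2 → ℝ) → Fin 2 → ℝ} {α : ℝ → ℝ} {C b B : ℝ}

/-- The action of `L_v` on the pair of weighted tensors, for a projective extension of a
homothetic field. -/
theorem IsData.lieActsBy_iff (hUn : U.Nonempty) (hIn : I.Nonempty) (hu : ContDiffOn ℝ ∞ u U)
    (hα : ContDiffOn ℝ ∞ α I) (hC : ∀ q ∈ U, lieMetric u h q = -C • h q)
    (hode : ∀ z ∈ I, -2 * deriv α z = C + b * (Z z - ρ) ∧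
      α z * deriv (fun z => Z z - ρ) z = -b * (Z z - ρ) ^ 2 + (2 * B - C) * (Z z - ρ))
    (A : Matrix (Fin 2) (Fin 2) ℝ) :
    LieActsBy (prodDomain U I) (field21 u α) (sigma21 h ρ Z) (sigmaBar21 h ρ Z) A ↔
      A = !![(C - B) / 2 - b * ρ, b;
        ρ * ((C - B) / 2 - (2 * B - C + (C - B) / 2 + b * ρ)),
        2 * B - C + (C - B) / 2 + b * ρ] := by
  set s := fibreFactor fun z => Z z - ρ with hs
  have hσ : EqOn (sigma21 h ρ Z) (splitWeighted h s s) (prodDomain U I) :=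
    D.weightedInverse_metric21
  have hσ' := D.sigmaBar21_eq
  have hZ : ∀ z ∈ I, HasDerivAt Z (deriv (fun z => Z z - ρ) z) z := fun z hz => by
    simpa using (D.diff_ζ hz).hasDerivAt.add_const ρ
  -- the factors of `L_v σ` and `L_v σ'`
  have hlie : ∀ p ∈ prodDomain U I, lieWeighted (field21 u α) (sigma21 h ρ Z) p =
      splitWeighted h (fun z => (C - B) / 2 * s z)
        (fun z => ((C - B) / 2 + b * (Z z - ρ)) * s z) p := by
    intro p hp
    have hz := hp.2
    have h0 := D.ne_zero _ hz
    have ds := D.hasDerivAt_fibreFactor hz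
    obtain ⟨o1, o2⟩ := hode _ hz
    have o3 : α (p (Sum.inr 0)) * (deriv (fun z => Z z - ρ) (p (Sum.inr 0)) /
        (Z (p (Sum.inr 0)) - ρ)) = -b * (Z (p (Sum.inr 0)) - ρ) + (2 * B - C) := by
      rw [mul_div_assoc', o2]
      field_simp
    rw [lieWeighted_congr D.isOpen _ hσ hp, D.lieWeighted_splitWeighted hu hα hC hp
      ds.differentiableAt ds.differentiableAt]
    refine splitWeighted_congr ?_ ?_
    · rw [ds.deriv]
      linear_combination -(1 / 4) * s (p (Sum.inr 0)) * o3 - 1 / 4 * s (p (Sum.inr 0)) * o1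
    · rw [ds.deriv]
      linear_combination -(1 / 4) * s (p (Sum.inr 0)) * o3 + 3 / 4 * s (p (Sum.inr 0)) * o1
  have hlie' : ∀ p ∈ prodDomain U I, lieWeighted (field21 u α) (sigmaBar21 h ρ Z) p =
      splitWeighted h (fun z => ρ * ((C - B) / 2) * s z)
        (fun z => (ρ * ((C - B) / 2) + (2 * B - C + (C - B) / 2 + b * ρ) * (Z z - ρ)) * s z) p := by
    intro p hp
    have hz := hp.2
    have h0 := D.ne_zero _ hz
    have ds := D.hasDerivAt_fibreFactor hz
    have ds1 : HasDerivAt (fun z => ρ * s z) _ (p (Sum.inr 0)) := ds.const_mul ρ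
    have ds2 : HasDerivAt (fun z => Z z * s z) _ (p (Sum.inr 0)) := (hZ _ hz).mul ds
    obtain ⟨o1, o2⟩ := hode _ hz
    have o3 : α (p (Sum.inr 0)) * (deriv (fun z => Z z - ρ) (p (Sum.inr 0)) /
        (Z (p (Sum.inr 0)) - ρ)) = -b * (Z (p (Sum.inr 0)) - ρ) + (2 * B - C) := by
      rw [mul_div_assoc', o2]
      field_simp
    rw [lieWeighted_congr D.isOpen _ hσ' hp, D.lieWeighted_splitWeighted hu hα hC hp
      ds1.differentiableAt ds2.differentiableAt]
    refine splitWeighted_congr ?_ ?_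
    · rw [ds1.deriv]
      linear_combination -(1 / 4) * ρ * s (p (Sum.inr 0)) * o3 -
        1 / 4 * ρ * s (p (Sum.inr 0)) * o1
    · rw [ds2.deriv]
      linear_combination -(1 / 4) * Z (p (Sum.inr 0)) * s (p (Sum.inr 0)) * o3 +
        3 / 4 * Z (p (Sum.inr 0)) * s (p (Sum.inr 0)) * o1 + s (p (Sum.inr 0)) * o2
  have hcomb : ∀ p ∈ prodDomain U I, ∀ x y : ℝ, x • sigma21 h ρ Z p + y • sigmaBar21 h ρ Z p =
      splitWeighted h (fun z => x * s z + y * (ρ * s z)) (fun z => x * s z + y * (Z z * s z)) p :=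
    fun p hp x y => by
      rw [hσ hp, hσ' hp, splitWeighted_combination]
  constructor
  · intro hA
    obtain ⟨q, hq⟩ := hUn
    obtain ⟨z, hz⟩ := hIn
    have hp : (Sum.elim q fun _ => z : Fin 2 ⊕ Fin 1 → ℝ) ∈ prodDomain U I := ⟨hq, hz⟩
    obtain ⟨a1, a2⟩ := hA _ hp
    rw [hlie _ hp, hcomb _ hp] at a1
    rw [hlie' _ hp, hcomb _ hp] at a2
    obtain ⟨b1, b2⟩ := D.splitWeighted_injective hp a1
    obtain ⟨c1, c2⟩ := D.splitWeighted_injective hp a2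
    simp only [Sum.elim_inr] at b1 b2 c1 c2
    have hs0 : s z ≠ 0 := D.fibreFactor_ne_zero hz
    have h0 : Z z - ρ ≠ 0 := D.ne_zero z hz
    have hs1 : s z * (Z z - ρ) ≠ 0 := mul_ne_zero hs0 h0
    have e01 : A 0 1 = b := mul_left_cancel₀ hs1 (by linear_combination b1 - b2)
    have e11 : A 1 1 = 2 * B - C + (C - B) / 2 + b * ρ :=
      mul_left_cancel₀ hs1 (by linear_combination c1 - c2)
    have e00 : A 0 0 = (C - B) / 2 - b * ρ :=
      mul_left_cancel₀ hs0 (by rw [e01] at b1; linear_combination -b1)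
    have e10 : A 1 0 = ρ * ((C - B) / 2 - (2 * B - C + (C - B) / 2 + b * ρ)) :=
      mul_left_cancel₀ hs0 (by rw [e11] at c1; linear_combination -c1)
    rw [Matrix.eta_fin_two A, e00, e01, e10, e11]
  · rintro rfl p hp
    rw [hlie p hp, hlie' p hp, hcomb p hp, hcomb p hp]
    constructor
    · refine splitWeighted_congr ?_ ?_ <;> simp <;> ring
    · refine splitWeighted_congr ?_ ?_ <;> simp <;> ring

end Action

end Weighted

end LeviCivita21

open LeviCivita21 in
theorem proposition6p5
    (U : Set (Fin 2 → ℝ)) (hU : IsOpen U) (hUc : IsConnected U)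
    (I : Set ℝ) (hI : IsOpen I) (hIc : IsConnected I)
    (h : (Fin 2 → ℝ) → Matrix (Fin 2) (Fin 2) ℝ) (hh : IsMetricOn U h)
    (Z : ℝ → ℝ) (hZ : ContDiffOn ℝ ∞ Z I) (ρ : ℝ)
    (ζ : ℝ → ℝ) (hζ : ζ = fun z => Z z - ρ) (hζ0 : ∀ z ∈ I, ζ z ≠ 0)
    (u : (Fin 2 → ℝ) → Fin 2 → ℝ) (hu : ContDiffOn ℝ ∞ u U)
    (α : ℝ → ℝ) (hα : ContDiffOn ℝ ∞ α I) :
    -- a projective field descends to a homothety of `h`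
    (¬ HasConstantCurvature (prodDomain U I) (metric21 h ζ) →
      IsProjective (prodDomain U I) (metric21 h ζ) (field21 u α) →
      ∃ a b c d : ℝ,
        (∀ A, LieActsBy (prodDomain U I) (field21 u α) (sigma21 h ρ Z) (sigmaBar21 h ρ Z) A ↔
          A = !![a, b; c, d]) ∧
        ∀ q ∈ U, lieMetric u h q = -(2 * b * ρ + 3 * a + d) • h q) ∧
    -- conversely: which fields that extend a homothety of `h` are projective
    (∀ C : ℝ, (∀ q ∈ U, lieMetric u h q = -C • h q) →
      (IsProjective (prodDomain U I) (metric21 h ζ) (field21 u α) ↔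
        ∃ a b c d : ℝ,
          (∀ A, LieActsBy (prodDomain U I) (field21 u α) (sigma21 h ρ Z) (sigmaBar21 h ρ Z) A ↔
            A = !![a, b; c, d]) ∧
          C = 2 * b * ρ + 3 * a + d ∧
          ∀ z ∈ I, -2 * deriv α z = C + b * ζ z ∧
            α z * deriv ζ z = -b * ζ z ^ 2 + (2 * (a + d) - C) * ζ z) ∧
      ∀ b B : ℝ,
        (∀ z ∈ I, -2 * deriv α z = C + b * ζ z ∧
          α z * deriv ζ z = -b * ζ z ^ 2 + (2 * B - C) * ζ z) →
        IsProjective (prodDomain U I) (metric21 h ζ) (field21 u α)) := by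
  subst hζ
  have D : IsData U I h fun z => Z z - ρ :=
    ⟨hU, hI, hh, hZ.sub contDiffOn_const, hζ0⟩
  have main : ∀ C : ℝ, (∀ q ∈ U, lieMetric u h q = -C • h q) →
      IsProjective (prodDomain U I) (metric21 h fun z => Z z - ρ) (field21 u α) →
      ∃ a b c d : ℝ,
        (∀ A, LieActsBy (prodDomain U I) (field21 u α) (sigma21 h ρ Z) (sigmaBar21 h ρ Z) A ↔
          A = !![a, b; c, d]) ∧
        C = 2 * b * ρ + 3 * a + d ∧
        ∀ z ∈ I, -2 * deriv α z = C + b * (Z z - ρ) ∧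
          α z * deriv (fun z => Z z - ρ) z =
            -b * (Z z - ρ) ^ 2 + (2 * (a + d) - C) * (Z z - ρ) := by
    intro C hC hproj
    obtain ⟨b, B, hode⟩ := D.exists_ode_of_isProjective hα hUc.nonempty hIc hu hproj hC
    refine ⟨_, _, _, _, D.lieActsBy_iff hUc.nonempty hIc.nonempty hu hα hC hode, by ring,
      fun z hz => ⟨(hode z hz).1, ?_⟩⟩
    rw [(hode z hz).2]
    ring
  refine ⟨fun hcurv hproj => ?_, fun C hC => ⟨⟨main C hC, ?_⟩, fun b B hode => ?_⟩⟩
  · obtain ⟨C, hC⟩ := D.exists_homothetic_of_isProjective hu hα hUc hIc.nonempty hcurv hproj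
    obtain ⟨a, b, c, d, hA, hCeq, -⟩ := main C hC hproj
    exact ⟨a, b, c, d, hA, fun q hq => by rw [hC q hq, hCeq]⟩
  · rintro ⟨a, b, c, d, -, -, hode⟩
    exact D.isProjective_of_ode hα hu hC hode
  · exact D.isProjective_of_ode hα hu hC hode
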